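/- Let $H_1,H_2\in(0,1)$ with $H:=H_1+H_2>\tfrac32$, and let $\alpha_1,\alpha_2,\nu_1,\nu_2>0$. Let $(B^1_t,B^2_t)_{t\in\mathbb R}$ be a bivariate fractional Brownian motion with Hurst indices $(H_1,H_2)$: a centred, jointly Gaussian process whose components are fractional Brownian motions with Hurst indices $H_1,H_2$ and unit variance at time $1$, which is jointly self-similar, $(B^1_{\lambda t},B^2_{\lambda t})_t\overset{d}{=}(\lambda^{H_1}B^1_t,\lambda^{H_2}B^2_t)_t$ for all $\lambda>0$, and has stationary increments (both in the sense of finite-dimensional distributions). Let $\rho=\mathrm{Corr}(B^1_1,B^2_1)$ and let $\eta_{12}=\dfrac{\mathrm{Cov}(B^1_1,B^2_{-1})-\mathrm{Cov}(B^1_{-1},B^2_1)}{2-2^H}$ be its second cross-correlation parameter, i.e. the number for which $$\mathrm{Cov}(B^1_t,B^2_u)=\tfrac12\big((\rho+\mathrm{sign}(t)\eta_{12})|t|^H+(\rho-\mathrm{sign}(u)\eta_{12})|u|^H-(\rho-\mathrm{sign}(u-t)\eta_{12})|u-t|^H\big),\qquad t,u\in\mathbb R .$$ Let $Y=(Y^1,Y^2)$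 be the bivariate fractional Ornstein–Uhlenbeck process driven by $(B^1,B^2)$: the centred Gaussian process with $Y^i_t=\nu_i\int_{-\infty}^t e^{-\alpha_i(t-u)}\,dB^i_u$ (pathwise improper Riemann–Stieltjes integral). Let $s\in\mathbb N$, let $a_1,a_2,a_3\in\mathbb R$ with $a_1+a_2+a_3\ne0$, and put $$\tilde S_n=n^{1-H}\sum_{k=1}^n\big(a_1Y^1_kY^2_k+a_2Y^1_{k+s}Y^2_k+a_3Y^1_kY^2_{k+s}-\rho\big).$$ Then all moments of $\tilde S_n$ are finite, and for every $p\ge2$ the cumulant $\kappa_p(\tilde S_n)=(-i)^p\frac{d^p}{dt^p}\big|_{t=0}\log\mathbb E[e^{it\tilde S_n}]$ satisfies $$\lim_{n\to\infty}\kappa_p(\tilde S_n)=2^{p-1}(p-1)!\,(a_1+a_2+a_3)^p\sum_{\substack{i_1,\dots,i_p,\,j_1,\dots,j_p\in\{1,2\}\\ i_2\ne j_1,\dots,i_p\ne j_{p-1},\,i_1\ne j_p}}\int_{[0,1]^p}z_{i_1j_1}(x_1,x_2)\,z_{i_2j_2}(x_2,x_3)\cdots z_{i_pj_p}(x_p,x_1)\,dx,$$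 where the integrals converge absolutely and $$z_{ii}(x,y)=\frac{\nu_i^2H_i(2H_i-1)}{2\alpha_i^2}|x-y|^{2H_i-2}\quad(i=1,2),$$ $$z_{12}(x,y)=\frac{\nu_1\nu_2H(H-1)}{4\alpha_1\alpha_2}\begin{cases}(\rho-\eta_{12})(x-y)^{H-2}&x>y\\(\rho+\eta_{12})(y-x)^{H-2}&x\le y,\end{cases}\qquad z_{21}(x,y)=\frac{\nu_1\nu_2H(H-1)}{4\alpha_1\alpha_2}\begin{cases}(\rho+\eta_{12})(x-y)^{H-2}&x>y\\(\rho-\eta_{12})(y-x)^{H-2}&x\le y.\end{cases}$$ Moreover $$\lim_{n\to\infty}\frac{\mathrm{Var}(\tilde S_n)}{(a_1+a_2+a_3)^2}=\frac{\nu_1^2\nu_2^2\big((\rho^2-\eta_{12}^2)H^2(H-1)^2+4H_1H_2(2H_1-1)(2H_2-1)\big)}{2\alpha_1^2\alpha_2^2(2H-3)(2H-2)}>0 .$$ -/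

import Mathlib

open MeasureTheory ProbabilityTheory Filter Topology

noncomputable section

/-- `X` is a fractional Brownian motion on the real line with Hurst index `H` and unit variance at
time `1`: a centred Gaussian process with the usual covariance function. -/
structure IsFBM {Ω : Type*} [MeasurableSpace Ω] (X : ℝ → Ω → ℝ) (H : ℝ) (P : Measure Ω) :
    Prop where
  gaussian : IsGaussianProcess X P
  centered : ∀ t, ∫ ω, X t ω ∂P = 0
  covariance : ∀ t s,
    cov[X t, X s; P] = (|t| ^ (2 * H) + |s| ^ (2 * H) - |t - s| ^ (2 * H)) / 2

/-- A multivariate fractional Brownian motion with Hurst indices `H i` (unit variances at time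
`1`): a centred, jointly Gaussian process whose components are fractional Brownian motions, which
is jointly self-similar and has stationary increments, both in the sense of finite-dimensional
distributions. -/
structure IsMfBm {ι Ω : Type*} [MeasurableSpace Ω] (B : ι → ℝ → Ω → ℝ) (H : ι → ℝ)
    (P : Measure Ω) : Prop where
  gaussian : IsGaussianProcess (fun q : ι × ℝ => B q.1 q.2) P
  fbm : ∀ i, IsFBM (B i) (H i) P
  selfSimilar : ∀ c : ℝ, 0 < c → ∀ T : Finset ℝ,
    IdentDistrib (fun ω (q : ι × T) => B q.1 (c * q.2) ω)
      (fun ω (q : ι × T) => c ^ H q.1 * B q.1 q.2 ω) P P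
  stationaryIncrements : ∀ h : ℝ, ∀ T : Finset ℝ,
    IdentDistrib (fun ω (q : ι × T) => B q.1 (q.2 + h) ω - B q.1 h ω)
      (fun ω (q : ι × T) => B q.1 q.2 ω - B q.1 0 ω) P P

/-- The correlation parameter `ρ` of a bivariate fractional Brownian motion: the correlation of
its components at time `1` (their variances there are `1`). -/
def mfBmRho {Ω : Type*} [MeasurableSpace Ω] (B : Fin 2 → ℝ → Ω → ℝ) (P : Measure Ω) : ℝ :=
  cov[B 0 1, B 1 1; P]

/-- The asymmetry parameter `η₁₂` of a bivariate fractional Brownian motion with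
`H 0 + H 1 ≠ 1`. It is the only value for which the cross-covariance of the two components can
have its known form `mfBmCrossCov`, see `mfBmEta_eq`. -/
def mfBmEta {Ω : Type*} [MeasurableSpace Ω] (B : Fin 2 → ℝ → Ω → ℝ) (H : Fin 2 → ℝ)
    (P : Measure Ω) : ℝ :=
  (cov[B 0 1, B 1 (-1); P] - cov[B 0 (-1), B 1 1; P]) / (2 - (2 : ℝ) ^ (H 0 + H 1))

/-- The sign function with value `1` at `0`. -/
def sgn (x : ℝ) : ℝ := if 0 ≤ x then 1 else -1

/-- The general form of `Cov(B¹_t, B²_s)` for a bivariate fractional Brownian motion with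
parameters `ρ`, `η = η₁₂` and `h = H₁ + H₂ ≠ 1`. -/
def mfBmCrossCov (ρ η h t s : ℝ) : ℝ :=
  ((ρ + sgn t * η) * |t| ^ h + (ρ - sgn s * η) * |s| ^ h
    - (ρ - sgn (s - t) * η) * |s - t| ^ h) / 2

/-- Wherever the cross-covariance has the general form with parameters `ρ` and `η`, these are the
numbers `mfBmRho` and `mfBmEta`. -/
theorem mfBmEta_eq {Ω : Type*} [MeasurableSpace Ω] (B : Fin 2 → ℝ → Ω → ℝ) (H : Fin 2 → ℝ)
    (P : Measure Ω) (ρ η : ℝ) (h1 : H 0 + H 1 ≠ 1) (h0 : 0 < H 0 + H 1)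
    (hc : ∀ t s, cov[B 0 t, B 1 s; P] = mfBmCrossCov ρ η (H 0 + H 1) t s) :
    mfBmRho B P = ρ ∧ mfBmEta B H P = η := by
  have hne : (2 : ℝ) - (2 : ℝ) ^ (H 0 + H 1) ≠ 0 := by
    intro h
    apply h1
    have h2 : (2 : ℝ) ^ (H 0 + H 1) = (2 : ℝ) ^ (1 : ℝ) := by
      rw [Real.rpow_one]; linarith
    exact (Real.strictMono_rpow_of_base_gt_one (by norm_num : (1 : ℝ) < 2)).injective h2
  constructor
  · rw [mfBmRho, hc]
    simp [mfBmCrossCov, sgn, Real.zero_rpow h0.ne']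
  · rw [mfBmEta, hc, hc, div_eq_iff hne]
    norm_num [mfBmCrossCov, sgn]
    ring

/-- `∫_a^b f dg = I` as a Riemann–Stieltjes integral: the sums over tagged partitions of `[a, b]`
converge to `I` as the mesh tends to `0`. -/
def HasRSIntegral (f g : ℝ → ℝ) (a b I : ℝ) : Prop :=
  ∀ ε > 0, ∃ δ > 0, ∀ (n : ℕ) (x ξ : ℕ → ℝ), x 0 = a → x n = b →
    (∀ k < n, x k ≤ ξ k ∧ ξ k ≤ x (k + 1) ∧ x (k + 1) - x k < δ) →
    |∑ k ∈ Finset.range n, f (ξ k) * (g (x (k + 1)) - g (x k)) - I| < ε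

/-- `∫_{-∞}^b f dg = I` as an improper Riemann–Stieltjes integral. -/
def HasRSIntegralIic (f g : ℝ → ℝ) (b I : ℝ) : Prop :=
  ∃ J : ℝ → ℝ, (∀ a < b, HasRSIntegral f g a b (J a)) ∧ Tendsto J atBot (𝓝 I)

/-- `Y` is the multivariate fractional Ornstein–Uhlenbeck process driven by `B`, with mean
reversions `α i` and volatilities `ν i`: a centred Gaussian process such that
`Y^i_t = ν_i ∫_{-∞}^t e^{-α_i (t - u)} dB^i_u`, a pathwise Riemann–Stieltjes integral. -/
structure IsMfOU {ι Ω : Type*} [MeasurableSpace Ω] (Y B : ι → ℝ → Ω → ℝ) (α ν : ι → ℝ)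
    (P : Measure Ω) : Prop where
  gaussian : IsGaussianProcess (fun q : ι × ℝ => Y q.1 q.2) P
  centered : ∀ i t, ∫ ω, Y i t ω ∂P = 0
  integral : ∀ i t, ∀ᵐ ω ∂P, ∃ I : ℝ,
    HasRSIntegralIic (fun u => Real.exp (-α i * (t - u))) (fun u => B i u ω) t I ∧
      Y i t ω = ν i * I

/-- The rescaled statistic
`n^{1-h} ∑_{k=1}^n (a₁ Y¹_k Y²_k + a₂ Y¹_{k+s} Y²_k + a₃ Y¹_k Y²_{k+s} - ρ)`. -/
def rescaledStat {Ω : Type*} (Y : Fin 2 → ℝ → Ω → ℝ) (h ρ a₁ a₂ a₃ : ℝ) (s n : ℕ) (ω : Ω) : ℝ :=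
  (n : ℝ) ^ (1 - h) * ∑ k ∈ Finset.Icc 1 n,
    (a₁ * (Y 0 k ω * Y 1 k ω) + a₂ * (Y 0 (k + s) ω * Y 1 k ω)
      + a₃ * (Y 0 k ω * Y 1 (k + s) ω) - ρ)

/-- The cumulant of order `p` of `F`: `(-i)^p (d/dt)^p log E[e^{i t F}]` at `t = 0`. -/
def cumulant {Ω : Type*} [MeasurableSpace Ω] (p : ℕ) (F : Ω → ℝ) (P : Measure Ω) : ℝ :=
  ((-Complex.I) ^ p *
    iteratedDeriv p (fun t : ℝ => Complex.log (∫ ω, Complex.exp (Complex.I * t * F ω) ∂P)) 0).re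

/-- The kernels `z_{ij}` on the unit square, with `h = H₁ + H₂`. -/
def zKernel (H α ν : Fin 2 → ℝ) (ρ η : ℝ) (i j : Fin 2) (x y : ℝ) : ℝ :=
  if i = j then
    ν i ^ 2 * H i * (2 * H i - 1) / (2 * α i ^ 2) * |x - y| ^ (2 * H i - 2)
  else
    ν 0 * ν 1 * (H 0 + H 1) * (H 0 + H 1 - 1) / (4 * α 0 * α 1) *
      (if i = 0 then
        (if y < x then (ρ - η) * (x - y) ^ (H 0 + H 1 - 2)
          else (ρ + η) * (y - x) ^ (H 0 + H 1 - 2))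
      else
        (if y < x then (ρ + η) * (x - y) ^ (H 0 + H 1 - 2)
          else (ρ - η) * (y - x) ^ (H 0 + H 1 - 2)))

/-- The cyclic product `z_{i₁ j₁}(x₁, x₂) z_{i₂ j₂}(x₂, x₃) ⋯ z_{i_p j_p}(x_p, x₁)`
(`finRotate p` is the cyclic shift `k ↦ k + 1` of `Fin p`). -/
def cyclicProd (H α ν : Fin 2 → ℝ) (ρ η : ℝ) (p : ℕ) (i j : Fin p → Fin 2) (x : Fin p → ℝ) : ℝ :=
  ∏ k, zKernel H α ν ρ η (i k) (j k) (x k) (x (finRotate p k))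

/-- The index pairs that occur in the limit: `i₂ ≠ j₁, …, i_p ≠ j_{p-1}, i₁ ≠ j_p`. -/
def Admissible (p : ℕ) (i j : Fin p → Fin 2) : Prop :=
  ∀ k, i (finRotate p k) ≠ j k

open Classical in
/-- The limit of the cumulants of order `p`, with `A = a₁ + a₂ + a₃`. -/
def limitCumulant (H α ν : Fin 2 → ℝ) (ρ η A : ℝ) (p : ℕ) : ℝ :=
  2 ^ (p - 1) * ((p - 1).factorial : ℝ) * A ^ p *
    ∑ i : Fin p → Fin 2, ∑ j : Fin p → Fin 2 with Admissible p i j,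
      ∫ x in Set.Icc (0 : Fin p → ℝ) 1, cyclicProd H α ν ρ η p i j x

/-- The closed form of the limiting variance divided by `(a₁ + a₂ + a₃)²`. -/
def limitVariance (H α ν : Fin 2 → ℝ) (ρ η : ℝ) : ℝ :=
  ν 0 ^ 2 * ν 1 ^ 2 *
    ((ρ ^ 2 - η ^ 2) * (H 0 + H 1) ^ 2 * (H 0 + H 1 - 1) ^ 2
      + 4 * H 0 * H 1 * (2 * H 0 - 1) * (2 * H 1 - 1)) /
    (2 * α 0 ^ 2 * α 1 ^ 2 * (2 * (H 0 + H 1) - 3) * (2 * (H 0 + H 1) - 2))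

end

/-!
# Cumulants of bilinear statistics of the bivariate fractional Ornstein–Uhlenbeck process

Write `h = H 0 + H 1 > 3 / 2`. The statistic is, up to a constant, a quadratic form in a centred
Gaussian vector with covariance matrix `Σ`. If `M` is the matrix of the form, diagonalizing
`Σ^{1/2} M Σ^{1/2}` shows that its cumulant of order `p ≥ 2` is
`2 ^ (p - 1) (p - 1)! tr ((Σ M) ^ p)` (`cumulant_quadraticForm`). The trace is a sum over closed
paths of products of covariances (`cumulant_sum_mul`). As the form pairs `Y⁰` with `Y¹`, only the
index pairs with `i (k + 1) ≠ j k` occur, and the exponents along each closed path add up to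
`p (h - 2)`.

The covariance functions are stationary and decay like `|m| ^ (H i + H j - 2)`, with constants that
depend on the sign of `m`. After rescaling, the sums over closed paths are therefore Riemann sums of
cyclic products of homogeneous kernels, and they converge by dominated convergence
(`tendsto_cyclic_sum`, `tendsto_cumulant_bilinear`). The dominating function is integrable by
`integrableOn_prod_abs_rpow`: weighted AM-GM reduces a cyclic product of powers to products with one
factor removed, which a linear change of variables turns into products of functions of one variable.
This is where `p (2 - h) < p - 1`, that is `h > 3 / 2` for `p = 2`, is needed.

The covariances come from those of the driving process. Self-similarity and stationary increments
alone force the known form of the cross-covariance (`eq_mfBmCrossCov`, `IsMfBm.covariance_eq`): it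
is built from a function `G` homogeneous of degree `H i + H j`. The pathwise integrals are almost
sure limits of Gaussian Riemann–Stieltjes sums, hence `L²` limits, so that covariances may be taken
under the integral (`covariance_of_hasRSIntegralIic`). Doing so in both arguments expresses the
covariance of `Y i t` and `Y j s` through exponential averages of `G'`
(`IsMfOU.covariance_eq`), which have the asymptotics of `G''` up to the factor `1 / (α i * α j)`
(`powDecay_of_integral_sub`, `PowDecay.hasPowTails_integral`).

For `p = 2` the limit is evaluated in `limitCumulant_two`. It is positive
(`IsMfBm.limitVariance_pos`): up to a factor it is the limiting variance of the same kind of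
statistic for the increments of the driving process, and that statistic keeps a correlation bounded
away from `0` with a product of two increments over long intervals.
-/

/-! ### Cumulants of Gaussian quadratic forms -/

/-- The Gaussian integral `E[e^{i a Z²}] = (1 - 2 i a)^{-1/2}` for a standard normal `Z`. -/
lemma integral_cexp_mul_sq_gaussianReal (a : ℝ) :
    ∫ x : ℝ, Complex.exp (Complex.I * a * (x : ℂ) ^ 2) ∂(gaussianReal 0 1) =
      Complex.exp (-(1 / 2) * Complex.log (1 - 2 * Complex.I * a)) := by
  rw [integral_gaussianReal_eq_integral_smul one_ne_zero]
  have hre : (1 - 2 * Complex.I * a : ℂ).re = 1 := by simp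
  have hne : (1 - 2 * Complex.I * a : ℂ) ≠ 0 := by
    intro h; rw [h] at hre; simp at hre
  have h1 : ∀ x : ℝ, gaussianPDFReal 0 1 x • Complex.exp (Complex.I * a * (x : ℂ) ^ 2) =
      ((√(2 * Real.pi))⁻¹ : ℝ) *
        Complex.exp (-((1 / 2) * (1 - 2 * Complex.I * a)) * (x : ℂ) ^ 2) := by
    intro x
    rw [gaussianPDFReal, Complex.real_smul]
    push_cast
    rw [mul_assoc, ← Complex.exp_add]
    congr 2
    · simp
    · simp; ring
  simp_rw [h1]
  rw [integral_const_mul, integral_gaussian_complex (by simp)]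
  have h2 : (Real.pi / ((1 / 2) * (1 - 2 * Complex.I * a)) : ℂ) =
      ((2 * Real.pi : ℝ) : ℂ) * (1 - 2 * Complex.I * a)⁻¹ := by
    push_cast; field_simp
  have hpi : (0 : ℝ) < 2 * Real.pi := by positivity
  have harg : (1 - 2 * Complex.I * a : ℂ).arg ≠ Real.pi := by
    intro h
    have := (Complex.arg_eq_pi_iff.1 h).1
    rw [hre] at this; linarith
  rw [h2, Complex.cpow_def_of_ne_zero (mul_ne_zero (by exact_mod_cast hpi.ne') (inv_ne_zero hne)),
    Complex.log_ofReal_mul hpi (inv_ne_zero hne), Complex.log_inv _ harg, add_mul, Complex.exp_add,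
    ← mul_assoc]
  have h3 : Complex.exp ((Real.log (2 * Real.pi) : ℂ) * (1 / 2)) = ((√(2 * Real.pi) : ℝ) : ℂ) := by
    rw [Real.sqrt_eq_rpow, Real.rpow_def_of_pos hpi]
    push_cast; rfl
  rw [h3, ← Complex.ofReal_mul, inv_mul_cancel₀ (by positivity)]
  simp only [Complex.ofReal_one, one_mul]
  congr 1; ring

section QuadraticForm

variable {ι Ω : Type*} [Fintype ι] [MeasurableSpace Ω] {P : Measure Ω}

/-- The covariance matrix of a finite family of random variables. -/
noncomputable def covMat (X : ι → Ω → ℝ) (P : Measure Ω) : Matrix ι ι ℝ :=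
  Matrix.of fun i j => cov[X i, X j; P]

lemma dotProduct_covMat [IsProbabilityMeasure P] {X : ι → Ω → ℝ} (hX : ∀ i, MemLp (X i) 2 P)
    (v : ι → ℝ) :
    v ⬝ᵥ (covMat X P).mulVec v = Var[fun ω => ∑ i, v i * X i ω; P] := by
  rw [← covariance_self (Finset.aemeasurable_fun_sum _ fun i _ => (hX i).aemeasurable.const_mul _),
    covariance_fun_sum_fun_sum (fun i => (hX i).const_mul _) (fun i => (hX i).const_mul _)]
  simp only [dotProduct, Matrix.mulVec, Finset.mul_sum, covMat, Matrix.of_apply,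
    covariance_const_mul_left, covariance_const_mul_right]
  refine Finset.sum_congr rfl fun i _ => Finset.sum_congr rfl fun j _ => by ring

lemma covMat_posSemidef [IsProbabilityMeasure P] {X : ι → Ω → ℝ} (hX : ∀ i, MemLp (X i) 2 P) :
    (covMat X P).PosSemidef := by
  classical
  refine Matrix.PosSemidef.of_dotProduct_mulVec_nonneg ?_ fun v => ?_
  · ext i j
    simp [covMat, covariance_comm (X i)]
  · simp only [star_trivial]
    rw [dotProduct_covMat hX]
    exact variance_nonneg _ _

lemma map_toLp_eq_multivariateGaussian [DecidableEq ι] [IsProbabilityMeasure P] {X : ι → Ω → ℝ}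
    (hX : HasGaussianLaw (fun ω i => X i ω) P) (h0 : ∀ i, ∫ ω, X i ω ∂P = 0) :
    P.map (fun ω => WithLp.toLp 2 (fun i => X i ω)) = multivariateGaussian 0 (covMat X P) := by
  have h2 : ∀ i, MemLp (X i) 2 P := fun i => (hX.eval i).memLp_two
  have hG := hX.toLp_pi 2
  have : IsProbabilityMeasure (P.map (fun ω => WithLp.toLp 2 (fun i => X i ω))) :=
    Measure.isProbabilityMeasure_map hG.aemeasurable
  refine Measure.ext_of_charFun (funext fun t => ?_)
  rw [hG.charFun_map_eq, charFun_multivariateGaussian (covMat_posSemidef h2), dotProduct_covMat h2]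
  have hin : ∀ ω, inner ℝ t (WithLp.toLp 2 (fun i => X i ω)) = ∑ i, t i * X i ω := by
    intro ω
    simp [PiLp.inner_apply, mul_comm]
  simp_rw [hin]
  rw [integral_finsetSum _ fun i _ => ((h2 i).integrable (by norm_num)).const_mul _]
  simp [integral_const_mul, h0]

open scoped Matrix MatrixOrder Matrix.Norms.L2Operator in
/-- A quadratic form in a centred Gaussian vector with covariance matrix `Σ` has the law of a
weighted sum `∑ λᵢ zᵢ²` of squares of independent standard normal variables. The weights are the
eigenvalues of `Σ^{1/2} M Σ^{1/2}`, whence their power sums are the traces of the powers of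
`Σ M`. -/
lemma exists_map_quadraticForm_eq [DecidableEq ι] [IsProbabilityMeasure P] {X : ι → Ω → ℝ}
    (hX : HasGaussianLaw (fun ω i => X i ω) P) (h0 : ∀ i, ∫ ω, X i ω ∂P = 0)
    {M : Matrix ι ι ℝ} (hM : M.IsSymm) :
    ∃ l : ι → ℝ, (∀ p : ℕ, ∑ i, l i ^ (p + 1) = ((covMat X P * M) ^ (p + 1)).trace) ∧
      P.map (fun ω => (fun i => X i ω) ⬝ᵥ M *ᵥ (fun i => X i ω)) =
        (Measure.pi fun _ : ι => gaussianReal 0 1).map (fun z => ∑ i, l i * z i ^ 2) := by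
  have h2 : ∀ i, MemLp (X i) 2 P := fun i => (hX.eval i).memLp_two
  have hS := covMat_posSemidef h2
  set S := covMat X P
  set R := CFC.sqrt S with hRdef
  have hRR : R * R = S := CFC.sqrt_mul_sqrt_self _ hS.nonneg
  have hRt : Rᵀ = R := by
    have := (CFC.sqrt_nonneg S).isSelfAdjoint
    simpa [IsSelfAdjoint, Matrix.star_eq_conjTranspose] using this
  have hA : (R * M * R).IsHermitian := by
    rw [Matrix.IsHermitian, Matrix.conjTranspose_eq_transpose_of_trivial, Matrix.transpose_mul,
      Matrix.transpose_mul, hM.eq, hRt, mul_assoc]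
  refine ⟨hA.eigenvalues, fun p => ?_, ?_⟩
  · have hA' := hA.spectral_theorem
    have h3 : ((S * M) ^ (p + 1)).trace = ((R * M * R) ^ (p + 1)).trace := by
      have : ∀ p : ℕ, (S * M) ^ (p + 1) = R * ((R * M * R) ^ p * (R * M)) := by
        intro p
        induction p with
        | zero => simp [← hRR, mul_assoc]
        | succ p ih => rw [pow_succ, ih, pow_succ, ← hRR]; simp only [mul_assoc]
      rw [this, Matrix.trace_mul_comm, pow_succ, mul_assoc, mul_assoc]
    rw [h3]
    conv_rhs => rw [hA', ← map_pow, Unitary.conjStarAlgAut_apply, Matrix.trace_mul_comm,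
      ← mul_assoc]
    simp [Matrix.diagonal_pow, Matrix.trace_diagonal]
  · have hq : Measurable fun v : EuclideanSpace ℝ ι => v.ofLp ⬝ᵥ M *ᵥ v.ofLp := by
      simp only [dotProduct, Matrix.mulVec]; fun_prop
    have h4 : P.map (fun ω => (fun i => X i ω) ⬝ᵥ M *ᵥ (fun i => X i ω)) =
        (P.map (fun ω => WithLp.toLp 2 (fun i => X i ω))).map
          (fun v : EuclideanSpace ℝ ι => v.ofLp ⬝ᵥ M *ᵥ v.ofLp) := by
      rw [AEMeasurable.map_map_of_aemeasurable hq.aemeasurable (hX.toLp_pi 2).aemeasurable]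
      rfl
    rw [h4, map_toLp_eq_multivariateGaussian hX h0, multivariateGaussian,
      Measure.map_map hq (by fun_prop), stdGaussian_eq_map_pi_orthonormalBasis hA.eigenvectorBasis,
      Measure.map_map (by fun_prop) (by fun_prop)]
    congr 1
    funext z
    simp only [Function.comp_apply, zero_add, Matrix.ofLp_toEuclideanCLM]
    set w := ∑ i, z i • hA.eigenvectorBasis i with hw
    have h5 : (R *ᵥ w.ofLp) ⬝ᵥ M *ᵥ (R *ᵥ w.ofLp) = w.ofLp ⬝ᵥ (R * M * R) *ᵥ w.ofLp := by
      rw [← Matrix.mulVec_mulVec, ← Matrix.mulVec_mulVec, Matrix.dotProduct_mulVec w.ofLp,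
        ← Matrix.mulVec_transpose, hRt]
    have h6 : (R * M * R) *ᵥ w.ofLp =
        (∑ i, (z i * hA.eigenvalues i) • hA.eigenvectorBasis i).ofLp := by
      rw [hw, WithLp.ofLp_sum, Matrix.mulVec_sum, WithLp.ofLp_sum]
      refine Finset.sum_congr rfl fun i _ => ?_
      rw [WithLp.ofLp_smul, Matrix.mulVec_smul, hA.mulVec_eigenvectorBasis, smul_smul,
        WithLp.ofLp_smul]
    rw [h5, h6]
    have h7 : ∀ a b : EuclideanSpace ℝ ι, a.ofLp ⬝ᵥ b.ofLp = inner ℝ a b := by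
      intro a b
      simp [PiLp.inner_apply, dotProduct, mul_comm]
    rw [h7, hw, hA.eigenvectorBasis.orthonormal.inner_sum]
    refine Finset.sum_congr rfl fun i _ => ?_
    simp; ring

/-- The derivatives of order at least two of `t ↦ i t c - ½ ∑ log (1 - 2 i λ t)`. -/
lemma iteratedDeriv_log_charFun (c : ℂ) (l : ι → ℝ) (p : ℕ) :
    iteratedDeriv (p + 2) (fun t : ℝ => Complex.I * t * c +
        ∑ i, -(1 / 2) * Complex.log (1 - 2 * Complex.I * (t * l i : ℝ))) =
      fun t : ℝ => ∑ i, (1 / 2) * (2 * Complex.I * l i) ^ (p + 2) * ((p + 1).factorial : ℂ) *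
        (1 - 2 * Complex.I * (t * l i : ℝ)) ^ (-(p + 2 : ℕ) : ℤ) := by
  have hre : ∀ (t : ℝ) i, (1 - 2 * Complex.I * (t * l i : ℝ) : ℂ).re = 1 := by
    intro t i; simp
  have hne : ∀ (t : ℝ) i, (1 - 2 * Complex.I * (t * l i : ℝ) : ℂ) ≠ 0 := by
    intro t i h; have := hre t i; rw [h] at this; simp at this
  have hd : ∀ (t : ℝ) i, HasDerivAt (fun t : ℝ => (1 - 2 * Complex.I * (t * l i : ℝ) : ℂ))
      (-(2 * Complex.I * l i)) t := by
    intro t i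
    have := (((Complex.ofRealCLM.hasDerivAt (x := t)).mul_const (l i : ℂ)).const_mul
      (2 * Complex.I)).const_sub 1
    simpa using this
  have h1 : deriv (fun t : ℝ => Complex.I * t * c +
      ∑ i, -(1 / 2) * Complex.log (1 - 2 * Complex.I * (t * l i : ℝ))) =
      fun t : ℝ => Complex.I * c +
        ∑ i, (1 / 2) * (2 * Complex.I * l i) * (1 - 2 * Complex.I * (t * l i : ℝ))⁻¹ := by
    funext t
    have hA : HasDerivAt (fun t : ℝ => Complex.I * t * c) (Complex.I * c) t := by
      simpa using ((Complex.ofRealCLM.hasDerivAt (x := t)).const_mul Complex.I).mul_const c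
    have hB : ∀ i ∈ Finset.univ, HasDerivAt
        (fun t : ℝ => -(1 / 2) * Complex.log (1 - 2 * Complex.I * (t * l i : ℝ)))
        (-(1 / 2) * (-(2 * Complex.I * l i) / (1 - 2 * Complex.I * (t * l i : ℝ)))) t := by
      intro i _
      exact (((hd t i).clog_real (Or.inl (by rw [hre]; norm_num)))).const_mul _
    rw [(hA.fun_add (HasDerivAt.fun_sum hB)).deriv]
    congr 1
    refine Finset.sum_congr rfl fun i _ => ?_
    rw [div_eq_mul_inv]; ring
  induction p with
  | zero =>
    rw [show 0 + 2 = 1 + 1 from rfl, iteratedDeriv_succ, iteratedDeriv_one, h1]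
    funext t
    have hB : ∀ i ∈ Finset.univ, HasDerivAt
        (fun t : ℝ => (1 / 2) * (2 * Complex.I * l i) * (1 - 2 * Complex.I * (t * l i : ℝ))⁻¹)
        ((1 / 2) * (2 * Complex.I * l i) * (-(-(2 * Complex.I * l i)) /
          (1 - 2 * Complex.I * (t * l i : ℝ)) ^ 2)) t := by
      intro i _
      exact ((hd t i).fun_inv (hne t i)).const_mul _
    rw [((HasDerivAt.fun_sum hB).const_add _).deriv]
    refine Finset.sum_congr rfl fun i _ => ?_
    have := hne t i
    simp only [zpow_neg, zpow_natCast]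
    simp
    ring
  | succ p ih =>
    rw [iteratedDeriv_succ, ih]
    funext t
    have hB : ∀ i ∈ Finset.univ, HasDerivAt
        (fun t : ℝ => (1 / 2) * (2 * Complex.I * l i) ^ (p + 2) * ((p + 1).factorial : ℂ) *
          (1 - 2 * Complex.I * (t * l i : ℝ)) ^ (-(p + 2 : ℕ) : ℤ))
        ((1 / 2) * (2 * Complex.I * l i) ^ (p + 2) * ((p + 1).factorial : ℂ) *
          (((-(p + 2 : ℕ) : ℤ) : ℂ) * (1 - 2 * Complex.I * (t * l i : ℝ)) ^ ((-(p + 2 : ℕ) : ℤ) - 1)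
            * (-(2 * Complex.I * l i)))) t := by
      intro i _
      have := (hasDerivAt_zpow (-(p + 2 : ℕ) : ℤ) (1 - 2 * Complex.I * (t * l i : ℝ) : ℂ)
        (Or.inl (hne t i))).comp_of_eq t (hd t i) rfl
      exact this.const_mul _
    rw [(HasDerivAt.fun_sum hB).deriv]
    refine Finset.sum_congr rfl fun i _ => ?_
    rw [show (-(p + 2 : ℕ) : ℤ) - 1 = (-(p + 1 + 2 : ℕ) : ℤ) by push_cast; ring,
      Nat.factorial_succ (p + 1)]
    push_cast
    ring

/-- The cumulants of order at least two of a quadratic form in a centred Gaussian vector, up to an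
additive constant. -/
lemma cumulant_quadraticForm [DecidableEq ι] [IsProbabilityMeasure P] {X : ι → Ω → ℝ}
    (hX : HasGaussianLaw (fun ω i => X i ω) P) (h0 : ∀ i, ∫ ω, X i ω ∂P = 0)
    {M : Matrix ι ι ℝ} (hM : M.IsSymm) (c : ℝ) {p : ℕ} (hp : 2 ≤ p) :
    cumulant p (fun ω => (fun i => X i ω) ⬝ᵥ M.mulVec (fun i => X i ω) + c) P =
      2 ^ (p - 1) * (p - 1).factorial * ((covMat X P * M) ^ p).trace := by
  obtain ⟨l, hl, hmap⟩ := exists_map_quadraticForm_eq hX h0 hM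
  obtain ⟨q, rfl⟩ : ∃ q, p = q + 2 := ⟨p - 2, by omega⟩
  have haem : AEMeasurable (fun ω => (fun i => X i ω) ⬝ᵥ M.mulVec (fun i => X i ω)) P := by
    have hq : Measurable fun v : ι → ℝ => v ⬝ᵥ M.mulVec v := by
      simp only [dotProduct, Matrix.mulVec]; fun_prop
    exact hq.comp_aemeasurable hX.aemeasurable
  have hchar : ∀ t : ℝ, ∫ ω, Complex.exp (Complex.I * t *
      (((fun i => X i ω) ⬝ᵥ M.mulVec (fun i => X i ω) + c : ℝ) : ℂ)) ∂P =
      Complex.exp (Complex.I * t * c +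
        ∑ i, -(1 / 2) * Complex.log (1 - 2 * Complex.I * (t * l i : ℝ))) := by
    intro t
    have e1 : ∫ ω, Complex.exp (Complex.I * t *
        (((fun i => X i ω) ⬝ᵥ M.mulVec (fun i => X i ω) + c : ℝ) : ℂ)) ∂P =
        ∫ y, Complex.exp (Complex.I * t * ((y + c : ℝ) : ℂ))
          ∂(P.map (fun ω => (fun i => X i ω) ⬝ᵥ M.mulVec (fun i => X i ω))) := by
      rw [integral_map haem (by fun_prop)]
    rw [e1, hmap, integral_map (Measurable.aemeasurable (by fun_prop)) (by fun_prop)]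
    have e2 : ∀ z : ι → ℝ, Complex.exp (Complex.I * t * ((∑ i, l i * z i ^ 2 + c : ℝ) : ℂ)) =
        Complex.exp (Complex.I * t * c) *
          ∏ i, Complex.exp (Complex.I * (t * l i : ℝ) * (z i : ℂ) ^ 2) := by
      intro z
      rw [← Complex.exp_sum, ← Complex.exp_add]
      congr 1
      push_cast
      rw [mul_add, Finset.mul_sum, add_comm]
      congr 1
      exact Finset.sum_congr rfl fun i _ => by ring
    simp_rw [e2]
    rw [integral_const_mul, integral_fintype_prod_eq_prod
      (f := fun i (x : ℝ) => Complex.exp (Complex.I * (t * l i : ℝ) * (x : ℂ) ^ 2))]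
    simp_rw [integral_cexp_mul_sq_gaussianReal]
    rw [← Complex.exp_sum, ← Complex.exp_add]
  -- The principal logarithm inverts the exponential near `0`, where the imaginary part of the
  -- exponent is small.
  have hev : (fun t : ℝ => Complex.log (∫ ω, Complex.exp (Complex.I * t *
      (((fun i => X i ω) ⬝ᵥ M.mulVec (fun i => X i ω) + c : ℝ) : ℂ)) ∂P)) =ᶠ[𝓝 0]
      fun t : ℝ => Complex.I * t * c +
        ∑ i, -(1 / 2) * Complex.log (1 - 2 * Complex.I * (t * l i : ℝ)) := by
    have hcont : ContinuousAt (fun t : ℝ => (Complex.I * t * c +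
        ∑ i, -(1 / 2) * Complex.log (1 - 2 * Complex.I * (t * l i : ℝ))).im) 0 := by
      refine Complex.continuous_im.continuousAt.comp ?_
      refine ContinuousAt.add (by fun_prop) ?_
      refine tendsto_finsetSum _ fun i _ => ?_
      refine ContinuousAt.mul (by fun_prop) (ContinuousAt.clog (by fun_prop) (Or.inl (by simp)))
    have h00 : ((Complex.I * (0 : ℝ) * c +
        ∑ i, -(1 / 2) * Complex.log (1 - 2 * Complex.I * ((0 : ℝ) * l i : ℝ))) : ℂ).im = 0 := by
      simp
    have hlt := hcont.eventually (Ioo_mem_nhds (a := -Real.pi) (b := Real.pi)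
      (by beta_reduce; rw [h00]; linarith [Real.pi_pos])
      (by beta_reduce; rw [h00]; exact Real.pi_pos))
    filter_upwards [hlt] with t ht
    rw [hchar t, Complex.log_exp ht.1 ht.2.le]
  rw [cumulant, hev.iteratedDeriv_eq, iteratedDeriv_log_charFun, ← hl (q + 1)]
  have : ((-Complex.I) ^ (q + 2) * ∑ i, (1 / 2) * (2 * Complex.I * l i) ^ (q + 2) *
      ((q + 1).factorial : ℂ) * (1 - 2 * Complex.I * ((0 : ℝ) * l i : ℝ)) ^ (-(q + 2 : ℕ) : ℤ)) =
      ((2 ^ (q + 1) * (q + 1).factorial * ∑ i, l i ^ (q + 2) : ℝ) : ℂ) := by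
    push_cast
    rw [Finset.mul_sum, Finset.mul_sum]
    refine Finset.sum_congr rfl fun i _ => ?_
    simp only [zero_mul, mul_zero, sub_zero, one_zpow, mul_one, mul_pow]
    have hI : (-Complex.I) ^ (q + 2) * Complex.I ^ (q + 2) = 1 := by
      rw [← mul_pow]; simp
    linear_combination (1 / 2 * 2 ^ (q + 2) * (l i : ℂ) ^ (q + 2) * ((q + 1).factorial : ℂ)) * hI
  rw [this, Complex.ofReal_re]
  rfl

end QuadraticForm

/-- The second cumulant of a square integrable random variable is its variance. -/
lemma cumulant_two {Ω : Type*} [MeasurableSpace Ω] {P : Measure Ω} [IsProbabilityMeasure P]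
    {F : Ω → ℝ} (hF : MemLp F 2 P) : cumulant 2 F P = Var[F; P] := by
  have hprob : IsProbabilityMeasure (P.map F) := Measure.isProbabilityMeasure_map hF.aemeasurable
  have hid : MemLp id ((2 : ℕ) : ENNReal) (P.map F) := by
    rw [memLp_map_measure_iff (by fun_prop) hF.aemeasurable]; exact_mod_cast hF
  have hid1 : MemLp id ((1 : ℕ) : ENNReal) (P.map F) := hid.mono_exponent (by norm_num)
  have hφ : (fun t : ℝ => ∫ ω, Complex.exp (Complex.I * t * F ω) ∂P) = charFun (P.map F) := by
    funext t
    rw [charFun_apply_real, integral_map hF.aemeasurable (by fun_prop)]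
    refine integral_congr_ae (Eventually.of_forall fun ω => ?_)
    simp only; congr 1; ring
  have hc := contDiff_charFun hid
  set φ := charFun (P.map F)
  have hφ0 : φ 0 = 1 := by simp [φ]
  have hslit : ∀ᶠ t in 𝓝 (0 : ℝ), φ t ∈ Complex.slitPlane :=
    hc.continuous.continuousAt.eventually
      (Complex.isOpen_slitPlane.mem_nhds (by rw [hφ0]; exact Complex.one_mem_slitPlane))
  have hd : ∀ t, HasDerivAt φ (deriv φ t) t := fun t =>
    (hc.differentiable (by norm_num) t).hasDerivAt
  have hd2 : ∀ t, HasDerivAt (deriv φ) (deriv (deriv φ) t) t := fun t =>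
    (((contDiff_succ_iff_deriv (n := 1)).1 (by exact_mod_cast hc)).2.2.differentiable
      (by norm_num) t).hasDerivAt
  have hm1 : deriv φ 0 = Complex.I * (∫ ω, F ω ∂P : ℝ) := by
    have := iteratedDeriv_charFun_zero hid1
    rw [iteratedDeriv_one, integral_map hF.aemeasurable (by fun_prop)] at this
    simpa using this
  have hm2 : deriv (deriv φ) 0 = -(∫ ω, F ω ^ 2 ∂P : ℝ) := by
    have := iteratedDeriv_charFun_zero hid
    rw [iteratedDeriv_succ, iteratedDeriv_one, integral_map hF.aemeasurable (by fun_prop)] at this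
    simpa using this
  have h1 : deriv (fun t => Complex.log (φ t)) =ᶠ[𝓝 0] fun t => deriv φ t / φ t := by
    filter_upwards [hslit] with t ht
    exact ((hd t).clog_real ht).deriv
  have h2 : iteratedDeriv 2 (fun t => Complex.log (φ t)) 0 =
      (deriv (deriv φ) 0 * φ 0 - deriv φ 0 * deriv φ 0) / φ 0 ^ 2 := by
    rw [iteratedDeriv_succ, iteratedDeriv_one, h1.deriv_eq]
    exact ((hd2 0).div (hd 0) (by rw [hφ0]; exact one_ne_zero)).deriv
  have hφ' : (fun t : ℝ => Complex.log (∫ ω, Complex.exp (Complex.I * t * F ω) ∂P)) =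
      fun t => Complex.log (φ t) := by
    funext t; rw [← hφ]
  rw [cumulant, hφ', h2, hm1, hm2, hφ0, variance_eq_sub hF]
  have : ((-Complex.I) ^ 2 * ((-((∫ ω, F ω ^ 2 ∂P : ℝ) : ℂ) * 1 -
      Complex.I * (∫ ω, F ω ∂P : ℝ) * (Complex.I * (∫ ω, F ω ∂P : ℝ))) / 1 ^ 2)) =
      ((∫ ω, F ω ^ 2 ∂P - (∫ ω, F ω ∂P) ^ 2 : ℝ) : ℂ) := by
    push_cast
    linear_combination (-((∫ ω, F ω ^ 2 ∂P : ℝ) : ℂ) - Complex.I ^ 2 * (∫ ω, F ω ∂P : ℝ) ^ 2 +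
      (∫ ω, F ω ∂P : ℝ) ^ 2) * Complex.I_sq
  rw [this, Complex.ofReal_re]
  simp

/-! ### Integrability of cyclic products of powers -/

/-- Backward induction along the cycle `k ↦ k + 1` of `Fin p`. -/
lemma forall_of_finRotate {p : ℕ} (hp : 2 ≤ p) {Q : Fin p → Prop} {m : Fin p} (hm : Q m)
    (h : ∀ k, Q (finRotate p k) → Q k) : ∀ k, Q k := by
  obtain ⟨q, rfl⟩ : ∃ q, p = q + 2 := ⟨p - 2, by omega⟩
  have hne : ∀ x : Fin (q + 2), finRotate (q + 2) x ≠ x := by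
    intro x hx
    have hc := isCycle_finRotate (n := q)
    have hs : x ∈ (finRotate (q + 2)).support := by simp [support_finRotate]
    exact (Equiv.Perm.mem_support.1 hs) hx
  intro k
  obtain ⟨i, hi⟩ := (isCycle_finRotate (n := q)).exists_pow_eq (hne k) (hne m)
  have : ∀ (i : ℕ) (k : Fin (q + 2)), Q ((finRotate (q + 2) ^ i) k) → Q k := by
    intro i
    induction i with
    | zero => intro k hk; simpa using hk
    | succ i ih =>
      intro k hk
      rw [pow_succ, Equiv.Perm.mul_apply] at hk
      exact h k (ih _ hk)
  exact this i k (hi ▸ hm)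

lemma intervalIntegrable_abs_rpow {r : ℝ} (hr : -1 < r) (a b : ℝ) :
    IntervalIntegrable (fun u : ℝ => |u| ^ r) volume a b := by
  have h0 : ∀ c : ℝ, 0 ≤ c → IntervalIntegrable (fun u : ℝ => |u| ^ r) volume 0 c := by
    intro c hc
    refine (intervalIntegral.intervalIntegrable_rpow' (a := 0) (b := c) hr).congr_ae ?_
    filter_upwards [ae_restrict_mem measurableSet_uIoc] with u hu
    rw [Set.uIoc_of_le hc] at hu
    rw [abs_of_pos hu.1]
  have h1 : ∀ c : ℝ, IntervalIntegrable (fun u : ℝ => |u| ^ r) volume 0 c := by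
    intro c
    rcases le_total 0 c with hc | hc
    · exact h0 c hc
    · have := (IntervalIntegrable.iff_comp_neg (by simp)).1 (h0 (-c) (by linarith))
      simpa using this
  exact (h1 a).symm.trans (h1 b)

lemma integrable_indicator_abs_rpow {w : ℝ} (hw : w < 1) :
    Integrable (Set.indicator (Set.Icc (-1 : ℝ) 1) fun y => |y| ^ (-w)) := by
  rw [integrable_indicator_iff measurableSet_Icc]
  have h := intervalIntegrable_abs_rpow (r := -w) (by linarith) (-1) 1
  rwa [intervalIntegrable_iff_integrableOn_Icc_of_le (by norm_num)] at h

/-- Once one factor of the cyclic product is removed, the differences `x k - x (k + 1)` of the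
other factors are, together with one coordinate, linear coordinates of `ℝᵖ`, so that the remaining
product of powers is integrable as soon as each factor is. -/
lemma integrableOn_prod_erase {p : ℕ} (hp : 2 ≤ p) (m : Fin p) {w : Fin p → ℝ}
    (hw : ∀ k, w k < 1) :
    IntegrableOn (fun x : Fin p → ℝ =>
      ∏ k ∈ Finset.univ.erase m, |x k - x (finRotate p k)| ^ (-w k)) (Set.Icc 0 1) := by
  let T : (Fin p → ℝ) →ₗ[ℝ] (Fin p → ℝ) := LinearMap.pi fun k =>
    if k = m then (LinearMap.proj m : (Fin p → ℝ) →ₗ[ℝ] ℝ)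
    else (LinearMap.proj k : (Fin p → ℝ) →ₗ[ℝ] ℝ) - LinearMap.proj (finRotate p k)
  have hTm : ∀ x, T x m = x m := fun x => by simp [T]
  have hTk : ∀ x k, k ≠ m → T x k = x k - x (finRotate p k) := fun x k hk => by simp [T, hk]
  have hinj : LinearMap.ker T = ⊥ := by
    rw [LinearMap.ker_eq_bot']
    intro x hx
    have h0 : x m = 0 := by rw [← hTm x, hx]; rfl
    funext k
    refine forall_of_finRotate hp (Q := fun k => x k = 0) h0 (fun k hk => ?_) k
    by_cases hkm : k = m
    · rw [hkm]; exact h0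
    · have := hTk x k hkm
      rw [hx, hk] at this
      simpa using this.symm
  have hdet : LinearMap.det T ≠ 0 := fun h =>
    (LinearMap.bot_lt_ker_of_det_eq_zero h).ne' hinj
  let φ : Fin p → ℝ → ℝ := fun k => if k = m then Set.indicator (Set.Icc (0 : ℝ) 1) 1 else
    Set.indicator (Set.Icc (-1 : ℝ) 1) fun y => |y| ^ (-w k)
  have hφ : ∀ k, Integrable (φ k) := by
    intro k
    by_cases hk : k = m
    · simp only [φ, hk, if_true]
      rw [integrable_indicator_iff measurableSet_Icc]
      exact (integrableOn_const (by simp))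
    · simp only [φ, hk, if_false]
      exact integrable_indicator_abs_rpow (hw k)
  have hG : Integrable (fun y : Fin p → ℝ => ∏ k, φ k (y k)) := Integrable.fintype_prod hφ
  have hG' : Integrable ((fun y : Fin p → ℝ => ∏ k, φ k (y k)) ∘ T) := by
    refine Integrable.comp_measurable (f := T) ?_
      (LinearMap.continuous_of_finiteDimensional T).measurable
    rw [Measure.map_linearMap_addHaar_pi_eq_smul_addHaar hdet]
    exact hG.smul_measure ENNReal.ofReal_ne_top
  refine (hG'.integrableOn (s := Set.Icc 0 1)).congr_fun ?_ measurableSet_Icc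
  intro x hx
  have hx0 : ∀ k, 0 ≤ x k := fun k => hx.1 k
  have hx1 : ∀ k, x k ≤ 1 := fun k => hx.2 k
  simp only [Function.comp_apply]
  rw [← Finset.mul_prod_erase _ _ (Finset.mem_univ m)]
  have : φ m (T x m) = 1 := by
    simp only [φ, if_true, hTm]
    rw [Set.indicator_of_mem (Set.mem_Icc.2 ⟨hx0 m, hx1 m⟩)]; rfl
  rw [this, one_mul]
  refine Finset.prod_congr rfl fun k hk => ?_
  have hk := Finset.ne_of_mem_erase hk
  simp only [φ, hk, if_false, hTk x k hk]
  rw [Set.indicator_of_mem]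
  exact ⟨by linarith [hx0 k, hx1 (finRotate p k)], by linarith [hx1 k, hx0 (finRotate p k)]⟩

/-- Weighted AM-GM: the vector of exponents `u` is a convex combination of vectors with all entries
below `1` and one entry equal to `0`. -/
lemma exists_prod_rpow_le_sum {p : ℕ} {u : Fin p → ℝ} (hu0 : ∀ k, 0 < u k) (hu1 : ∀ k, u k < 1)
    (hu : ∑ k, u k < p - 1) :
    ∃ l w : Fin p → ℝ, (∀ k, w k < 1) ∧ ∀ d : Fin p → ℝ, (∀ k, 0 ≤ d k) →
      ∏ k, d k ^ (-u k) ≤ ∑ m, l m * ∏ k ∈ Finset.univ.erase m, d k ^ (-w k) := by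
  -- The weights are proportional to `1 - u k`; they are below `1 - u k` because `s > 1`.
  set s : ℝ := ∑ k, (1 - u k) with hs
  have hs1 : 1 < s := by
    rw [hs, Finset.sum_sub_distrib]; simp; linarith
  let l : Fin p → ℝ := fun k => (1 - u k) / s
  have hl0 : ∀ k, 0 ≤ l k := fun k => div_nonneg (by linarith [hu1 k]) (by linarith)
  have hl1 : ∀ k, l k < 1 - u k := fun k => div_lt_self (by linarith [hu1 k]) hs1
  have hlsum : ∑ k, l k = 1 := by
    rw [← Finset.sum_div]; exact div_self (by linarith)
  have hl1' : ∀ k, 0 < 1 - l k := fun k => by linarith [hl1 k, hu0 k]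
  let w : Fin p → ℝ := fun k => u k / (1 - l k)
  refine ⟨l, w, fun k => ?_, fun d hd => ?_⟩
  · rw [div_lt_one (hl1' k)]; linarith [hl1 k]
  by_cases hd0 : ∃ k, d k = 0
  · obtain ⟨k, hk⟩ := hd0
    rw [Finset.prod_eq_zero (Finset.mem_univ k)
      (by rw [hk, Real.zero_rpow (neg_ne_zero.2 (hu0 k).ne')])]
    exact Finset.sum_nonneg fun m _ => mul_nonneg (hl0 m)
      (Finset.prod_nonneg fun k _ => Real.rpow_nonneg (hd k) _)
  push Not at hd0
  have hd' : ∀ k, 0 < d k := fun k => lt_of_le_of_ne (hd k) (hd0 k).symm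
  have key := Real.geom_mean_le_arith_mean_weighted Finset.univ l
    (fun m => ∏ k ∈ Finset.univ.erase m, d k ^ (-w k)) (fun m _ => hl0 m) hlsum
    (fun m _ => Finset.prod_nonneg fun k _ => Real.rpow_nonneg (hd k) _)
  refine le_trans (le_of_eq ?_) key
  have h1 : ∀ m, (∏ k ∈ Finset.univ.erase m, d k ^ (-w k)) ^ l m =
      ∏ k, if k = m then 1 else d k ^ (-w k * l m) := by
    intro m
    rw [← Real.finsetProd_rpow _ _ (fun k _ => Real.rpow_nonneg (hd k) _),
      ← Finset.mul_prod_erase _ _ (Finset.mem_univ m), if_pos rfl, one_mul]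
    refine Finset.prod_congr rfl fun k hk => ?_
    rw [if_neg (Finset.ne_of_mem_erase hk), Real.rpow_mul (hd k)]
  simp_rw [h1]
  rw [Finset.prod_comm]
  refine Finset.prod_congr rfl fun k _ => ?_
  rw [← Finset.mul_prod_erase _ _ (Finset.mem_univ k), if_pos rfl, one_mul,
    Finset.prod_congr rfl (g := fun m => d k ^ (-w k * l m))
      (fun m hm => if_neg (Finset.ne_of_mem_erase hm).symm), ← Real.rpow_sum_of_pos (hd' k),
    ← Finset.mul_sum, Finset.sum_erase_eq_sub (Finset.mem_univ k), hlsum]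
  congr 1
  have := (hl1' k).ne'
  simp only [w]
  field_simp

/-- A cyclic product of powers is integrable on the unit cube as soon as each exponent exceeds `-1`
and their sum exceeds `-(p - 1)`, the codimension of the diagonal. -/
lemma integrableOn_prod_abs_rpow {p : ℕ} (hp : 2 ≤ p) {u : Fin p → ℝ} (hu0 : ∀ k, 0 < u k)
    (hu1 : ∀ k, u k < 1) (hu : ∑ k, u k < p - 1) :
    IntegrableOn (fun x : Fin p → ℝ => ∏ k, |x k - x (finRotate p k)| ^ (-u k)) (Set.Icc 0 1) := by
  obtain ⟨l, w, hw, hle⟩ := exists_prod_rpow_le_sum hu0 hu1 hu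
  have hdom : IntegrableOn (fun x : Fin p → ℝ => ∑ m, l m *
      ∏ k ∈ Finset.univ.erase m, |x k - x (finRotate p k)| ^ (-w k)) (Set.Icc 0 1) :=
    integrable_finsetSum _ fun m _ => (integrableOn_prod_erase hp m hw).const_mul (l m)
  refine hdom.mono' (Measurable.aestronglyMeasurable (by fun_prop))
    (Eventually.of_forall fun x => ?_)
  rw [Real.norm_of_nonneg (Finset.prod_nonneg fun k _ => Real.rpow_nonneg (abs_nonneg _) _)]
  exact hle _ fun k => abs_nonneg _

/-! ### Riemann sums of cyclic products -/

/-- Integrals over the unit cube of functions of `⌊n x⌋` are averages over a grid. -/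
lemma setIntegral_floor {p n : ℕ} (hn : 0 < n) (f : (Fin p → ℤ) → ℝ) :
    ∫ x in Set.Icc (0 : Fin p → ℝ) 1, f (fun k => ⌊n * x k⌋) =
      ((n : ℝ) ^ p)⁻¹ * ∑ m : Fin p → Fin n, f (fun k => (m k : ℤ)) := by
  have hn' : (0 : ℝ) < n := by exact_mod_cast hn
  let box : (Fin p → Fin n) → Set (Fin p → ℝ) := fun m =>
    Set.univ.pi fun k => Set.Ico ((m k : ℝ) / n) (((m k : ℝ) + 1) / n)
  have hfl : ∀ m, ∀ x ∈ box m, ∀ k, ⌊n * x k⌋ = (m k : ℤ) := by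
    intro m x hx k
    have := hx k (Set.mem_univ k)
    rw [Set.mem_Ico, div_le_iff₀ hn', lt_div_iff₀ hn'] at this
    rw [Int.floor_eq_iff]
    push_cast
    constructor <;> linarith
  have hU : (Set.univ.pi fun _ : Fin p => Set.Ico (0 : ℝ) 1) = ⋃ m, box m := by
    ext x
    simp only [Set.mem_iUnion]
    constructor
    · intro hx
      have hx' : ∀ k, 0 ≤ x k ∧ x k < 1 := fun k => hx k (Set.mem_univ k)
      have hnx : ∀ k, 0 ≤ (n : ℝ) * x k := fun k => mul_nonneg hn'.le (hx' k).1
      refine ⟨fun k => ⟨⌊n * x k⌋₊, ?_⟩, fun k _ => ?_⟩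
      · rw [Nat.floor_lt (hnx k)]
        nlinarith [(hx' k).2]
      · simp only
        rw [Set.mem_Ico, div_le_iff₀ hn', lt_div_iff₀ hn']
        constructor
        · linarith [Nat.floor_le (hnx k)]
        · linarith [Nat.lt_floor_add_one ((n : ℝ) * x k)]
    · rintro ⟨m, hm⟩ k -
      have h1 := hm k (Set.mem_univ k)
      have h2 : ((m k : ℝ) + 1) ≤ n := by exact_mod_cast (m k).2
      refine ⟨le_trans (by positivity) h1.1, lt_of_lt_of_le h1.2 ?_⟩
      rwa [div_le_one hn']
  have hmeas : ∀ m, MeasurableSet (box m) := fun m =>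
    MeasurableSet.univ_pi fun k => measurableSet_Ico
  have hcongr : ∀ m, Set.EqOn (fun x : Fin p → ℝ => f (fun k => ⌊n * x k⌋))
      (fun _ => f (fun k => (m k : ℤ))) (box m) := by
    intro m x hx
    simp only
    congr 1
    funext k
    exact hfl m x hx k
  have hvol : ∀ m, volume (box m) = ENNReal.ofReal (((n : ℝ) ^ p)⁻¹) := by
    intro m
    simp only [box]
    rw [volume_pi_pi]
    simp only [Real.volume_Ico]
    have : ∀ k, ((m k : ℝ) + 1) / n - (m k : ℝ) / n = (n : ℝ)⁻¹ := by
      intro k; rw [← sub_div]; simp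
    simp_rw [this]
    rw [Finset.prod_const, ← ENNReal.ofReal_pow (by positivity)]
    simp
  rw [volume_pi, ← setIntegral_congr_set
    (Measure.univ_pi_Ico_ae_eq_Icc (f := (0 : Fin p → ℝ)) (g := 1)), ← volume_pi]
  simp only [Pi.zero_apply, Pi.one_apply]
  rw [hU, integral_iUnion_fintype hmeas, Finset.mul_sum]
  · refine Finset.sum_congr rfl fun m _ => ?_
    rw [setIntegral_congr_fun (hmeas m) (hcongr m), setIntegral_const, measureReal_def, hvol,
      ENNReal.toReal_ofReal (by positivity), smul_eq_mul]
  · intro m m' hmm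
    refine Set.disjoint_left.2 fun x hx hx' => hmm ?_
    funext k
    have := (hfl m x hx k).symm.trans (hfl m' x hx' k)
    exact Fin.ext (by exact_mod_cast this)
  · intro m
    refine IntegrableOn.congr_fun ?_ (hcongr m).symm (hmeas m)
    exact integrableOn_const (by rw [hvol]; exact ENNReal.ofReal_ne_top)

/-- `g m ∼ cp m ^ e` as `m → ∞` and `g m ∼ cm |m| ^ e` as `m → -∞`, stated so that the constants may
vanish. -/
def HasPowTails (g : ℤ → ℝ) (e cp cm : ℝ) : Prop :=
  Tendsto (fun m : ℤ => g m * |(m : ℝ)| ^ (-e)) atTop (𝓝 cp) ∧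
    Tendsto (fun m : ℤ => g m * |(m : ℝ)| ^ (-e)) atBot (𝓝 cm)

/-- The homogeneous function equal to `cp x ^ e` for `x > 0` and to `cm |x| ^ e` for `x ≤ 0`. -/
noncomputable def powKernel (e cp cm x : ℝ) : ℝ := if 0 < x then cp * x ^ e else cm * (-x) ^ e

lemma abs_powKernel_le (e cp cm x : ℝ) : |powKernel e cp cm x| ≤ (|cp| + |cm|) * |x| ^ e := by
  have h0 := Real.rpow_nonneg (abs_nonneg x) e
  unfold powKernel
  split_ifs with h
  · rw [abs_mul, abs_of_pos h, abs_of_nonneg (Real.rpow_nonneg h.le _)]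
    exact mul_le_mul_of_nonneg_right (by linarith [abs_nonneg cm]) (Real.rpow_nonneg h.le _)
  · push Not at h
    rw [abs_mul, abs_of_nonpos h, abs_of_nonneg (Real.rpow_nonneg (by linarith) _)]
    exact mul_le_mul_of_nonneg_right (by linarith [abs_nonneg cp])
      (Real.rpow_nonneg (by linarith) _)

@[fun_prop]
lemma measurable_powKernel (e cp cm : ℝ) : Measurable (powKernel e cp cm) := by
  unfold powKernel
  exact Measurable.ite measurableSet_Ioi (by fun_prop) (by fun_prop)

lemma tendsto_abs_div_abs_add (c : ℝ) {l : Filter ℝ} (hl : Tendsto (fun x : ℝ => |x|) l atTop) :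
    Tendsto (fun x : ℝ => |x| / |x + c|) l (𝓝 1) := by
  have hinv : Tendsto (fun x : ℝ => c / x) l (𝓝 0) := by
    rw [tendsto_zero_iff_abs_tendsto_zero]
    refine (hl.const_div_atTop |c|).congr fun x => ?_
    simp [abs_div]
  have h1 : Tendsto (fun x : ℝ => |1 + c / x|⁻¹) l (𝓝 1) := by
    have : Tendsto (fun x : ℝ => |1 + c / x|⁻¹) l (𝓝 (|(1 : ℝ) + 0|⁻¹)) :=
      ((hinv.const_add 1).abs).inv₀ (by norm_num)
    simpa using this
  refine h1.congr' ?_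
  filter_upwards [hl.eventually_gt_atTop 0] with x hx
  have hx0 : x ≠ 0 := abs_pos.1 hx
  rw [← abs_div, ← abs_inv, ← inv_div]
  congr 2
  field_simp

/-- Power asymptotics are not affected by a shift of the argument. -/
lemma tendsto_shift_mul_abs_rpow {D : ℝ → ℝ} {e a : ℝ} (c : ℝ) {l : Filter ℝ}
    (hl : Tendsto (fun x : ℝ => |x|) l atTop) (hlc : Tendsto (fun x : ℝ => x + c) l l)
    (hD : Tendsto (fun x => D x * |x| ^ e) l (𝓝 a)) :
    Tendsto (fun x => D (x + c) * |x| ^ e) l (𝓝 a) := by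
  have h1 := (tendsto_abs_div_abs_add c hl).rpow_const (p := e) (Or.inl one_ne_zero)
  have h2 := (hD.comp hlc).mul h1
  rw [Real.one_rpow, mul_one] at h2
  refine h2.congr' ?_
  filter_upwards [(hl.comp hlc).eventually_gt_atTop 0] with x hx
  simp only [Function.comp_apply] at hx ⊢
  rw [Real.div_rpow (abs_nonneg _) (abs_nonneg _)]
  have := (Real.rpow_pos_of_pos hx e).ne'
  field_simp

lemma tendsto_abs_intCast_atTop : Tendsto (fun m : ℤ => |(m : ℝ)|) atTop atTop :=
  tendsto_abs_atTop_atTop.comp tendsto_intCast_atTop_atTop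

lemma tendsto_abs_intCast_atBot : Tendsto (fun m : ℤ => |(m : ℝ)|) atBot atTop :=
  tendsto_abs_atBot_atTop.comp (tendsto_intCast_atBot_iff.2 tendsto_id)

lemma HasPowTails.shift {g : ℤ → ℝ} {e cp cm : ℝ} (hg : HasPowTails g e cp cm) (c : ℤ) :
    HasPowTails (fun m => g (m + c)) e cp cm := by
  have key : ∀ {l : Filter ℤ} {a : ℝ}, Tendsto (fun m : ℤ => |(m : ℝ)|) l atTop →
      Tendsto (fun m : ℤ => m + c) l l → Tendsto (fun m : ℤ => g m * |(m : ℝ)| ^ (-e)) l (𝓝 a) →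
      Tendsto (fun m : ℤ => g (m + c) * |(m : ℝ)| ^ (-e)) l (𝓝 a) := by
    intro l a hl hlc hga
    have h1 := tendsto_shift_mul_abs_rpow (D := fun x => g ⌊x⌋) (e := -e) (a := a) (c : ℝ)
      (l := l.map ((↑) : ℤ → ℝ)) (tendsto_map'_iff.2 hl)
      (by
        refine tendsto_map'_iff.2 ((tendsto_map.comp hlc).congr fun m => ?_)
        simp)
      (tendsto_map'_iff.2 (hga.congr fun m => by simp))
    refine (tendsto_map'_iff.1 h1).congr fun m => ?_
    simp only [Function.comp_apply]
    rw [← Int.cast_add, Int.floor_intCast]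
  exact ⟨key tendsto_abs_intCast_atTop (tendsto_atTop_add_const_right _ c tendsto_id) hg.1,
    key tendsto_abs_intCast_atBot (tendsto_atBot_add_const_right _ c tendsto_id) hg.2⟩

lemma HasPowTails.neg {g : ℤ → ℝ} {e cp cm : ℝ} (hg : HasPowTails g e cp cm) :
    HasPowTails (fun m => g (-m)) e cm cp := by
  constructor
  · refine (hg.2.comp tendsto_neg_atTop_atBot).congr fun m => ?_
    simp
  · refine (hg.1.comp tendsto_neg_atBot_atTop).congr fun m => ?_
    simp

/-- As `g 0` is arbitrary, the bound is in terms of `1 + |m|`. -/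
lemma HasPowTails.exists_bound {g : ℤ → ℝ} {e cp cm : ℝ} (hg : HasPowTails g e cp cm) (he : e ≤ 0) :
    ∃ C, 0 ≤ C ∧ ∀ m, |g m| ≤ C * (1 + |(m : ℝ)|) ^ e := by
  -- On each tail `|m|` may be replaced by `1 + |m|`.
  have key : ∀ {l : Filter ℤ} {a : ℝ}, Tendsto (fun m : ℤ => |(m : ℝ)|) l atTop →
      Tendsto (fun m : ℤ => g m * |(m : ℝ)| ^ (-e)) l (𝓝 a) →
      ∀ᶠ m in l, |g m| * (1 + |(m : ℝ)|) ^ (-e) ≤ (|a| + 1) * 2 ^ (-e) := by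
    intro l a hl hga
    filter_upwards [hl.eventually_ge_atTop 1,
      hga.abs.eventually (eventually_le_nhds (show |a| < |a| + 1 by linarith))] with m hm1 hm2
    rw [abs_mul, abs_of_nonneg (Real.rpow_nonneg (abs_nonneg _) _)] at hm2
    calc |g m| * (1 + |(m : ℝ)|) ^ (-e) ≤ |g m| * (2 * |(m : ℝ)|) ^ (-e) :=
          mul_le_mul_of_nonneg_left
            (Real.rpow_le_rpow (by positivity) (by linarith) (by linarith)) (abs_nonneg _)
      _ = |g m| * |(m : ℝ)| ^ (-e) * 2 ^ (-e) := by
          rw [Real.mul_rpow (by norm_num) (abs_nonneg _)]; ring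
      _ ≤ _ := mul_le_mul_of_nonneg_right hm2 (by positivity)
  obtain ⟨N1, hN1⟩ := eventually_atTop.1 (key tendsto_abs_intCast_atTop hg.1)
  obtain ⟨N2, hN2⟩ := eventually_atBot.1 (key tendsto_abs_intCast_atBot hg.2)
  refine ⟨(|cp| + 1) * 2 ^ (-e) + (|cm| + 1) * 2 ^ (-e) +
    ∑ m ∈ Finset.Icc N2 N1, |g m| * (1 + |(m : ℝ)|) ^ (-e), by positivity, fun m => ?_⟩
  have hpos : 0 < 1 + |(m : ℝ)| := by positivity
  have h3 : 0 ≤ (|cp| + 1) * (2 : ℝ) ^ (-e) := by positivity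
  have h4 : 0 ≤ (|cm| + 1) * (2 : ℝ) ^ (-e) := by positivity
  have h5 : 0 ≤ ∑ m ∈ Finset.Icc N2 N1, |g m| * (1 + |(m : ℝ)|) ^ (-e) :=
    Finset.sum_nonneg fun _ _ => by positivity
  rw [← div_le_iff₀ (Real.rpow_pos_of_pos hpos e), div_eq_mul_inv, ← Real.rpow_neg hpos.le]
  rcases le_or_gt N1 m with h | h
  · linarith [hN1 m h]
  rcases le_or_gt m N2 with h' | h'
  · linarith [hN2 m h']
  have := Finset.single_le_sum (f := fun m : ℤ => |g m| * (1 + |(m : ℝ)|) ^ (-e))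
    (fun _ _ => by positivity) (Finset.mem_Icc.2 ⟨h'.le, h.le⟩)
  linarith

/-- Rescaled step functions of a sequence with power tails converge off the diagonal. -/
lemma HasPowTails.tendsto_floor {g : ℤ → ℝ} {e cp cm : ℝ} (hg : HasPowTails g e cp cm) {x y : ℝ}
    (hxy : x ≠ y) :
    Tendsto (fun n : ℕ => (n : ℝ) ^ (-e) * g (⌊n * x⌋ - ⌊n * y⌋)) atTop
      (𝓝 (powKernel e cp cm (x - y))) := by
  have hr : Tendsto (fun n : ℕ => ((⌊n * x⌋ - ⌊n * y⌋ : ℤ) : ℝ) / n) atTop (𝓝 (x - y)) := by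
    have h1 : ∀ z : ℝ, Tendsto (fun n : ℕ => (⌊(n : ℝ) * z⌋ : ℝ) / n) atTop (𝓝 z) := by
      intro z
      have h0 : Tendsto (fun n : ℕ => z - 1 / (n : ℝ)) atTop (𝓝 (z - 0)) :=
        tendsto_one_div_atTop_nhds_zero_nat.const_sub z
      rw [sub_zero] at h0
      refine tendsto_of_tendsto_of_tendsto_of_le_of_le' h0 tendsto_const_nhds ?_ ?_
      · filter_upwards [eventually_gt_atTop 0] with n hn
        have hn' : (0 : ℝ) < n := by exact_mod_cast hn
        rw [le_div_iff₀ hn', sub_mul, one_div, inv_mul_cancel₀ hn'.ne']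
        linarith [Int.lt_floor_add_one ((n : ℝ) * z)]
      · filter_upwards [eventually_gt_atTop 0] with n hn
        have hn' : (0 : ℝ) < n := by exact_mod_cast hn
        rw [div_le_iff₀ hn']
        linarith [Int.floor_le ((n : ℝ) * z)]
    refine ((h1 x).sub (h1 y)).congr fun n => ?_
    push_cast; rw [sub_div]
  have habs : Tendsto (fun n : ℕ => (|((⌊n * x⌋ - ⌊n * y⌋ : ℤ) : ℝ)| / n) ^ e) atTop
      (𝓝 (|x - y| ^ e)) := by
    have h2 : Tendsto (fun n : ℕ => |((⌊n * x⌋ - ⌊n * y⌋ : ℤ) : ℝ)| / n) atTop (𝓝 |x - y|) := by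
      refine hr.abs.congr fun n => ?_
      rw [abs_div, Nat.abs_cast]
    exact h2.rpow_const (Or.inl (abs_pos.2 (sub_ne_zero.2 hxy)).ne')
  have hmul : Tendsto (fun n : ℕ => ((⌊n * x⌋ - ⌊n * y⌋ : ℤ) : ℝ) / n * n) atTop
      (if 0 < x - y then atTop else atBot) := by
    split_ifs with h
    · exact hr.pos_mul_atTop h tendsto_natCast_atTop_atTop
    · exact hr.neg_mul_atTop (lt_of_le_of_ne (not_lt.1 h) (sub_ne_zero.2 hxy))
        tendsto_natCast_atTop_atTop
  have hmul' : Tendsto (fun n : ℕ => ((⌊n * x⌋ - ⌊n * y⌋ : ℤ) : ℝ)) atTop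
      (if 0 < x - y then atTop else atBot) := by
    refine hmul.congr' ?_
    filter_upwards [eventually_gt_atTop 0] with n hn
    have : (n : ℝ) ≠ 0 := by exact_mod_cast hn.ne'
    field_simp
  have hfin : Tendsto (fun n : ℕ => g (⌊n * x⌋ - ⌊n * y⌋) *
      |((⌊n * x⌋ - ⌊n * y⌋ : ℤ) : ℝ)| ^ (-e)) atTop (𝓝 (if 0 < x - y then cp else cm)) := by
    split_ifs at hmul' ⊢ with h
    · exact hg.1.comp (tendsto_intCast_atTop_iff.1 hmul')
    · exact hg.2.comp (tendsto_intCast_atBot_iff.1 hmul')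
  have hne : ∀ᶠ n : ℕ in atTop, (0 : ℝ) < |((⌊n * x⌋ - ⌊n * y⌋ : ℤ) : ℝ)| := by
    have : Tendsto (fun n : ℕ => |((⌊n * x⌋ - ⌊n * y⌋ : ℤ) : ℝ)|) atTop atTop := by
      split_ifs at hmul' with h
      · exact tendsto_abs_atTop_atTop.comp hmul'
      · exact tendsto_abs_atBot_atTop.comp hmul'
    exact this.eventually_gt_atTop 0
  have hlim : powKernel e cp cm (x - y) = (if 0 < x - y then cp else cm) * |x - y| ^ e := by
    unfold powKernel
    split_ifs with h
    · rw [abs_of_pos h]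
    · rw [abs_of_nonpos (not_lt.1 h)]
  rw [hlim]
  refine (hfin.mul habs).congr' ?_
  filter_upwards [hne, eventually_gt_atTop 0] with n hn hn0
  have hn0' : (0 : ℝ) < n := by exact_mod_cast hn0
  rw [Real.div_rpow hn.le hn0'.le, Real.rpow_neg hn.le, Real.rpow_neg hn0'.le]
  have := (Real.rpow_pos_of_pos hn e).ne'
  field_simp

/-- A bound for the rescaled step functions of a sequence with power decay that does not depend on
`n`. -/
lemma abs_floor_le {g : ℤ → ℝ} {e C : ℝ} (he : e < 0) (hC : 0 ≤ C)
    (hg : ∀ m, |g m| ≤ C * (1 + |(m : ℝ)|) ^ e) {n : ℕ} (hn : 0 < n) {x y : ℝ} (hxy : x ≠ y) :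
    |(n : ℝ) ^ (-e) * g (⌊n * x⌋ - ⌊n * y⌋)| ≤ C * |x - y| ^ e := by
  have hn' : (0 : ℝ) < n := by exact_mod_cast hn
  have hd : 0 < |x - y| := abs_pos.2 (sub_ne_zero.2 hxy)
  have h1 : n * |x - y| ≤ 1 + |((⌊n * x⌋ - ⌊n * y⌋ : ℤ) : ℝ)| := by
    have hx1 := Int.floor_le ((n : ℝ) * x)
    have hx2 := Int.lt_floor_add_one ((n : ℝ) * x)
    have hy1 := Int.floor_le ((n : ℝ) * y)
    have hy2 := Int.lt_floor_add_one ((n : ℝ) * y)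
    rw [← abs_of_pos hn', ← abs_mul, abs_of_pos hn']
    push_cast
    rw [abs_le]
    constructor
    · nlinarith [neg_abs_le ((⌊(n : ℝ) * x⌋ : ℝ) - ⌊(n : ℝ) * y⌋)]
    · nlinarith [le_abs_self ((⌊(n : ℝ) * x⌋ : ℝ) - ⌊(n : ℝ) * y⌋)]
  rw [abs_mul, abs_of_nonneg (Real.rpow_nonneg hn'.le _)]
  calc (n : ℝ) ^ (-e) * |g (⌊n * x⌋ - ⌊n * y⌋)|
      ≤ (n : ℝ) ^ (-e) * (C * (1 + |((⌊n * x⌋ - ⌊n * y⌋ : ℤ) : ℝ)|) ^ e) :=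
        mul_le_mul_of_nonneg_left (hg _) (Real.rpow_nonneg hn'.le _)
    _ ≤ (n : ℝ) ^ (-e) * (C * (n * |x - y|) ^ e) := by
        refine mul_le_mul_of_nonneg_left (mul_le_mul_of_nonneg_left ?_ hC)
          (Real.rpow_nonneg hn'.le _)
        exact Real.rpow_le_rpow_of_nonpos (by positivity) h1 he.le
    _ = C * |x - y| ^ e := by
        rw [Real.mul_rpow hn'.le hd.le, Real.rpow_neg hn'.le]
        have := (Real.rpow_pos_of_pos hn' e).ne'
        field_simp

lemma ae_forall_ne_finRotate {p : ℕ} (hp : 2 ≤ p) :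
    ∀ᵐ x ∂(volume.restrict (Set.Icc (0 : Fin p → ℝ) 1)), ∀ k, x k ≠ x (finRotate p k) := by
  refine ae_restrict_of_ae ?_
  rw [eventually_countable_forall]
  intro k
  have hk : finRotate p k ≠ k := by
    obtain ⟨q, rfl⟩ : ∃ q, p = q + 2 := ⟨p - 2, by omega⟩
    exact Equiv.Perm.mem_support.1 (by simp [support_finRotate])
  let V : Submodule ℝ (Fin p → ℝ) := LinearMap.ker
    ((LinearMap.proj k : (Fin p → ℝ) →ₗ[ℝ] ℝ) - LinearMap.proj (finRotate p k))
  have hV : V ≠ ⊤ := by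
    intro h
    have : (Pi.single k 1 : Fin p → ℝ) ∈ V := by rw [h]; trivial
    simp only [V, LinearMap.mem_ker, LinearMap.sub_apply, LinearMap.proj_apply, Pi.single_eq_same,
      Pi.single_eq_of_ne hk, sub_zero] at this
    exact one_ne_zero this
  have := Measure.addHaar_submodule volume V hV
  rw [ae_iff]
  convert! this using 2
  ext x
  simp [V, sub_eq_zero]

/-- The integrability of cyclic products of homogeneous kernels. -/
lemma integrableOn_prod_powKernel {p : ℕ} (hp : 2 ≤ p) {e cp cm : Fin p → ℝ} (he0 : ∀ k, e k < 0)
    (he1 : ∀ k, -1 < e k) (he : 1 - (p : ℝ) < ∑ k, e k) :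
    IntegrableOn (fun x : Fin p → ℝ =>
      ∏ k, powKernel (e k) (cp k) (cm k) (x k - x (finRotate p k))) (Set.Icc 0 1) := by
  have hdom := (integrableOn_prod_abs_rpow hp (u := fun k => -e k) (fun k => by linarith [he0 k])
    (fun k => by linarith [he1 k]) (by rw [Finset.sum_neg_distrib]; linarith)).const_mul
      (∏ k, (|cp k| + |cm k|))
  refine hdom.mono' (Measurable.aestronglyMeasurable (by fun_prop))
    (Eventually.of_forall fun x => ?_)
  rw [Real.norm_eq_abs, Finset.abs_prod, ← Finset.prod_mul_distrib]
  refine Finset.prod_le_prod (fun k _ => abs_nonneg _) fun k _ => ?_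
  rw [neg_neg]
  exact abs_powKernel_le _ _ _ _

/-- Riemann sums: cyclic sums of products of sequences with power tails converge, after rescaling,
to the integral of the cyclic product of the corresponding homogeneous kernels. -/
lemma tendsto_cyclic_sum {p : ℕ} (hp : 2 ≤ p) {g : Fin p → ℤ → ℝ} {e cp cm : Fin p → ℝ}
    (he0 : ∀ k, e k < 0) (he1 : ∀ k, -1 < e k) (he : 1 - (p : ℝ) < ∑ k, e k)
    (hg : ∀ k, HasPowTails (g k) (e k) (cp k) (cm k)) :
    Tendsto (fun n : ℕ => (n : ℝ) ^ (-(∑ k, e k) - p) *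
        ∑ m : Fin p → Fin n, ∏ k, g k ((m k : ℤ) - m (finRotate p k))) atTop
      (𝓝 (∫ x in Set.Icc (0 : Fin p → ℝ) 1,
        ∏ k, powKernel (e k) (cp k) (cm k) (x k - x (finRotate p k)))) := by
  choose C hC0 hC using fun k => (hg k).exists_bound (he0 k).le
  have hdom := (integrableOn_prod_abs_rpow hp (u := fun k => -e k) (fun k => by linarith [he0 k])
    (fun k => by linarith [he1 k]) (by rw [Finset.sum_neg_distrib]; linarith)).const_mul
      (∏ k, C k)
  have hlim := tendsto_integral_filter_of_dominated_convergence
    (μ := volume.restrict (Set.Icc (0 : Fin p → ℝ) 1)) (l := (atTop : Filter ℕ))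
    (F := fun n x => ∏ k, ((n : ℝ) ^ (-e k) * g k (⌊n * x k⌋ - ⌊n * x (finRotate p k)⌋)))
    (f := fun x => ∏ k, powKernel (e k) (cp k) (cm k) (x k - x (finRotate p k)))
    _ (Eventually.of_forall fun n => ?_) ?_ hdom ?_
  · refine hlim.congr' ?_
    filter_upwards [eventually_gt_atTop 0] with n hn
    have hn' : (0 : ℝ) < n := by exact_mod_cast hn
    rw [setIntegral_floor hn (fun m => ∏ k, ((n : ℝ) ^ (-e k) * g k (m k - m (finRotate p k))))]
    simp_rw [Finset.prod_mul_distrib]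
    rw [← Real.rpow_sum_of_pos hn', ← Finset.mul_sum, Finset.sum_neg_distrib, ← mul_assoc,
      Real.rpow_sub hn', Real.rpow_natCast]
    ring
  · refine Measurable.aestronglyMeasurable ?_
    refine Finset.measurable_prod _ fun k _ => Measurable.const_mul ?_ _
    have : Measurable (g k) := measurable_from_top
    refine this.comp ?_
    exact (Int.measurable_floor.comp (by fun_prop)).sub (Int.measurable_floor.comp (by fun_prop))
  · filter_upwards [eventually_gt_atTop 0] with n hn
    filter_upwards [ae_forall_ne_finRotate hp] with x hx
    rw [Real.norm_eq_abs, Finset.abs_prod, ← Finset.prod_mul_distrib]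
    refine Finset.prod_le_prod (fun k _ => abs_nonneg _) fun k _ => ?_
    rw [neg_neg]
    exact abs_floor_le (he0 k) (hC0 k) (hC k) hn (hx k)
  · filter_upwards [ae_forall_ne_finRotate hp] with x hx
    exact tendsto_finsetProd _ fun k _ => (hg k).tendsto_floor (hx k)

/-! ### Cumulants of bilinear Gaussian statistics -/

/-- The entries of powers of a matrix as sums over paths. -/
lemma matrix_pow_succ_apply {ι : Type*} [Fintype ι] [DecidableEq ι] (A : Matrix ι ι ℝ) (q : ℕ) :
    ∀ i j, (A ^ (q + 1)) i j = ∑ t : Fin q → ι,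
      (∏ k : Fin q, A (Fin.cons (α := fun _ => ι) i t k.castSucc)
        (Fin.cons (α := fun _ => ι) i t k.succ)) *
      A (Fin.cons (α := fun _ => ι) i t (Fin.last q)) j := by
  induction q with
  | zero => intro i j; simp
  | succ q ih =>
    intro i j
    rw [pow_succ', Matrix.mul_apply, ← (Fin.consEquiv fun _ : Fin (q + 1) => ι).sum_comp,
      Fintype.sum_prod_type]
    refine Finset.sum_congr rfl fun l _ => ?_
    rw [ih, Finset.mul_sum]
    refine Finset.sum_congr rfl fun t _ => ?_
    rw [Fin.prod_univ_succ, ← mul_assoc, ← Fin.succ_last]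
    simp [Fin.consEquiv]

/-- The trace of a power of a matrix as a sum over closed paths. -/
lemma trace_pow_eq_sum_cycles {ι : Type*} [Fintype ι] [DecidableEq ι] (A : Matrix ι ι ℝ) {p : ℕ}
    (hp : 1 ≤ p) :
    (A ^ p).trace = ∑ v : Fin p → ι, ∏ k, A (v k) (v (finRotate p k)) := by
  obtain ⟨q, rfl⟩ : ∃ q, p = q + 1 := ⟨p - 1, by omega⟩
  rw [Matrix.trace, ← (Fin.consEquiv fun _ : Fin (q + 1) => ι).sum_comp, Fintype.sum_prod_type]
  refine Finset.sum_congr rfl fun i _ => ?_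
  rw [Matrix.diag_apply, matrix_pow_succ_apply]
  refine Finset.sum_congr rfl fun t _ => ?_
  rw [Fin.prod_univ_castSucc]
  simp [Fin.consEquiv]

lemma IsGaussianProcess.hasGaussianLaw_of_fintype {T Ω : Type*} [Fintype T] [MeasurableSpace Ω]
    {P : Measure Ω} {X : T → Ω → ℝ} (hX : IsGaussianProcess X P) :
    HasGaussianLaw (fun ω t => X t ω) P :=
  (hX.hasGaussianLaw Finset.univ).map_fun (ContinuousLinearMap.pi fun t =>
    (ContinuousLinearMap.proj (R := ℝ) (φ := fun _ : (Finset.univ : Finset T) => ℝ)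
      ⟨t, Finset.mem_univ t⟩))

section Bilinear

variable {E Ω : Type*} [Fintype E] [DecidableEq E] [MeasurableSpace Ω] {P : Measure Ω}

/-- The symmetric matrix of the quadratic form `∑ e, w e * x (e, 0) * x (e, 1)`. -/
noncomputable def pairingMat (w : E → ℝ) : Matrix (E × Fin 2) (E × Fin 2) ℝ :=
  Matrix.of fun a b => if b = (a.1, 1 - a.2) then w a.1 / 2 else 0

omit [Fintype E] in
lemma pairingMat_isSymm (w : E → ℝ) : (pairingMat w).IsSymm := by
  ext ⟨e, i⟩ ⟨e', i'⟩
  simp only [pairingMat, Matrix.transpose_apply, Matrix.of_apply, Prod.mk.injEq]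
  by_cases h : e = e'
  · subst h
    have : i = 1 - i' ↔ i' = 1 - i := by fin_cases i <;> fin_cases i' <;> simp
    simp [this]
  · simp [h, Ne.symm h]

lemma dotProduct_pairingMat (w : E → ℝ) (x : E × Fin 2 → ℝ) :
    x ⬝ᵥ (pairingMat w).mulVec x = ∑ e, w e * (x (e, 0) * x (e, 1)) := by
  simp only [dotProduct, Matrix.mulVec, pairingMat, Matrix.of_apply, ite_mul, zero_mul,
    Finset.sum_ite_eq', Finset.mem_univ, if_true]
  rw [Fintype.sum_prod_type]
  refine Finset.sum_congr rfl fun e _ => ?_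
  simp only [Fin.sum_univ_two]
  simp; ring

/-- Cumulants of a weighted sum of products of jointly Gaussian variables, as a sum over cycles. -/
lemma cumulant_sum_mul [IsProbabilityMeasure P] {X : E × Fin 2 → Ω → ℝ}
    (hX : HasGaussianLaw (fun ω v => X v ω) P) (h0 : ∀ v, ∫ ω, X v ω ∂P = 0) (w : E → ℝ) (c : ℝ)
    {p : ℕ} (hp : 2 ≤ p) :
    cumulant p (fun ω => ∑ e, w e * (X (e, 0) ω * X (e, 1) ω) + c) P =
      2 ^ (p - 1) * (p - 1).factorial * ∑ i : Fin p → Fin 2, ∑ e : Fin p → E, ∏ k,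
        (w (e k) / 2 * cov[X (e k, i k), X (e (finRotate p k), 1 - i (finRotate p k)); P]) := by
  have h1 := cumulant_quadraticForm hX h0 (pairingMat_isSymm w) c hp
  simp_rw [dotProduct_pairingMat] at h1
  rw [h1, trace_pow_eq_sum_cycles _ (by omega)]
  congr 1
  have hA : ∀ a b : E × Fin 2, (covMat X P * pairingMat w) a b =
      w b.1 / 2 * cov[X a, X (b.1, 1 - b.2); P] := by
    rintro a ⟨e, i⟩
    have : ∀ b : E × Fin 2, pairingMat w b (e, i) = if b = (e, 1 - i) then w e / 2 else 0 := by
      intro b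
      rw [← (pairingMat_isSymm w).apply]
      simp [pairingMat]
    simp only [Matrix.mul_apply, this, mul_ite, mul_zero, Finset.sum_ite_eq', Finset.mem_univ,
      if_true, covMat, Matrix.of_apply]
    ring
  simp_rw [hA]
  rw [← (Equiv.arrowProdEquivProdArrow (Fin p) (fun _ => E) (fun _ => Fin 2)).symm.sum_comp,
    Fintype.sum_prod_type, Finset.sum_comm]
  refine Finset.sum_congr rfl fun i _ => Finset.sum_congr rfl fun e _ => ?_
  rw [Finset.prod_mul_distrib, Finset.prod_mul_distrib]
  congr 1
  exact Equiv.prod_comp (finRotate p) fun k => w (e k) / 2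

end Bilinear

/-- The kernels `zKernel` are homogeneous functions of `x - y`; their coefficients are the values at
`(1, 0)` and `(0, 1)`. -/
lemma zKernel_eq_powKernel (H α ν : Fin 2 → ℝ) (ρ η : ℝ) (i j : Fin 2) (x y : ℝ) :
    zKernel H α ν ρ η i j x y = powKernel (H i + H j - 2) (zKernel H α ν ρ η i j 1 0)
      (zKernel H α ν ρ η i j 0 1) (x - y) := by
  have h2 : ∀ i, H i + H i - 2 = 2 * H i - 2 := fun i => by ring
  have h01 : ¬ (1 : ℝ) < 0 := by norm_num
  have h10 : H 1 + H 0 - 2 = H 0 + H 1 - 2 := by ring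
  have hd : ∀ i, zKernel H α ν ρ η i i x y = powKernel (H i + H i - 2)
      (zKernel H α ν ρ η i i 1 0) (zKernel H α ν ρ η i i 0 1) (x - y) := by
    intro i
    simp only [zKernel, powKernel, if_true, h2]
    split_ifs with h
    · rw [abs_of_pos h]; simp
    · rw [abs_of_nonpos (not_lt.1 h)]; simp
  fin_cases i <;> fin_cases j
  · exact hd 0
  · rcases lt_or_ge y x with h | h
    · simp [zKernel, powKernel, h]; ring
    · simp [zKernel, powKernel, h.not_gt, h01]; ring
  · rcases lt_or_ge y x with h | h
    · simp [zKernel, powKernel, h, h10]; ring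
    · simp [zKernel, powKernel, h.not_gt, h01, h10]; ring
  · exact hd 1

lemma cyclicProd_eq (H α ν : Fin 2 → ℝ) (ρ η : ℝ) (p : ℕ) (i j : Fin p → Fin 2) (x : Fin p → ℝ) :
    cyclicProd H α ν ρ η p i j x = ∏ k, powKernel (H (i k) + H (j k) - 2)
      (zKernel H α ν ρ η (i k) (j k) 1 0) (zKernel H α ν ρ η (i k) (j k) 0 1)
      (x k - x (finRotate p k)) :=
  Finset.prod_congr rfl fun _ _ => zKernel_eq_powKernel ..

lemma admissible_iff {p : ℕ} {i j : Fin p → Fin 2} :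
    Admissible p i j ↔ j = fun k => 1 - i (finRotate p k) := by
  have : ∀ a b : Fin 2, a ≠ b ↔ b = 1 - a := by decide
  simp only [Admissible, this, funext_iff]

/-- Admissibility determines the second index, so the limit is a sum over the first one. -/
lemma limitCumulant_eq (H α ν : Fin 2 → ℝ) (ρ η A : ℝ) (p : ℕ) :
    limitCumulant H α ν ρ η A p = 2 ^ (p - 1) * ((p - 1).factorial : ℝ) * A ^ p *
      ∑ i : Fin p → Fin 2, ∫ x in Set.Icc (0 : Fin p → ℝ) 1,
        cyclicProd H α ν ρ η p i (fun k => 1 - i (finRotate p k)) x := by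
  unfold limitCumulant
  congr 1
  refine Finset.sum_congr rfl fun i _ => ?_
  simp_rw [admissible_iff]
  rw [Finset.filter_eq' Finset.univ, if_pos (Finset.mem_univ _), Finset.sum_singleton]

/-- Along an admissible cycle the exponents of the kernels add up to `p (h - 2)`. -/
lemma sum_exponents (H : Fin 2 → ℝ) {p : ℕ} (i : Fin p → Fin 2) :
    ∑ k, (H (i k) + H (1 - i (finRotate p k)) - 2) = p * (H 0 + H 1 - 2) := by
  rw [Finset.sum_sub_distrib, Finset.sum_add_distrib,
    Equiv.sum_comp (finRotate p) fun k => H (1 - i k), ← Finset.sum_add_distrib]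
  have : ∀ a : Fin 2, H a + H (1 - a) = H 0 + H 1 := by
    intro a; fin_cases a <;> simp [add_comm]
  simp_rw [this]
  simp; ring

lemma half_lt_hurst {H : Fin 2 → ℝ} (hH : ∀ i, 0 < H i ∧ H i < 1) (hH32 : 3 / 2 < H 0 + H 1)
    (i : Fin 2) : 1 / 2 < H i := by
  have h0 := (hH 0).2
  have h1 := (hH 1).2
  fin_cases i
  · simp only [Fin.zero_eta]; linarith
  · simp only [Fin.mk_one]; linarith

lemma integrableOn_cyclicProd {H : Fin 2 → ℝ} (hH : ∀ i, 0 < H i ∧ H i < 1)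
    (hH32 : 3 / 2 < H 0 + H 1) (α ν : Fin 2 → ℝ) (ρ η : ℝ) {p : ℕ} (hp : 2 ≤ p)
    {i j : Fin p → Fin 2} (hij : Admissible p i j) :
    IntegrableOn (cyclicProd H α ν ρ η p i j) (Set.Icc (0 : Fin p → ℝ) 1) := by
  have hp' : (2 : ℝ) ≤ p := by exact_mod_cast hp
  rw [admissible_iff] at hij
  subst hij
  have h12 := half_lt_hurst hH hH32
  simp only [funext (cyclicProd_eq H α ν ρ η p i _)]
  refine integrableOn_prod_powKernel hp (fun k => ?_) (fun k => ?_) ?_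
  · linarith [(hH (i k)).2, (hH (1 - i (finRotate p k))).2]
  · linarith [h12 (i k), h12 (1 - i (finRotate p k))]
  · rw [sum_exponents]; nlinarith

/-- The non-central limit theorem for cumulants, for bilinear statistics of a pair of jointly
stationary Gaussian sequences whose covariances have power tails. The sequences may depend on `n`
as long as their covariances do not. -/
theorem tendsto_cumulant_bilinear {Ω : Type*} [MeasurableSpace Ω] {P : Measure Ω}
    [IsProbabilityMeasure P] {H α ν : Fin 2 → ℝ} {ρ η : ℝ} (hH : ∀ i, 0 < H i ∧ H i < 1)
    (hH32 : 3 / 2 < H 0 + H 1) {X : ℕ → Fin 2 → ℤ → Ω → ℝ}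
    (hX : ∀ n, IsGaussianProcess (fun q : Fin 2 × ℤ => X n q.1 q.2) P)
    (h0 : ∀ n i m, ∫ ω, X n i m ω ∂P = 0) {γ : Fin 2 → Fin 2 → ℤ → ℝ}
    (hγ : ∀ n i j m l, cov[X n i m, X n j l; P] = γ i j (m - l))
    (htail : ∀ i j, HasPowTails (γ i j) (H i + H j - 2) (2 * zKernel H α ν ρ η i j 1 0)
      (2 * zKernel H α ν ρ η i j 0 1))
    {κ : Type*} [Fintype κ] (a : κ → ℝ) (b : κ → Fin 2 → ℤ) (c : ℕ → ℝ) {p : ℕ} (hp : 2 ≤ p) :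
    Tendsto (fun n : ℕ => cumulant p (fun ω => ∑ e : κ × Fin n,
        (n : ℝ) ^ (1 - (H 0 + H 1)) * a e.1 *
          (X n 0 (e.2 + b e.1 0) ω * X n 1 (e.2 + b e.1 1) ω) + c n) P) atTop
      (𝓝 (limitCumulant H α ν ρ η (∑ r, a r) p)) := by
  classical
  have hp' : (2 : ℝ) ≤ p := by exact_mod_cast hp
  have h12 := half_lt_hurst hH hH32
  have hcum : ∀ n : ℕ, cumulant p (fun ω => ∑ e : κ × Fin n, (n : ℝ) ^ (1 - (H 0 + H 1)) * a e.1 *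
        (X n 0 (e.2 + b e.1 0) ω * X n 1 (e.2 + b e.1 1) ω) + c n) P =
      2 ^ (p - 1) * (p - 1).factorial * ∑ i : Fin p → Fin 2, ∑ r : Fin p → κ,
        (∏ k, a (r k)) * ((1 / 2) ^ p * (((n : ℝ) ^ (1 - (H 0 + H 1))) ^ p *
          ∑ m : Fin p → Fin n, ∏ k, γ (i k) (1 - i (finRotate p k)) ((m k : ℤ) - m (finRotate p k)
            + (b (r k) (i k) - b (r (finRotate p k)) (1 - i (finRotate p k)))))) := by
    intro n
    have hG : HasGaussianLaw (fun ω (v : (κ × Fin n) × Fin 2) =>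
        X n v.2 (v.1.2 + b v.1.1 v.2) ω) P :=
      IsGaussianProcess.hasGaussianLaw_of_fintype
        ((hX n).comp_right fun v : (κ × Fin n) × Fin 2 => (v.2, (v.1.2 : ℤ) + b v.1.1 v.2))
    rw [cumulant_sum_mul (X := fun v : (κ × Fin n) × Fin 2 => X n v.2 (v.1.2 + b v.1.1 v.2)) hG
      (fun v => h0 _ _ _) (fun e => (n : ℝ) ^ (1 - (H 0 + H 1)) * a e.1) (c n) hp]
    congr 1
    refine Finset.sum_congr rfl fun i _ => ?_
    rw [← (Equiv.arrowProdEquivProdArrow (Fin p) (fun _ => κ) (fun _ => Fin n)).symm.sum_comp,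
      Fintype.sum_prod_type]
    refine Finset.sum_congr rfl fun r _ => ?_
    rw [Finset.mul_sum, Finset.mul_sum, Finset.mul_sum]
    refine Finset.sum_congr rfl fun m _ => ?_
    simp only [hγ, Equiv.arrowProdEquivProdArrow, Equiv.coe_fn_symm_mk]
    rw [Finset.prod_mul_distrib]
    have hw : ∏ k, ((n : ℝ) ^ (1 - (H 0 + H 1)) * a (r k) / 2) =
        (∏ k, a (r k)) * ((1 / 2) ^ p * ((n : ℝ) ^ (1 - (H 0 + H 1))) ^ p) := by
      have : ∀ k, (n : ℝ) ^ (1 - (H 0 + H 1)) * a (r k) / 2 =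
          a (r k) * (1 / 2 * (n : ℝ) ^ (1 - (H 0 + H 1))) := fun k => by ring
      simp_rw [this]
      rw [Finset.prod_mul_distrib, Finset.prod_const, Finset.card_univ, Fintype.card_fin, mul_pow]
    rw [hw, mul_assoc, mul_assoc]
    congr 3
    refine Finset.prod_congr rfl fun k _ => ?_
    congr 1
    ring
  simp_rw [hcum]
  have hone : ∀ (i : Fin p → Fin 2) (r : Fin p → κ),
      Tendsto (fun n : ℕ => (1 / 2 : ℝ) ^ p * (((n : ℝ) ^ (1 - (H 0 + H 1))) ^ p *
        ∑ m : Fin p → Fin n, ∏ k, γ (i k) (1 - i (finRotate p k)) ((m k : ℤ) - m (finRotate p k)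
          + (b (r k) (i k) - b (r (finRotate p k)) (1 - i (finRotate p k)))))) atTop
        (𝓝 (∫ x in Set.Icc (0 : Fin p → ℝ) 1,
          cyclicProd H α ν ρ η p i (fun k => 1 - i (finRotate p k)) x)) := by
    intro i r
    have hlim := (tendsto_cyclic_sum hp
      (g := fun k m => γ (i k) (1 - i (finRotate p k))
        (m + (b (r k) (i k) - b (r (finRotate p k)) (1 - i (finRotate p k)))))
      (e := fun k => H (i k) + H (1 - i (finRotate p k)) - 2)
      (fun k => by linarith [(hH (i k)).2, (hH (1 - i (finRotate p k))).2])
      (fun k => by linarith [h12 (i k), h12 (1 - i (finRotate p k))])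
      (by rw [sum_exponents]; nlinarith)
      (fun k => (htail (i k) (1 - i (finRotate p k))).shift _)).const_mul ((1 / 2 : ℝ) ^ p)
    have hint : (1 / 2 : ℝ) ^ p * ∫ x in Set.Icc (0 : Fin p → ℝ) 1,
        ∏ k, powKernel (H (i k) + H (1 - i (finRotate p k)) - 2)
          (2 * zKernel H α ν ρ η (i k) (1 - i (finRotate p k)) 1 0)
          (2 * zKernel H α ν ρ η (i k) (1 - i (finRotate p k)) 0 1) (x k - x (finRotate p k)) =
        ∫ x in Set.Icc (0 : Fin p → ℝ) 1,
          cyclicProd H α ν ρ η p i (fun k => 1 - i (finRotate p k)) x := by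
      rw [← integral_const_mul]
      congr 1
      funext x
      have h2 : ∀ e cp cm y : ℝ, powKernel e (2 * cp) (2 * cm) y = 2 * powKernel e cp cm y := by
        intro e cp cm y; unfold powKernel; split_ifs <;> ring
      simp_rw [cyclicProd_eq, h2]
      rw [Finset.prod_mul_distrib, Finset.prod_const, Finset.card_univ, Fintype.card_fin,
        ← mul_assoc, ← mul_pow]
      norm_num
    rw [hint] at hlim
    refine hlim.congr fun n => ?_
    congr 2
    rw [sum_exponents, ← Real.rpow_mul_natCast (Nat.cast_nonneg n)]
    congr 1
    ring
  rw [limitCumulant_eq, mul_assoc]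
  refine Tendsto.const_mul _ ?_
  rw [Finset.mul_sum]
  refine tendsto_finsetSum _ fun i _ => ?_
  have hpow : (∑ r, a r) ^ p = ∑ r : Fin p → κ, ∏ k, a (r k) := by
    rw [← Fin.prod_const, Finset.prod_univ_sum]
    simp
  rw [hpow, Finset.sum_mul]
  exact tendsto_finsetSum _ fun r _ => (hone i r).const_mul _

/-! ### Covariances of bivariate fractional Brownian motion -/

/-- A function on `ℝ²` which vanishes on the axes, is homogeneous of degree `h ∈ (1, 2)`, and is the
covariance of increments starting at any point is a cross-covariance of the standard form. The
symmetric part is determined by the diagonal; the antisymmetric part defines a group cocycle of `ℝ`,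
which homogeneity forces to be symmetric and then to be an explicit coboundary, because the effect
of doubling the arguments is known in two ways. No regularity is needed. -/
lemma eq_mfBmCrossCov {g : ℝ → ℝ → ℝ} {h : ℝ} (h1 : 1 < h) (h2 : h < 2)
    (hl : ∀ s, g 0 s = 0) (hr : ∀ t, g t 0 = 0)
    (hom : ∀ c, 0 < c → ∀ t s, g (c * t) (c * s) = c ^ h * g t s)
    (hst : ∀ x t s, g (t + x) (s + x) - g (t + x) x - g x (s + x) + g x x = g t s) (t s : ℝ) :
    g t s = mfBmCrossCov (g 1 1) ((g 1 (-1) - g (-1) 1) / (2 - 2 ^ h)) h t s := by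
  have h20 : (2 : ℝ) < 2 ^ h := by
    have := Real.rpow_lt_rpow_of_exponent_lt (x := 2) (by norm_num) h1
    rwa [Real.rpow_one] at this
  have h24 : (2 : ℝ) ^ h < 4 := by
    have := Real.rpow_lt_rpow_of_exponent_lt (x := 2) (by norm_num) h2
    norm_num at this
    exact this
  have hz : (0 : ℝ) ^ h = 0 := Real.zero_rpow (by linarith)
  -- The symmetric part, determined by polarization.
  have hdpos : ∀ t, 0 < t → g t t = g 1 1 * |t| ^ h := by
    intro t ht
    have := hom t ht 1 1
    rw [mul_one] at this
    rw [this, abs_of_pos ht, mul_comm]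
  have hdiag : ∀ t, g t t = g 1 1 * |t| ^ h := by
    intro t
    rcases lt_trichotomy t 0 with ht | rfl | ht
    · have e1 := hst t (-t) (-t)
      rw [neg_add_cancel, hl, hl, hr, hdpos (-t) (by linarith), abs_neg] at e1
      linarith
    · simp [hl, hz]
    · exact hdpos t ht
  have hsym : g t s + g s t = g 1 1 * (|t| ^ h + |s| ^ h - |s - t| ^ h) := by
    have e1 := hst s (t - s) (t - s)
    rw [sub_add_cancel, hdiag t, hdiag s, hdiag (t - s), abs_sub_comm t s] at e1
    linarith
  -- The antisymmetric part and its cocycle.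
  set a : ℝ → ℝ → ℝ := fun t s => g t s - g s t with ha
  have ast : ∀ x t s, a (t + x) (s + x) - a (t + x) x - a x (s + x) = a t s := by
    intro x t s
    have e1 := hst x t s
    have e2 := hst x s t
    simp only [ha]
    linarith
  have a0 : ∀ x, a x 0 = 0 := fun x => by simp [ha, hl, hr]
  have a0' : ∀ x, a 0 x = 0 := fun x => by simp [ha, hl, hr]
  have aa : ∀ x y, a x y = -a y x := fun x y => by simp [ha]
  have ahom : ∀ c, 0 < c → ∀ t s, a (c * t) (c * s) = c ^ h * a t s := by
    intro c hc t s
    simp only [ha]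
    rw [hom c hc, hom c hc]; ring
  set b : ℝ → ℝ → ℝ := fun u v => a u (u + v) with hb
  have bhom : ∀ c, 0 < c → ∀ u v, b (c * u) (c * v) = c ^ h * b u v := by
    intro c hc u v
    simp only [hb]
    rw [← mul_add, ahom c hc]
  have bco : ∀ u v w, b u v + b (u + v) w = b v w + b u (v + w) := by
    intro u v w
    have e1 := ast u v (v + w)
    have e2 := aa (v + u) u
    simp only [hb]
    rw [show v + w + u = u + (v + w) by ring, show v + u = u + v by ring] at e1
    rw [show v + u = u + v by ring] at e2
    rw [show u + v + w = u + (v + w) by ring]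
    linarith
  -- The antisymmetrization of the cocycle is biadditive, hence homogeneous of degree `2 ≠ h`.
  have wadd : ∀ u v w, b u (v + w) - b (v + w) u = (b u v - b v u) + (b u w - b w u) := by
    intro u v w
    have e1 := bco u v w
    have e2 := bco v w u
    have e3 := bco v u w
    rw [add_comm w u] at e2
    rw [add_comm v u] at e3
    linarith
  have bsymm : ∀ u v, b u v = b v u := by
    intro u v
    have e1 := wadd (2 * u) v v
    have e2 := wadd v u u
    rw [← two_mul] at e1 e2
    have e3 := bhom 2 (by norm_num) u v
    have e4 := bhom 2 (by norm_num) v u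
    have e5 : (4 - (2 : ℝ) ^ h) * (b u v - b v u) = 0 := by linarith
    rcases mul_eq_zero.1 e5 with e6 | e6 <;> linarith
  have bdouble : ∀ u v, (2 ^ h - 2) * b u v = b (u + v) (u + v) - b u u - b v v := by
    intro u v
    have e1 := bco u v (u + v)
    have e2 := bco u u (2 * v)
    have e3 := bco v v u
    have e4 := bhom 2 (by norm_num) u v
    rw [show v + (u + v) = u + 2 * v by ring] at e1
    rw [show u + u = 2 * u by ring] at e2
    rw [show v + v = 2 * v by ring, add_comm v u] at e3
    have e5 := bsymm u v
    have e6 := bsymm u (2 * v)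
    linarith
  have bdiag : ∀ x, b x x = b 1 1 * (sgn x * |x| ^ h) := by
    have hpos : ∀ x, 0 < x → b x x = b 1 1 * |x| ^ h := by
      intro x hx
      have := bhom x hx 1 1
      rw [mul_one] at this
      rw [this, abs_of_pos hx, mul_comm]
    intro x
    rcases lt_trichotomy x 0 with hx | rfl | hx
    · have e1 := ast (2 * x) (-x) (-(2 * x))
      rw [neg_add_cancel, a0, a0, show -x + 2 * x = x by ring] at e1
      have e2 := hpos (-x) (by linarith)
      rw [abs_neg] at e2
      simp only [hb, sgn, if_neg (not_le.2 hx)] at e2 ⊢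
      rw [show -x + -x = -(2 * x) by ring] at e2
      rw [← two_mul]
      linarith
    · simp [hb, a0', hz]
    · rw [hpos x hx, sgn, if_pos hx.le, one_mul]
  have hη : g 1 (-1) - g (-1) 1 = b 1 1 := by
    have e1 := bdouble 1 (-2)
    rw [bdiag (1 + -2), bdiag (-2)] at e1
    norm_num [sgn] at e1
    have e2 : (2 ^ h - 2) * (b 1 (-2) - b 1 1) = 0 := by linarith
    rcases mul_eq_zero.1 e2 with e3 | e3
    · linarith
    · have : b 1 (-2) = g 1 (-1) - g (-1) 1 := by simp only [hb, ha]; norm_num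
      linarith
  have hanti : g t s - g s t = (g 1 (-1) - g (-1) 1) / (2 - 2 ^ h) *
      (sgn t * |t| ^ h - sgn s * |s| ^ h + sgn (s - t) * |s - t| ^ h) := by
    have e1 := bdouble t (s - t)
    rw [bdiag t, bdiag (s - t), show t + (s - t) = s by ring, bdiag s] at e1
    have e2 : b t (s - t) = g t s - g s t := by
      simp only [hb, ha]; rw [show t + (s - t) = s by ring]
    rw [e2] at e1
    rw [hη]
    have : (2 : ℝ) - 2 ^ h ≠ 0 := by linarith
    field_simp
    linarith
  rw [mfBmCrossCov]
  linarith

lemma cov_eq_of_identDistrib {Ω Ω' : Type*} [MeasurableSpace Ω] [MeasurableSpace Ω']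
    {P : Measure Ω} {P' : Measure Ω'} {U V : Ω → ℝ} {U' V' : Ω' → ℝ}
    (h : IdentDistrib (fun ω => (U ω, V ω)) (fun ω => (U' ω, V' ω)) P P') :
    cov[U, V; P] = cov[U', V'; P'] := by
  have hU : ∫ ω, U ω ∂P = ∫ ω, U' ω ∂P' := (h.comp measurable_fst).integral_eq
  have hV : ∫ ω, V ω ∂P = ∫ ω, V' ω ∂P' := (h.comp measurable_snd).integral_eq
  rw [covariance, covariance, hU, hV]
  exact (h.comp (u := fun p : ℝ × ℝ => (p.1 - ∫ ω, U' ω ∂P') * (p.2 - ∫ ω, V' ω ∂P'))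
    (by fun_prop)).integral_eq

section MfBm

variable {Ω : Type*} [MeasurableSpace Ω] {P : Measure Ω} {H : Fin 2 → ℝ}
  {B : Fin 2 → ℝ → Ω → ℝ}

lemma IsMfBm.memLp (hB : IsMfBm B H P) (i : Fin 2) (t : ℝ) : MemLp (B i t) 2 P :=
  (hB.gaussian.hasGaussianLaw_eval (i, t)).memLp_two

lemma IsMfBm.ae_eq_zero [IsProbabilityMeasure P] (hB : IsMfBm B H P) (hH : ∀ i, 0 < H i)
    (i : Fin 2) : B i 0 =ᵐ[P] 0 := by
  have h1 := (hB.fbm i).covariance 0 0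
  rw [covariance_self (hB.memLp i 0).aemeasurable] at h1
  simp only [abs_zero, sub_zero, Real.zero_rpow (by linarith [hH i] : 2 * H i ≠ 0)] at h1
  have h2 := ae_eq_integral_of_variance_eq_zero (hB.memLp i 0) (by simpa using h1)
  rw [(hB.fbm i).centered 0] at h2
  exact h2

lemma covariance_congr_ae {U U' V V' : Ω → ℝ} (hU : U =ᵐ[P] U') (hV : V =ᵐ[P] V') :
    cov[U, V; P] = cov[U', V'; P] := by
  rw [covariance, covariance, integral_congr_ae hU, integral_congr_ae hV]
  refine integral_congr_ae ?_
  filter_upwards [hU, hV] with ω h1 h2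
  rw [h1, h2]

lemma IsMfBm.cov_zero_left [IsProbabilityMeasure P] (hB : IsMfBm B H P) (hH : ∀ i, 0 < H i)
    (i : Fin 2) (V : Ω → ℝ) : cov[B i 0, V; P] = 0 := by
  rw [covariance_congr_ae (hB.ae_eq_zero hH i) (ae_eq_refl V), covariance_zero_left]

/-- The cross-covariance of a bivariate fractional Brownian motion. -/
lemma IsMfBm.cross_covariance [IsProbabilityMeasure P] (hB : IsMfBm B H P) (hH : ∀ i, 0 < H i)
    (h1 : 1 < H 0 + H 1) (h2 : H 0 + H 1 < 2) (t s : ℝ) :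
    cov[B 0 t, B 1 s; P] = mfBmCrossCov (mfBmRho B P) (mfBmEta B H P) (H 0 + H 1) t s := by
  classical
  refine eq_mfBmCrossCov (g := fun t s => cov[B 0 t, B 1 s; P]) h1 h2
    (fun s => hB.cov_zero_left hH 0 _)
    (fun t => by rw [covariance_comm]; exact hB.cov_zero_left hH 1 _) (fun c hc t s => ?_)
    (fun x t s => ?_) t s
  · have h := (hB.selfSimilar c hc {t, s}).comp
      (u := fun x : Fin 2 × ({t, s} : Finset ℝ) → ℝ => (x (0, ⟨t, by simp⟩), x (1, ⟨s, by simp⟩)))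
      (by fun_prop)
    have h' := cov_eq_of_identDistrib (U := B 0 (c * t)) (V := B 1 (c * s))
      (U' := fun ω => c ^ H 0 * B 0 t ω) (V' := fun ω => c ^ H 1 * B 1 s ω) h
    rw [h', covariance_const_mul_left, covariance_const_mul_right, ← mul_assoc,
      ← Real.rpow_add hc]
  · have h := (hB.stationaryIncrements x {t, s}).comp
      (u := fun x : Fin 2 × ({t, s} : Finset ℝ) → ℝ => (x (0, ⟨t, by simp⟩), x (1, ⟨s, by simp⟩)))
      (by fun_prop)
    have h' := cov_eq_of_identDistrib (U := fun ω => B 0 (t + x) ω - B 0 x ω)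
      (V := fun ω => B 1 (s + x) ω - B 1 x ω)
      (U' := fun ω => B 0 t ω - B 0 0 ω) (V' := fun ω => B 1 s ω - B 1 0 ω) h
    rw [covariance_fun_sub_fun_sub (hB.memLp _ _) (hB.memLp _ _) (hB.memLp _ _) (hB.memLp _ _),
      covariance_fun_sub_fun_sub (hB.memLp _ _) (hB.memLp _ _) (hB.memLp _ _) (hB.memLp _ _)] at h'
    have e1 := hB.cov_zero_left hH 0 (B 1 s)
    have e2 := hB.cov_zero_left hH 0 (B 1 0)
    have e3 := hB.cov_zero_left hH 1 (B 0 t)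
    rw [covariance_comm] at e3
    linarith
end MfBm

/-! ### Almost sure and mean square limits of Gaussian variables -/

section SquareIntegrable

variable {Ω : Type*} [MeasurableSpace Ω] {P : Measure Ω}

/-- `L²` convergence of both factors implies convergence of the integrals of the products. -/
lemma tendsto_integral_mul {ι : Type*} {l : Filter ι} {X Y : ι → Ω → ℝ} {X' Y' : Ω → ℝ}
    (hX : ∀ n, MemLp (X n) 2 P) (hX' : MemLp X' 2 P) (hY : ∀ n, MemLp (Y n) 2 P)
    (hY' : MemLp Y' 2 P) (h1 : Tendsto (fun n => eLpNorm (X n - X') 2 P) l (𝓝 0))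
    (h2 : Tendsto (fun n => eLpNorm (Y n - Y') 2 P) l (𝓝 0)) :
    Tendsto (fun n => ∫ ω, X n ω * Y n ω ∂P) l (𝓝 (∫ ω, X' ω * Y' ω ∂P)) := by
  have h1' := (Lp.tendsto_Lp_iff_tendsto_eLpNorm'' X hX X' hX').2 h1
  have h2' := (Lp.tendsto_Lp_iff_tendsto_eLpNorm'' Y hY Y' hY').2 h2
  have h := Filter.Tendsto.inner (𝕜 := ℝ) h1' h2'
  have key : ∀ {f g : Ω → ℝ} (hf : MemLp f 2 P) (hg : MemLp g 2 P),
      inner ℝ (hf.toLp f) (hg.toLp g) = ∫ ω, f ω * g ω ∂P := by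
    intro f g hf hg
    rw [L2.inner_def]
    refine integral_congr_ae ?_
    filter_upwards [hf.coeFn_toLp, hg.coeFn_toLp] with ω e1 e2
    rw [e1, e2]
    simp [mul_comm]
  simpa only [key] using h

lemma tendsto_covariance [IsProbabilityMeasure P] {ι : Type*} {l : Filter ι} {X : ι → Ω → ℝ}
    {X' Z : Ω → ℝ} (hX : ∀ n, MemLp (X n) 2 P) (hX' : MemLp X' 2 P) (hZ : MemLp Z 2 P)
    (h : Tendsto (fun n => eLpNorm (X n - X') 2 P) l (𝓝 0)) :
    Tendsto (fun n => cov[X n, Z; P]) l (𝓝 cov[X', Z; P]) := by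
  have h0 : ∀ W : Ω → ℝ, Tendsto (fun _ : ι => eLpNorm (W - W) 2 P) l (𝓝 0) := by
    intro W; simpa using tendsto_const_nhds
  have h1 := tendsto_integral_mul hX hX' (fun _ => hZ) hZ h (h0 Z)
  have h2 := tendsto_integral_mul hX hX' (fun _ => memLp_const (1 : ℝ)) (memLp_const (1 : ℝ)) h
    (h0 fun _ => 1)
  simp only [mul_one] at h2
  simp_rw [fun n => covariance_eq_sub (hX n) hZ, covariance_eq_sub hX' hZ]
  exact h1.sub (h2.mul_const _)

/-- A square integrable random variable whose characteristic function at `1` is that of a centred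
Gaussian variable with the same second moment. -/
structure GaussLike (X : Ω → ℝ) (P : Measure Ω) : Prop where
  memLp : MemLp X 2 P
  charFun_one : ∫ ω, Complex.exp (Complex.I * X ω) ∂P = Real.exp (-(∫ ω, X ω * X ω ∂P) / 2)

lemma tendsto_integral_cexp [IsProbabilityMeasure P] {ι : Type*} {l : Filter ι}
    [l.IsCountablyGenerated] {X : ι → Ω → ℝ} {X' : Ω → ℝ} (hX : ∀ n, MemLp (X n) 2 P)
    (h : ∀ᵐ ω ∂P, Tendsto (fun n => X n ω) l (𝓝 (X' ω))) :
    Tendsto (fun n => ∫ ω, Complex.exp (Complex.I * X n ω) ∂P) l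
      (𝓝 (∫ ω, Complex.exp (Complex.I * X' ω) ∂P)) := by
  refine tendsto_integral_filter_of_dominated_convergence (fun _ => 1)
    (Eventually.of_forall fun n => ?_) (Eventually.of_forall fun n => ?_) (integrable_const _) ?_
  · have := (hX n).aemeasurable
    exact AEMeasurable.aestronglyMeasurable (by fun_prop)
  · refine Eventually.of_forall fun ω => ?_
    rw [mul_comm, Complex.norm_exp_ofReal_mul_I]
  · filter_upwards [h] with ω hω
    have hc : Continuous fun x : ℝ => Complex.exp (Complex.I * x) := by fun_prop
    exact (hc.tendsto _).comp hω

/-- An almost surely convergent sequence with Gaussian differences converges in `L²`: the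
characteristic functions of the differences tend to `1`, so their variances tend to `0`. -/
lemma tendsto_eLpNorm_of_gaussLike [IsProbabilityMeasure P] {X : ℕ → Ω → ℝ} {X' : Ω → ℝ}
    (hX : ∀ n, MemLp (X n) 2 P) (hG : ∀ n m, GaussLike (X n - X m) P)
    (h : ∀ᵐ ω ∂P, Tendsto (fun n => X n ω) atTop (𝓝 (X' ω))) :
    MemLp X' 2 P ∧ Tendsto (fun n => eLpNorm (X n - X') 2 P) atTop (𝓝 0) := by
  have h1 : Tendsto (fun q : ℕ × ℕ => ∫ ω, Complex.exp (Complex.I * (X q.1 - X q.2) ω) ∂P)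
      (atTop ×ˢ atTop) (𝓝 1) := by
    have := tendsto_integral_cexp (P := P) (l := atTop ×ˢ atTop)
      (X := fun q : ℕ × ℕ => X q.1 - X q.2)
      (X' := fun _ => 0) (fun q => (hX q.1).sub (hX q.2)) (by
        filter_upwards [h] with ω hω
        have e1 : Tendsto (fun q : ℕ × ℕ => X q.1 ω) (atTop ×ˢ atTop) (𝓝 (X' ω)) :=
          hω.comp tendsto_fst
        have e2 : Tendsto (fun q : ℕ × ℕ => X q.2 ω) (atTop ×ˢ atTop) (𝓝 (X' ω)) :=
          hω.comp tendsto_snd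
        simpa using e1.sub e2)
    simpa using this
  have h2 : Tendsto (fun q : ℕ × ℕ => ∫ ω, (X q.1 - X q.2) ω * (X q.1 - X q.2) ω ∂P)
      (atTop ×ˢ atTop) (𝓝 0) := by
    have e1 : Tendsto (fun q : ℕ × ℕ =>
        Real.exp (-(∫ ω, (X q.1 - X q.2) ω * (X q.1 - X q.2) ω ∂P) / 2))
        (atTop ×ˢ atTop) (𝓝 1) := by
      have := (Complex.continuous_re.tendsto _).comp h1
      refine this.congr fun q => ?_
      simp only [Function.comp_apply]
      rw [(hG q.1 q.2).charFun_one, Complex.ofReal_re]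
    have e2 := ((Real.continuousAt_log one_ne_zero).tendsto.comp e1).const_mul (-2)
    rw [Real.log_one, mul_zero] at e2
    refine e2.congr fun q => ?_
    simp only [Function.comp_apply, Real.log_exp]
    ring
  have h3 : Tendsto (fun q : ℕ × ℕ => eLpNorm (X q.1 - X q.2) 2 P) (atTop ×ˢ atTop) (𝓝 0) := by
    have e1 := (ENNReal.continuous_ofReal.tendsto _).comp
      (h2.rpow_const (p := 1 / 2) (Or.inr (by norm_num)))
    rw [Real.zero_rpow (by norm_num), ENNReal.ofReal_zero] at e1
    refine e1.congr fun q => ?_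
    simp only [Function.comp_apply]
    rw [((hX q.1).sub (hX q.2)).eLpNorm_eq_integral_rpow_norm (by norm_num) (by norm_num)]
    congr 2
    · congr 1
      funext ω
      simp [pow_two]
    · norm_num
  have h4 : Tendsto (fun n => eLpNorm (X n - X') 2 P) atTop (𝓝 0) := by
    rw [ENNReal.tendsto_atTop_zero]
    intro ε hε
    have := (ENNReal.tendsto_nhds_zero.1 h3) ε hε
    rw [prod_atTop_atTop_eq, eventually_atTop] at this
    obtain ⟨⟨N, M⟩, hNM⟩ := this
    refine ⟨N, fun n hn => ?_⟩
    have hF := Lp.eLpNorm_lim_le_liminf_eLpNorm (p := 2) (μ := P) (f := fun m => X n - X m)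
      (fun m => ((hX n).sub (hX m)).aestronglyMeasurable) (X n - X') (by
        filter_upwards [h] with ω hω
        exact hω.const_sub _)
    refine hF.trans (liminf_le_of_frequently_le' ?_)
    refine Eventually.frequently ?_
    filter_upwards [eventually_ge_atTop M] with m hm
    exact hNM (n, m) ⟨hn, hm⟩
  refine ⟨?_, h4⟩
  have hm : AEStronglyMeasurable X' P :=
    aestronglyMeasurable_of_tendsto_ae atTop (fun n => (hX n).aestronglyMeasurable) h
  obtain ⟨n, hn⟩ := (h4.eventually (gt_mem_nhds (show (0 : ENNReal) < 1 by norm_num))).exists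
  have : MemLp (X n - X') 2 P :=
    ⟨(hX n).aestronglyMeasurable.sub hm, hn.trans (by simp)⟩
  have h5 := (hX n).sub this
  simpa using h5

lemma GaussLike.of_tendsto [IsProbabilityMeasure P] {X : ℕ → Ω → ℝ} {X' : Ω → ℝ}
    (hG : ∀ n, GaussLike (X n) P) (hX' : MemLp X' 2 P)
    (h : ∀ᵐ ω ∂P, Tendsto (fun n => X n ω) atTop (𝓝 (X' ω)))
    (h2 : Tendsto (fun n => eLpNorm (X n - X') 2 P) atTop (𝓝 0)) : GaussLike X' P := by
  refine ⟨hX', tendsto_nhds_unique (tendsto_integral_cexp (fun n => (hG n).memLp) h) ?_⟩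
  simp_rw [fun n => (hG n).charFun_one]
  have := tendsto_integral_mul (fun n => (hG n).memLp) hX' (fun n => (hG n).memLp) hX' h2 h2
  exact (Complex.continuous_ofReal.tendsto _).comp
    ((Real.continuous_exp.tendsto _).comp (this.neg.div_const 2))

/-- Elements of the linear span of a centred Gaussian process. -/
lemma gaussLike_of_mem_span [IsProbabilityMeasure P] {T : Type*} {X : T → Ω → ℝ}
    (hX : IsGaussianProcess X P) (h0 : ∀ t, ∫ ω, X t ω ∂P = 0) {W : Ω → ℝ}
    (hW : W ∈ Submodule.span ℝ (Set.range X)) : GaussLike W P := by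
  obtain ⟨c, rfl⟩ := (Finsupp.mem_span_range_iff_exists_finsupp).1 hW
  have hG : HasGaussianLaw (c.sum fun t a => a • X t) P :=
    (hX.smul fun t => c t).hasGaussianLaw_sum (I := c.support)
  have hmean : ∫ ω, (c.sum fun t a => a • X t) ω ∂P = 0 := by
    simp only [Finsupp.sum, Finset.sum_apply, Pi.smul_apply, smul_eq_mul]
    rw [integral_finsetSum _ fun t _ => ((hX.hasGaussianLaw_eval t).integrable).const_mul _]
    simp [integral_const_mul, h0]
  set W := c.sum fun t a => a • X t
  refine ⟨hG.memLp_two, ?_⟩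
  have h1 := hG.charFun_map_eq 1
  rw [charFun_apply_real, integral_map hG.aemeasurable (by fun_prop)] at h1
  simp only [Complex.ofReal_one, one_mul] at h1
  have h2 : ∀ ω, inner ℝ (1 : ℝ) (W ω) = W ω := fun ω => by simp
  simp_rw [h2] at h1
  rw [hmean, variance_eq_sub hG.memLp_two, hmean] at h1
  simp_rw [mul_comm Complex.I]
  rw [h1]
  push_cast
  congr 1
  simp [pow_two]
  ring

end SquareIntegrable

/-! ### Covariances of pathwise integrals -/

/-- The left Riemann–Stieltjes sum `∑ f (x_k) (g (x_{k+1}) - g (x_k))` over the partition of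
`[a, b]` into `n` intervals of equal length. -/
noncomputable def leftRSSum (f g : ℝ → ℝ) (a b : ℝ) (n : ℕ) : ℝ :=
  ∑ k ∈ Finset.range n, f (a + k * ((b - a) / n)) *
    (g (a + (k + 1 : ℕ) * ((b - a) / n)) - g (a + k * ((b - a) / n)))

lemma HasRSIntegral.tendsto_leftRSSum {f g : ℝ → ℝ} {a b I : ℝ} (hab : a ≤ b)
    (h : HasRSIntegral f g a b I) : Tendsto (leftRSSum f g a b) atTop (𝓝 I) := by
  rw [Metric.tendsto_atTop]
  intro ε hε
  obtain ⟨δ, hδ, hδ'⟩ := h ε hε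
  have h1 : Tendsto (fun n : ℕ => (b - a) / (n : ℝ)) atTop (𝓝 0) :=
    tendsto_const_div_atTop_nhds_zero_nat _
  obtain ⟨N, hN⟩ := eventually_atTop.1 (h1.eventually (gt_mem_nhds hδ))
  refine ⟨max N 1, fun n hn => ?_⟩
  have hn0 : (n : ℝ) ≠ 0 := by
    have : 0 < n := lt_of_lt_of_le one_pos ((le_max_right _ _).trans hn)
    exact_mod_cast this.ne'
  rw [Real.dist_eq]
  refine hδ' n (fun k => a + k * ((b - a) / n)) (fun k => a + k * ((b - a) / n)) (by simp)
    (by field_simp; ring) fun k _ => ⟨le_rfl, ?_, ?_⟩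
  · push_cast
    have : 0 ≤ (b - a) / n := div_nonneg (by linarith) (Nat.cast_nonneg n)
    nlinarith
  · have := hN n ((le_max_left _ _).trans hn)
    push_cast
    linarith

/-- Riemann–Stieltjes sums with a continuously differentiable integrator. -/
lemma tendsto_leftRSSum_of_hasDerivAt {f φ φ' : ℝ → ℝ} {a b L : ℝ} (hab : a ≤ b)
    (hf : ∀ x ∈ Set.Icc a b, ∀ y ∈ Set.Icc a b, |f x - f y| ≤ L * |x - y|) (hfc : Continuous f)
    (hφ : ∀ u, HasDerivAt φ (φ' u) u) (hφ' : Continuous φ') :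
    Tendsto (leftRSSum f φ a b) atTop (𝓝 (∫ u in a..b, f u * φ' u)) := by
  have hbound : ∀ n : ℕ, 0 < n → |leftRSSum f φ a b n - ∫ u in a..b, f u * φ' u| ≤
      L * (b - a) * (∫ u in a..b, |φ' u|) / n := by
    intro n hn
    have hn' : (0 : ℝ) < n := by exact_mod_cast hn
    set d := (b - a) / n with hd
    have hd0 : 0 ≤ d := div_nonneg (by linarith) hn'.le
    have hnd : (n : ℝ) * d = b - a := by rw [hd]; field_simp
    let x : ℕ → ℝ := fun k => a + k * d
    have hx0 : x 0 = a := by simp [x]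
    have hxn : x n = b := by simp only [x]; linarith
    have hxs : ∀ k, x (k + 1) = x k + d := fun k => by simp only [x]; push_cast; ring
    have hxm : ∀ k ≤ n, x k ∈ Set.Icc a b := by
      intro k hk
      have hk' : (k : ℝ) ≤ n := by exact_mod_cast hk
      have : 0 ≤ (k : ℝ) := Nat.cast_nonneg k
      constructor
      · simp only [x]; nlinarith
      · simp only [x]; nlinarith
    have hsplit : ∀ F : ℝ → ℝ, Continuous F →
        ∫ u in a..b, F u = ∑ k ∈ Finset.range n, ∫ u in x k..x (k + 1), F u := by
      intro F hF
      rw [intervalIntegral.sum_integral_adjacent_intervals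
        (fun k _ => hF.intervalIntegrable _ _), hx0, hxn]
    have hsum : leftRSSum f φ a b n =
        ∑ k ∈ Finset.range n, ∫ u in x k..x (k + 1), f (x k) * φ' u := by
      refine Finset.sum_congr rfl fun k _ => ?_
      rw [intervalIntegral.integral_const_mul, intervalIntegral.integral_eq_sub_of_hasDerivAt
        (fun u _ => hφ u) (hφ'.intervalIntegrable _ _)]
    rw [hsum, hsplit (fun u => f u * φ' u) (hfc.mul hφ'), ← Finset.sum_sub_distrib,
      hsplit (fun u => |φ' u|) hφ'.abs, Finset.mul_sum,
      Finset.sum_div]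
    refine (Finset.abs_sum_le_sum_abs _ _).trans (Finset.sum_le_sum fun k hk => ?_)
    have hk := Finset.mem_range.1 hk
    have hle : x k ≤ x (k + 1) := by rw [hxs]; linarith
    rw [← intervalIntegral.integral_sub (f := fun u => f (x k) * φ' u) (g := fun u => f u * φ' u)
      ((continuous_const.mul hφ').intervalIntegrable _ _)
      ((hfc.mul hφ').intervalIntegrable _ _)]
    have e1 : L * (b - a) * (∫ u in x k..x (k + 1), |φ' u|) / n =
        ∫ u in x k..x (k + 1), L * d * |φ' u| := by
      rw [intervalIntegral.integral_const_mul, hd]; ring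
    rw [e1]
    refine (intervalIntegral.abs_integral_le_integral_abs hle).trans ?_
    refine intervalIntegral.integral_mono_on hle
      (Continuous.intervalIntegrable (by fun_prop) _ _)
      (Continuous.intervalIntegrable (by fun_prop) _ _) fun u hu => ?_
    rw [← sub_mul, abs_mul]
    refine mul_le_mul_of_nonneg_right ?_ (abs_nonneg _)
    have hua : u ∈ Set.Icc a b :=
      ⟨(hxm k hk.le).1.trans hu.1, hu.2.trans (hxm (k + 1) hk).2⟩
    refine (hf _ (hxm k hk.le) _ hua).trans ?_
    have hL : 0 ≤ L * |x k - u| := (abs_nonneg _).trans (hf _ (hxm k hk.le) _ hua)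
    rcases eq_or_lt_of_le (abs_nonneg (x k - u)) with h0 | h0
    · rw [← h0, mul_zero]
      have h1 := (abs_nonneg _).trans (hf _ (hxm k hk.le) _ (hxm (k + 1) hk))
      rw [hxs, show x k - (x k + d) = -d by ring, abs_neg, abs_of_nonneg hd0] at h1
      exact h1
    · have hL' : 0 ≤ L := nonneg_of_mul_nonneg_left hL h0
      refine mul_le_mul_of_nonneg_left ?_ hL'
      rw [abs_sub_comm, abs_of_nonneg (by linarith [hu.1])]
      linarith [hu.2, hxs k]
  rw [tendsto_iff_dist_tendsto_zero]
  refine squeeze_zero' (Eventually.of_forall fun n => dist_nonneg) ?_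
    (tendsto_const_div_atTop_nhds_zero_nat (L * (b - a) * (∫ u in a..b, |φ' u|)))
  filter_upwards [eventually_gt_atTop 0] with n hn
  rw [Real.dist_eq]
  exact hbound n hn

section WienerIntegral

variable {Ω : Type*}

lemma leftRSSum_mem_span (X : ℝ → Ω → ℝ) (f : ℝ → ℝ) (a b : ℝ) (n : ℕ) :
    (fun ω => leftRSSum f (fun u => X u ω) a b n) ∈ Submodule.span ℝ (Set.range X) := by
  have : (fun ω => leftRSSum f (fun u => X u ω) a b n) =
      ∑ k ∈ Finset.range n, f (a + k * ((b - a) / n)) •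
        (X (a + (k + 1 : ℕ) * ((b - a) / n)) - X (a + k * ((b - a) / n))) := by
    funext ω
    simp [leftRSSum, Finset.sum_apply]
  rw [this]
  exact Submodule.sum_mem _ fun k _ => Submodule.smul_mem _ _ (Submodule.sub_mem _
    (Submodule.subset_span ⟨_, rfl⟩) (Submodule.subset_span ⟨_, rfl⟩))

variable [MeasurableSpace Ω] {P : Measure Ω} [IsProbabilityMeasure P]

lemma covariance_leftRSSum {X : ℝ → Ω → ℝ} (hX : ∀ t, MemLp (X t) 2 P) {Z : Ω → ℝ}
    (hZ : MemLp Z 2 P) (f : ℝ → ℝ) (a b : ℝ) (n : ℕ) :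
    cov[fun ω => leftRSSum f (fun u => X u ω) a b n, Z; P] =
      leftRSSum f (fun u => cov[X u, Z; P]) a b n := by
  simp only [leftRSSum]
  rw [covariance_fun_sum_left' (X := fun (k : ℕ) ω => f (a + k * ((b - a) / n)) *
    (X (a + (k + 1 : ℕ) * ((b - a) / n)) ω - X (a + k * ((b - a) / n)) ω))
    (fun k _ => ((hX _).sub (hX _)).const_mul _) hZ]
  refine Finset.sum_congr rfl fun k _ => ?_
  rw [covariance_const_mul_left, covariance_fun_sub_left (hX _) (hX _) hZ]

lemma abs_exp_sub_exp_le {α t a : ℝ} (hα : 0 ≤ α) :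
    ∀ x ∈ Set.Icc a t, ∀ y ∈ Set.Icc a t,
      |Real.exp (-α * (t - x)) - Real.exp (-α * (t - y))| ≤ α * |x - y| := by
  have key : ∀ x y, x ≤ y → y ≤ t →
      |Real.exp (-α * (t - x)) - Real.exp (-α * (t - y))| ≤ α * |x - y| := by
    intro x y hxy hy
    have h1 : Real.exp (-α * (t - x)) ≤ Real.exp (-α * (t - y)) :=
      Real.exp_le_exp.2 (by nlinarith)
    have h2 : Real.exp (-α * (t - y)) ≤ 1 := Real.exp_le_one_iff.2 (by nlinarith)
    have h3 : Real.exp (-α * (t - x)) = Real.exp (-α * (t - y)) * Real.exp (-(α * (y - x))) := by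
      rw [← Real.exp_add]; congr 1; ring
    have h4 := Real.one_sub_le_exp_neg (α * (y - x))
    rw [abs_sub_comm, abs_of_nonneg (by linarith), abs_sub_comm, abs_of_nonneg (by linarith), h3]
    have h5 := Real.exp_pos (-α * (t - y))
    have h6 : 0 ≤ α * (y - x) := mul_nonneg hα (by linarith)
    nlinarith
  intro x hx y hy
  rcases le_total x y with h | h
  · exact key x y h hy.2
  · rw [abs_sub_comm, abs_sub_comm x]
    exact key y x h hx.2

/-- The covariance of a pathwise exponentially weighted integral of a Gaussian process `X` with a
square integrable variable `Z`: the integral may be interchanged with the covariance. The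
Riemann–Stieltjes sums converge almost surely and belong to the linear span of `X`, so they
converge in `L²`. -/
theorem covariance_of_hasRSIntegralIic {X : ℝ → Ω → ℝ} (hX : IsGaussianProcess X P)
    (h0 : ∀ t, ∫ ω, X t ω ∂P = 0) {α ν t : ℝ} (hα : 0 ≤ α) (hν : ν ≠ 0) {Y Z : Ω → ℝ}
    (hZ : MemLp Z 2 P)
    (hI : ∀ᵐ ω ∂P, ∃ I : ℝ,
      HasRSIntegralIic (fun u => Real.exp (-α * (t - u))) (fun u => X u ω) t I ∧ Y ω = ν * I)
    {φ' : ℝ → ℝ} (hφ : ∀ u, HasDerivAt (fun u => cov[X u, Z; P]) (φ' u) u) (hφ' : Continuous φ')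
    (hint : IntegrableOn (fun u => Real.exp (-α * (t - u)) * φ' u) (Set.Iic t)) :
    cov[Y, Z; P] = ν * ∫ u in Set.Iic t, Real.exp (-α * (t - u)) * φ' u := by
  set f : ℝ → ℝ := fun u => Real.exp (-α * (t - u)) with hf
  have hfc : Continuous f := by fun_prop
  have hX2 : ∀ u, MemLp (X u) 2 P := fun u => (hX.hasGaussianLaw_eval u).memLp_two
  -- Two limits along sequences: `S N n → J N` over `[a N, t]`, then `J N → Y / ν`.
  let a : ℕ → ℝ := fun N => t - (N + 1 : ℕ)
  have ha : ∀ N, a N < t := fun N => by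
    simp only [a]; push_cast; linarith [Nat.cast_nonneg (α := ℝ) N]
  have hatop : Tendsto a atTop atBot := by
    have h1 : Tendsto (fun N : ℕ => ((N + 1 : ℕ) : ℝ)) atTop atTop :=
      tendsto_natCast_atTop_atTop.comp (tendsto_add_atTop_nat 1)
    exact tendsto_atBot_add_const_left _ t (tendsto_neg_atTop_atBot.comp h1)
  let S : ℕ → ℕ → Ω → ℝ := fun N n ω => leftRSSum f (fun u => X u ω) (a N) t n
  let J : ℕ → Ω → ℝ := fun N ω => limUnder atTop (fun n => S N n ω)
  have hS : ∀ N n, S N n ∈ Submodule.span ℝ (Set.range X) := fun N n =>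
    leftRSSum_mem_span X f (a N) t n
  have hSG : ∀ N n M m, GaussLike (S N n - S M m) P := fun N n M m =>
    gaussLike_of_mem_span hX h0 (Submodule.sub_mem _ (hS N n) (hS M m))
  have hS2 : ∀ N n, MemLp (S N n) 2 P := fun N n => (gaussLike_of_mem_span hX h0 (hS N n)).memLp
  have hlim : ∀ᵐ ω ∂P, (∀ N, Tendsto (fun n => S N n ω) atTop (𝓝 (J N ω))) ∧
      Tendsto (fun N => J N ω) atTop (𝓝 (Y ω / ν)) := by
    filter_upwards [hI] with ω hω
    obtain ⟨I, ⟨j, hj, hjI⟩, hYI⟩ := hω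
    have h1 : ∀ N, Tendsto (fun n => S N n ω) atTop (𝓝 (j (a N))) := fun N =>
      (hj (a N) (ha N)).tendsto_leftRSSum (ha N).le
    have h2 : ∀ N, J N ω = j (a N) := fun N => (h1 N).limUnder_eq
    refine ⟨fun N => by rw [h2]; exact h1 N, ?_⟩
    rw [hYI, mul_div_cancel_left₀ _ hν]
    simp_rw [h2]
    exact hjI.comp hatop
  have hJ : ∀ N, MemLp (J N) 2 P ∧ Tendsto (fun n => eLpNorm (S N n - J N) 2 P) atTop (𝓝 0) :=
    fun N => tendsto_eLpNorm_of_gaussLike (hS2 N) (fun n m => hSG N n N m)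
      (hlim.mono fun ω hω => hω.1 N)
  have hJG : ∀ N M, GaussLike (J N - J M) P := by
    intro N M
    refine GaussLike.of_tendsto (fun n => hSG N n M n) ((hJ N).1.sub (hJ M).1)
      (hlim.mono fun ω hω => (hω.1 N).sub (hω.1 M)) ?_
    have hsum := (hJ N).2.add (hJ M).2
    rw [add_zero] at hsum
    refine tendsto_of_tendsto_of_tendsto_of_le_of_le tendsto_const_nhds hsum
      (fun n => zero_le) fun n => ?_
    rw [show S N n - S M n - (J N - J M) = (S N n - J N) - (S M n - J M) by abel]
    exact eLpNorm_sub_le ((hS2 N n).sub (hJ N).1).aestronglyMeasurable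
      ((hS2 M n).sub (hJ M).1).aestronglyMeasurable (by norm_num)
  have hYν := tendsto_eLpNorm_of_gaussLike (fun N => (hJ N).1) hJG (hlim.mono fun ω hω => hω.2)
  have hcovJ : ∀ N, cov[J N, Z; P] = ∫ u in a N..t, f u * φ' u := by
    intro N
    refine tendsto_nhds_unique (tendsto_covariance (hS2 N) (hJ N).1 hZ (hJ N).2) ?_
    refine (tendsto_leftRSSum_of_hasDerivAt (ha N).le (abs_exp_sub_exp_le hα) hfc hφ hφ').congr
      fun n => ?_
    exact (covariance_leftRSSum hX2 hZ f (a N) t n).symm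
  have hfin : cov[fun ω => Y ω / ν, Z; P] = ∫ u in Set.Iic t, f u * φ' u := by
    refine tendsto_nhds_unique (tendsto_covariance (fun N => (hJ N).1) hYν.1 hZ hYν.2) ?_
    simp_rw [hcovJ]
    exact intervalIntegral_tendsto_integral_Iic t hint hatop
  rw [covariance_fun_div_left, div_eq_iff hν] at hfin
  rw [hfin, mul_comm]

end WienerIntegral

/-! ### Increments of homogeneous functions -/

lemma powKernel_eq_max {a : ℝ} (ha : 0 < a) (cp cm x : ℝ) :
    powKernel a cp cm x = cp * (max x 0) ^ a + cm * (max (-x) 0) ^ a := by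
  unfold powKernel
  split_ifs with h
  · rw [max_eq_left h.le, max_eq_right (by linarith), Real.zero_rpow ha.ne']; ring
  · rw [max_eq_right (by linarith), max_eq_left (by linarith), Real.zero_rpow ha.ne']; ring

lemma continuous_powKernel {a : ℝ} (ha : 0 < a) (cp cm : ℝ) : Continuous (powKernel a cp cm) := by
  have : powKernel a cp cm = fun x => cp * (max x 0) ^ a + cm * (max (-x) 0) ^ a :=
    funext fun x => powKernel_eq_max ha cp cm x
  rw [this]
  exact (continuous_const.mul ((Real.continuous_rpow_const ha.le).comp (by fun_prop))).add
    (continuous_const.mul ((Real.continuous_rpow_const ha.le).comp (by fun_prop)))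

lemma hasDerivAt_powKernel {h : ℝ} (hh : 1 < h) (kp km x : ℝ) :
    HasDerivAt (powKernel h kp km) (powKernel (h - 1) (h * kp) (-(h * km)) x) x := by
  rcases lt_trichotomy x 0 with hx | rfl | hx
  · have h1 : HasDerivAt (fun y : ℝ => km * (-y) ^ h) (km * (-1 * h * (-x) ^ (h - 1))) x :=
      ((hasDerivAt_neg x).rpow_const (Or.inl (by linarith))).const_mul km
    have h2 : powKernel (h - 1) (h * kp) (-(h * km)) x = km * (-1 * h * (-x) ^ (h - 1)) := by
      rw [powKernel, if_neg (by linarith)]; ring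
    rw [h2]
    refine h1.congr_of_eventuallyEq ?_
    filter_upwards [gt_mem_nhds hx] with y hy
    rw [powKernel, if_neg (by linarith)]
  · have h2 : powKernel (h - 1) (h * kp) (-(h * km)) 0 = 0 := by
      simp [powKernel, Real.zero_rpow (by linarith : h - 1 ≠ 0)]
    have h3 : powKernel h kp km 0 = 0 := by
      simp [powKernel, Real.zero_rpow (by linarith : h ≠ 0)]
    rw [h2, hasDerivAt_iff_tendsto_slope, tendsto_zero_iff_abs_tendsto_zero]
    have h4 : Tendsto (fun y : ℝ => (|kp| + |km|) * |y| ^ (h - 1)) (𝓝[≠] 0) (𝓝 0) := by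
      have hc : Continuous fun y : ℝ => (|kp| + |km|) * |y| ^ (h - 1) :=
        continuous_const.mul ((Real.continuous_rpow_const (by linarith)).comp continuous_abs)
      have := hc.tendsto 0
      rw [abs_zero, Real.zero_rpow (by linarith), mul_zero] at this
      exact this.mono_left nhdsWithin_le_nhds
    refine squeeze_zero' (Eventually.of_forall fun y => abs_nonneg _) ?_ h4
    filter_upwards [self_mem_nhdsWithin] with y hy
    have hy' : 0 < |y| := abs_pos.2 hy
    simp only [Function.comp_apply, slope_def_field, h3, sub_zero]
    rw [abs_div, div_le_iff₀ hy', mul_assoc, ← Real.rpow_add_one hy'.ne', sub_add_cancel]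
    exact abs_powKernel_le _ _ _ _
  · have h1 : HasDerivAt (fun y : ℝ => kp * y ^ h) (kp * (1 * h * x ^ (h - 1))) x :=
      ((hasDerivAt_id x).rpow_const (Or.inl (by simpa using hx.ne'))).const_mul kp
    have h2 : powKernel (h - 1) (h * kp) (-(h * km)) x = kp * (1 * h * x ^ (h - 1)) := by
      rw [powKernel, if_pos hx]; ring
    rw [h2]
    refine h1.congr_of_eventuallyEq ?_
    filter_upwards [lt_mem_nhds hx] with y hy
    rw [powKernel, if_pos hy]

lemma abs_powKernel_le_linear {a : ℝ} (ha0 : 0 ≤ a) (ha1 : a ≤ 1) (cp cm x : ℝ) :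
    |powKernel a cp cm x| ≤ (|cp| + |cm|) * (1 + |x|) := by
  refine (abs_powKernel_le _ _ _ _).trans (mul_le_mul_of_nonneg_left ?_ (by positivity))
  calc |x| ^ a ≤ (1 + |x|) ^ a := Real.rpow_le_rpow (abs_nonneg _) (by linarith) ha0
    _ ≤ (1 + |x|) ^ (1 : ℝ) := Real.rpow_le_rpow_of_exponent_le (by linarith [abs_nonneg x]) ha1
    _ = 1 + |x| := Real.rpow_one _

lemma rpow_sub_rpow_sub_le {a y p : ℝ} (ha0 : 0 ≤ a) (ha1 : a ≤ 1) (hy : 0 < y) (hp : 0 ≤ p)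
    (hpy : p ≤ y) : |y ^ a - (y - p) ^ a| ≤ p * y ^ (a - 1) := by
  have h1 : (y - p) ^ a ≤ y ^ a := Real.rpow_le_rpow (by linarith) (by linarith) ha0
  rw [abs_of_nonneg (by linarith)]
  have hr0 : 0 ≤ (y - p) / y := div_nonneg (by linarith) hy.le
  have hr1 : (y - p) / y ≤ 1 := (div_le_one hy).2 (by linarith)
  have h2 : (y - p) ^ a = y ^ a * ((y - p) / y) ^ a := by
    rw [← Real.mul_rpow hy.le hr0]; congr 1; field_simp
  have h3 : (y - p) / y ≤ ((y - p) / y) ^ a := Real.self_le_rpow_of_le_one hr0 hr1 ha1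
  rw [h2, Real.rpow_sub_one hy.ne']
  have h4 : y ^ a * ((y - p) / y) ≤ y ^ a * ((y - p) / y) ^ a :=
    mul_le_mul_of_nonneg_left h3 (by positivity)
  have h5 : y ^ a * ((y - p) / y) = y ^ a - p * (y ^ a / y) := by field_simp
  linarith

/-- Increments of a homogeneous function of degree `a ∈ (0, 1)` decay like its derivative. -/
lemma abs_powKernel_sub_le {a : ℝ} (ha0 : 0 < a) (ha1 : a ≤ 1) (cp cm : ℝ) {x p : ℝ} (hx : x ≠ 0)
    (hp : 0 ≤ p) : |powKernel a cp cm x - powKernel a cp cm (x - p)| ≤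
      2 * (|cp| + |cm|) * p * |x| ^ (a - 1) := by
  have hcp := abs_nonneg cp
  have hcm := abs_nonneg cm
  have hX := Real.rpow_nonneg (abs_nonneg x) (a - 1)
  rcases lt_or_gt_of_ne hx with h | h
  · have e1 : powKernel a cp cm x - powKernel a cp cm (x - p) =
        -(cm * ((p - x) ^ a - ((p - x) - p) ^ a)) := by
      rw [powKernel, powKernel, if_neg (by linarith), if_neg (by linarith)]
      ring_nf
    rw [e1, abs_neg, abs_mul]
    have h1 := rpow_sub_rpow_sub_le ha0.le ha1 (y := p - x) (by linarith) hp (by linarith)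
    have h2 : (p - x) ^ (a - 1) ≤ |x| ^ (a - 1) := by
      rw [abs_of_neg h]
      exact Real.rpow_le_rpow_of_nonpos (by linarith) (by linarith) (by linarith)
    calc |cm| * |(p - x) ^ a - ((p - x) - p) ^ a| ≤ |cm| * (p * |x| ^ (a - 1)) :=
          mul_le_mul_of_nonneg_left (h1.trans (mul_le_mul_of_nonneg_left h2 hp)) hcm
      _ ≤ 2 * (|cp| + |cm|) * p * |x| ^ (a - 1) := by
          have : 0 ≤ p * |x| ^ (a - 1) := mul_nonneg hp hX
          nlinarith
  rcases lt_or_ge x p with h' | h'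
  · refine (abs_sub _ _).trans ?_
    have h1 := abs_powKernel_le a cp cm x
    have h2 := abs_powKernel_le a cp cm (x - p)
    have h3 : |x| ^ a ≤ p * |x| ^ (a - 1) := by
      rw [abs_of_pos h, Real.rpow_sub_one h.ne', ← mul_div_assoc, le_div_iff₀ h, mul_comm]
      exact mul_le_mul_of_nonneg_right h'.le (by positivity)
    have h4 : |x - p| ^ a ≤ p * |x| ^ (a - 1) := by
      have hp0 : 0 < p := h.trans h'
      have : p ^ a = p * p ^ (a - 1) := by
        rw [Real.rpow_sub_one hp0.ne']; field_simp
      calc |x - p| ^ a ≤ p ^ a :=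
            Real.rpow_le_rpow (abs_nonneg _) (by rw [abs_le]; constructor <;> linarith) ha0.le
        _ = p * p ^ (a - 1) := this
        _ ≤ p * |x| ^ (a - 1) := by
            rw [abs_of_pos h]
            exact mul_le_mul_of_nonneg_left
              (Real.rpow_le_rpow_of_nonpos h h'.le (by linarith)) hp
    nlinarith
  · have e1 : powKernel a cp cm x - powKernel a cp cm (x - p) = cp * (x ^ a - (x - p) ^ a) := by
      rcases eq_or_lt_of_le h' with rfl | h''
      · simp [powKernel, h, Real.zero_rpow ha0.ne']
      · rw [powKernel, powKernel, if_pos h, if_pos (by linarith)]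
        ring
    rw [e1, abs_mul]
    have h1 := rpow_sub_rpow_sub_le ha0.le ha1 h hp h'
    rw [abs_of_pos h] at hX ⊢
    calc |cp| * |x ^ a - (x - p) ^ a| ≤ |cp| * (p * x ^ (a - 1)) :=
          mul_le_mul_of_nonneg_left h1 hcp
      _ ≤ 2 * (|cp| + |cm|) * p * x ^ (a - 1) := by
          have : 0 ≤ p * x ^ (a - 1) := mul_nonneg hp hX
          nlinarith

lemma tendsto_mul_one_sub_rpow (a p : ℝ) {l : Filter ℝ} (hl : Tendsto (fun x : ℝ => |x|) l atTop) :
    Tendsto (fun x : ℝ => x * (1 - (1 - p / x) ^ a)) l (𝓝 (a * p)) := by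
  have hd : HasDerivAt (fun u : ℝ => (1 - p * u) ^ a) (-(a * p)) 0 := by
    have := (((hasDerivAt_id (0 : ℝ)).const_mul p).const_sub 1).rpow_const (p := a)
      (Or.inl (by simp))
    simpa [mul_comm] using this
  have hinv : Tendsto (fun x : ℝ => x⁻¹) l (𝓝[≠] 0) := by
    refine tendsto_nhdsWithin_iff.2 ⟨?_, ?_⟩
    · rw [tendsto_zero_iff_abs_tendsto_zero]
      refine (tendsto_inv_atTop_zero.comp hl).congr fun x => ?_
      simp [abs_inv]
    · filter_upwards [hl.eventually_gt_atTop 0] with x hx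
      exact inv_ne_zero (abs_pos.1 hx)
  have h1 := ((hasDerivAt_iff_tendsto_slope.1 hd).comp hinv).neg
  rw [neg_neg] at h1
  refine h1.congr' ?_
  filter_upwards [hl.eventually_gt_atTop 0] with x hx
  have hx0 : x ≠ 0 := abs_pos.1 hx
  simp only [Function.comp_apply, slope_def_field, mul_zero, sub_zero, Real.one_rpow]
  rw [div_inv_eq_mul, ← div_eq_mul_inv]
  ring

lemma tendsto_powKernel_sub_atTop {a : ℝ} (cp cm p : ℝ) :
    Tendsto (fun x : ℝ => (powKernel a cp cm x - powKernel a cp cm (x - p)) * |x| ^ (-(a - 1)))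
      atTop (𝓝 (cp * (a * p))) := by
  refine ((tendsto_mul_one_sub_rpow a p tendsto_abs_atTop_atTop).const_mul cp).congr' ?_
  filter_upwards [eventually_gt_atTop 0, eventually_gt_atTop p] with x hx hxp
  have hr : 0 ≤ 1 - p / x := by
    rw [sub_nonneg, div_le_one hx]; exact hxp.le
  have h2 : (x - p) ^ a = x ^ a * (1 - p / x) ^ a := by
    rw [← Real.mul_rpow hx.le hr]; congr 1; field_simp
  rw [powKernel, powKernel, if_pos hx, if_pos (by linarith), h2, abs_of_pos hx, Real.rpow_neg hx.le,
    Real.rpow_sub_one hx.ne']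
  have := (Real.rpow_pos_of_pos hx a).ne'
  field_simp

lemma tendsto_powKernel_sub_atBot {a : ℝ} (cp cm p : ℝ) :
    Tendsto (fun x : ℝ => (powKernel a cp cm x - powKernel a cp cm (x - p)) * |x| ^ (-(a - 1)))
      atBot (𝓝 (-cm * (a * p))) := by
  refine ((tendsto_mul_one_sub_rpow a p tendsto_abs_atBot_atTop).const_mul (-cm)).congr' ?_
  filter_upwards [eventually_lt_atBot 0, eventually_lt_atBot p] with x hx hxp
  have hx' : 0 < -x := by linarith
  have hr : 0 ≤ 1 - p / x := by
    rw [sub_nonneg, div_le_one_of_neg hx]; exact hxp.le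
  have h2 : (-(x - p)) ^ a = (-x) ^ a * (1 - p / x) ^ a := by
    rw [← Real.mul_rpow hx'.le hr]; congr 1; linear_combination -(mul_div_cancel₀ p hx.ne)
  rw [powKernel, powKernel, if_neg (by linarith), if_neg (by linarith), h2, abs_of_neg hx,
    Real.rpow_neg hx'.le, Real.rpow_sub_one hx'.ne']
  have := (Real.rpow_pos_of_pos hx' a).ne'
  field_simp

/-- A continuous function that is bounded by a multiple of `(1 + |x|) ^ e` and asymptotic to
`dp x ^ e` at `∞` and to `dm |x| ^ e` at `-∞`. -/
structure PowDecay (D : ℝ → ℝ) (e dp dm : ℝ) : Prop where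
  continuous : Continuous D
  bound : ∃ C, ∀ x, |D x| ≤ C * (1 + |x|) ^ e
  tendsto_atTop : Tendsto (fun x => D x * |x| ^ (-e)) atTop (𝓝 dp)
  tendsto_atBot : Tendsto (fun x => D x * |x| ^ (-e)) atBot (𝓝 dm)

/-- Averages of the increments of a homogeneous function of degree `a ∈ (0, 1)`. -/
lemma powDecay_of_integral_sub {a : ℝ} (ha0 : 0 < a) (ha1 : a ≤ 1) (cp cm : ℝ) {μ : Measure ℝ}
    (hμ : ∀ᵐ p ∂μ, 0 ≤ p) {k : ℝ → ℝ} (hkm : AEStronglyMeasurable k μ)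
    (hk : Integrable (fun p => k p * p) μ) {D : ℝ → ℝ} (hD : Continuous D)
    (hDk : ∀ x, D x = ∫ p, k p * (powKernel a cp cm x - powKernel a cp cm (x - p)) ∂μ) :
    PowDecay D (a - 1) (cp * a * ∫ p, k p * p ∂μ) (-cm * a * ∫ p, k p * p ∂μ) := by
  have hbd : ∀ x ≠ 0, ∀ᵐ p ∂μ, ‖k p * (powKernel a cp cm x - powKernel a cp cm (x - p))‖ ≤
      2 * (|cp| + |cm|) * |x| ^ (a - 1) * ‖k p * p‖ := by
    intro x hx
    filter_upwards [hμ] with p hp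
    rw [norm_mul, norm_mul, Real.norm_eq_abs, Real.norm_eq_abs p, abs_of_nonneg hp,
      Real.norm_eq_abs]
    calc |k p| * |powKernel a cp cm x - powKernel a cp cm (x - p)|
        ≤ |k p| * (2 * (|cp| + |cm|) * p * |x| ^ (a - 1)) :=
          mul_le_mul_of_nonneg_left (abs_powKernel_sub_le ha0 ha1 cp cm hx hp) (abs_nonneg _)
      _ = _ := by ring
  have hlim : ∀ (l : Filter ℝ) [l.IsCountablyGenerated] (c : ℝ),
      Tendsto (fun x : ℝ => |x|) l atTop →
      (∀ p, Tendsto (fun x : ℝ => (powKernel a cp cm x - powKernel a cp cm (x - p)) *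
        |x| ^ (-(a - 1))) l (𝓝 (c * (a * p)))) →
      Tendsto (fun x => D x * |x| ^ (-(a - 1))) l (𝓝 (c * a * ∫ p, k p * p ∂μ)) := by
    intro l _ c hl hc
    rw [← integral_const_mul]
    simp_rw [hDk, ← integral_mul_const]
    refine tendsto_integral_filter_of_dominated_convergence
      (fun p => 2 * (|cp| + |cm|) * ‖k p * p‖) ?_ ?_ (hk.norm.const_mul _) ?_
    · refine Eventually.of_forall fun x => ((hkm.mul ?_).mul_const _)
      exact (Measurable.aestronglyMeasurable (by fun_prop))
    · filter_upwards [hl.eventually_gt_atTop 0] with x hx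
      filter_upwards [hbd x (abs_pos.1 hx)] with p hp
      rw [norm_mul, Real.norm_eq_abs (|x| ^ _), abs_of_nonneg (Real.rpow_nonneg (abs_nonneg _) _)]
      refine (mul_le_mul_of_nonneg_right hp (Real.rpow_nonneg (abs_nonneg _) _)).trans_eq ?_
      rw [Real.rpow_neg hx.le]
      have := (Real.rpow_pos_of_pos hx (a - 1)).ne'
      field_simp
    · refine Eventually.of_forall fun p => ?_
      have := (hc p).const_mul (k p)
      rw [show k p * (c * (a * p)) = c * a * (k p * p) by ring] at this
      simpa only [mul_assoc] using this
  refine ⟨hD, ?_, ?_, ?_⟩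
  · have h1 : ∀ x ≠ 0, |D x| ≤ 2 * (|cp| + |cm|) * (∫ p, ‖k p * p‖ ∂μ) * |x| ^ (a - 1) := by
      intro x hx
      rw [hDk, ← Real.norm_eq_abs]
      refine (norm_integral_le_of_norm_le (hk.norm.const_mul _) (hbd x hx)).trans_eq ?_
      rw [integral_const_mul]; ring
    obtain ⟨C, hC⟩ := (isCompact_Icc (a := (-1 : ℝ)) (b := 1)).exists_bound_of_continuousOn
      hD.continuousOn
    set M := 2 * (|cp| + |cm|) * (∫ p, ‖k p * p‖ ∂μ) with hM
    have hM0 : 0 ≤ M := mul_nonneg (by positivity) (integral_nonneg fun _ => norm_nonneg _)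
    have hC0 : 0 ≤ C := (norm_nonneg _).trans (hC 0 (by norm_num))
    refine ⟨(M + C) * 2 ^ (-(a - 1)), fun x => ?_⟩
    have hpos : 0 < 1 + |x| := by positivity
    have h2 : (2 : ℝ) ^ (-(a - 1)) * (1 + |x|) ^ (a - 1) = ((1 + |x|) / 2) ^ (a - 1) := by
      rw [Real.div_rpow hpos.le (by norm_num), Real.rpow_neg (by norm_num)]
      field_simp
    rw [mul_assoc, h2]
    have h3 : 0 ≤ ((1 + |x|) / 2) ^ (a - 1) := by positivity
    rcases le_or_gt |x| 1 with hx | hx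
    · have h4 : 1 ≤ ((1 + |x|) / 2) ^ (a - 1) :=
        Real.one_le_rpow_of_pos_of_le_one_of_nonpos (by positivity) (by linarith) (by linarith)
      have h5 := hC x (abs_le.1 hx)
      rw [Real.norm_eq_abs] at h5
      nlinarith
    · have h4 : |x| ^ (a - 1) ≤ ((1 + |x|) / 2) ^ (a - 1) :=
        Real.rpow_le_rpow_of_nonpos (by positivity) (by linarith) (by linarith)
      have h5 := h1 x (by rintro rfl; simp at hx; linarith)
      nlinarith
  · exact hlim atTop cp tendsto_abs_atTop_atTop fun p => tendsto_powKernel_sub_atTop cp cm p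
  · exact hlim atBot (-cm) tendsto_abs_atBot_atTop fun p => tendsto_powKernel_sub_atBot cp cm p

/-- Weighted averages over shifts of the argument keep power asymptotics. Since
`|x| ≤ (1 + |x + p|) (1 + |p|)`, the rescaled integrand is dominated by a multiple of
`|k p| (1 + |p|)`. -/
lemma PowDecay.tendsto_integral_shift {D : ℝ → ℝ} {e dp dm : ℝ} (hD : PowDecay D e dp dm)
    (he0 : e ≤ 0) (he1 : -1 ≤ e) {μ : Measure ℝ} {k : ℝ → ℝ} (hkm : AEStronglyMeasurable k μ)
    (hk : Integrable (fun p => k p * (1 + |p|)) μ) {l : Filter ℝ} [l.IsCountablyGenerated] {d : ℝ}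
    (hl : Tendsto (fun x : ℝ => |x|) l atTop) (hlc : ∀ c, Tendsto (fun x : ℝ => x + c) l l)
    (hd : Tendsto (fun x => D x * |x| ^ (-e)) l (𝓝 d)) :
    Tendsto (fun x => (∫ p, k p * D (x + p) ∂μ) * |x| ^ (-e)) l (𝓝 (d * ∫ p, k p ∂μ)) := by
  obtain ⟨C, hC⟩ := hD.bound
  have hC0 : 0 ≤ C := by simpa using (abs_nonneg _).trans (hC 0)
  rw [mul_comm d, ← integral_mul_const]
  simp_rw [← integral_mul_const]
  refine tendsto_integral_filter_of_dominated_convergence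
    (fun p => C * ‖k p * (1 + |p|)‖) ?_ ?_ (hk.norm.const_mul _) ?_
  · refine Eventually.of_forall fun x => ((hkm.mul ?_).mul_const _)
    exact (hD.continuous.comp (by fun_prop)).aestronglyMeasurable
  · refine Eventually.of_forall fun x => Eventually.of_forall fun p => ?_
    have hp : 0 < 1 + |p| := by positivity
    have hxp : 0 < 1 + |x + p| := by positivity
    have h1 : |x| ≤ (1 + |x + p|) * (1 + |p|) := by
      have h2 : |x| ≤ |x + p| + |p| := by
        have := abs_sub (x + p) p
        rwa [add_sub_cancel_right] at this
      nlinarith [mul_nonneg (abs_nonneg (x + p)) (abs_nonneg p)]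
    rw [norm_mul, norm_mul, norm_mul, Real.norm_eq_abs, Real.norm_eq_abs, Real.norm_eq_abs,
      Real.norm_eq_abs, abs_of_pos hp, abs_of_nonneg (Real.rpow_nonneg (abs_nonneg x) _)]
    calc |k p| * |D (x + p)| * |x| ^ (-e)
        ≤ |k p| * (C * (1 + |x + p|) ^ e) * ((1 + |x + p|) * (1 + |p|)) ^ (-e) := by
          refine mul_le_mul (mul_le_mul_of_nonneg_left (hC _) (abs_nonneg _))
            (Real.rpow_le_rpow (abs_nonneg _) h1 (by linarith)) (by positivity) (by positivity)
      _ = |k p| * C * (1 + |p|) ^ (-e) := by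
          rw [Real.mul_rpow hxp.le hp.le, Real.rpow_neg hxp.le]
          have := (Real.rpow_pos_of_pos hxp e).ne'
          field_simp
      _ ≤ |k p| * C * (1 + |p|) ^ (1 : ℝ) := by
          refine mul_le_mul_of_nonneg_left (Real.rpow_le_rpow_of_exponent_le
            (by linarith [abs_nonneg p]) (by linarith)) (by positivity)
      _ = C * (|k p| * (1 + |p|)) := by rw [Real.rpow_one]; ring
  · refine Eventually.of_forall fun p => ?_
    have := (tendsto_shift_mul_abs_rpow p hl (hlc p) hd).const_mul (k p)
    simpa only [mul_assoc] using this

lemma PowDecay.hasPowTails_integral {D : ℝ → ℝ} {e dp dm : ℝ} (hD : PowDecay D e dp dm)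
    (he0 : e ≤ 0) (he1 : -1 ≤ e) {μ : Measure ℝ} {k : ℝ → ℝ} (hkm : AEStronglyMeasurable k μ)
    (hk : Integrable (fun p => k p * (1 + |p|)) μ) :
    HasPowTails (fun m => ∫ p, k p * D (m + p) ∂μ) e (dp * ∫ p, k p ∂μ) (dm * ∫ p, k p ∂μ) :=
  ⟨(hD.tendsto_integral_shift he0 he1 hkm hk tendsto_abs_atTop_atTop
      (fun c => tendsto_atTop_add_const_right _ c tendsto_id) hD.tendsto_atTop).comp
      tendsto_intCast_atTop_atTop,
    (hD.tendsto_integral_shift he0 he1 hkm hk tendsto_abs_atBot_atTop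
      (fun c => tendsto_atBot_add_const_right _ c tendsto_id) hD.tendsto_atBot).comp
      (tendsto_intCast_atBot_iff.2 tendsto_id)⟩

/-! ### Exponential averages and covariances of the Ornstein–Uhlenbeck process -/

section ExpSmooth

/-- The exponential moving average `x ↦ ∫_0^∞ e^{-α p} F (x - p) dp`. -/
noncomputable def expSmooth (α : ℝ) (F : ℝ → ℝ) (x : ℝ) : ℝ :=
  ∫ p in Set.Ioi 0, Real.exp (-α * p) * F (x - p)

variable {α : ℝ} {F : ℝ → ℝ}

lemma integrableOn_exp_neg_mul (hα : 0 < α) :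
    IntegrableOn (fun p => Real.exp (-α * p)) (Set.Ioi 0) :=
  integrableOn_exp_mul_Ioi (by linarith) 0

lemma integrableOn_exp_neg_mul_mul_id (hα : 0 < α) :
    IntegrableOn (fun p => Real.exp (-α * p) * p) (Set.Ioi 0) := by
  have := integrableOn_rpow_mul_exp_neg_mul_rpow (p := 1) (s := 1) (b := α) (by norm_num)
    (by norm_num) hα
  simp only [Real.rpow_one] at this
  exact this.congr (Eventually.of_forall fun p => mul_comm _ _)

lemma integrableOn_exp_neg_mul_one_add_abs (hα : 0 < α) :
    IntegrableOn (fun p => Real.exp (-α * p) * (1 + |p|)) (Set.Ioi 0) := by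
  refine ((integrableOn_exp_neg_mul hα).add (integrableOn_exp_neg_mul_mul_id hα)).congr_fun_ae ?_
  filter_upwards [ae_restrict_mem measurableSet_Ioi] with p hp
  rw [abs_of_pos hp, Pi.add_apply]
  ring

lemma integral_exp_neg_mul (hα : 0 < α) : ∫ p in Set.Ioi 0, Real.exp (-α * p) = 1 / α := by
  rw [integral_exp_mul_Ioi (by linarith)]
  simp

lemma integral_exp_neg_mul_mul_id (hα : 0 < α) :
    ∫ p in Set.Ioi 0, Real.exp (-α * p) * p = 1 / α ^ 2 := by
  have := Real.integral_rpow_mul_exp_neg_mul_Ioi (a := 2) (r := α) (by norm_num) hα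
  norm_num at this
  rw [one_div, ← this]
  refine integral_congr_ae (Eventually.of_forall fun p => ?_)
  simp only
  rw [neg_mul, mul_comm]

lemma integrableOn_exp_neg_mul_of_linear (hα : 0 < α) (hF : Continuous F) {C : ℝ}
    (hC : ∀ x, |F x| ≤ C * (1 + |x|)) :
    IntegrableOn (fun p => Real.exp (-α * p) * F p) (Set.Ioi 0) := by
  refine ((integrableOn_exp_neg_mul_one_add_abs hα).const_mul C).mono'
    (Continuous.aestronglyMeasurable (by fun_prop)) (Eventually.of_forall fun p => ?_)
  rw [norm_mul, Real.norm_eq_abs, Real.norm_eq_abs, Real.abs_exp]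
  calc Real.exp (-α * p) * |F p| ≤ Real.exp (-α * p) * (C * (1 + |p|)) :=
        mul_le_mul_of_nonneg_left (hC p) (Real.exp_pos _).le
    _ = _ := by ring

lemma abs_comp_sub_le {C : ℝ} (hC : ∀ x, |F x| ≤ C * (1 + |x|)) (x p : ℝ) :
    |F (x - p)| ≤ C * (1 + |x|) * (1 + |p|) := by
  have hC0 : 0 ≤ C := by simpa using (abs_nonneg _).trans (hC 0)
  refine (hC _).trans ?_
  rw [mul_assoc]
  refine mul_le_mul_of_nonneg_left ?_ hC0
  nlinarith [abs_sub x p, mul_nonneg (abs_nonneg x) (abs_nonneg p)]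

lemma integrableOn_exp_neg_mul_comp_sub (hα : 0 < α) (hF : Continuous F) {C : ℝ}
    (hC : ∀ x, |F x| ≤ C * (1 + |x|)) (x : ℝ) :
    IntegrableOn (fun p => Real.exp (-α * p) * F (x - p)) (Set.Ioi 0) :=
  integrableOn_exp_neg_mul_of_linear hα (by fun_prop) (abs_comp_sub_le hC x)

lemma abs_expSmooth_le (hα : 0 < α) {C : ℝ} (hC : ∀ x, |F x| ≤ C * (1 + |x|)) (x : ℝ) :
    |expSmooth α F x| ≤
      (C * ∫ p in Set.Ioi 0, Real.exp (-α * p) * (1 + |p|)) * (1 + |x|) := by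
  rw [← Real.norm_eq_abs, expSmooth]
  refine (norm_integral_le_of_norm_le
    ((integrableOn_exp_neg_mul_one_add_abs hα).const_mul (C * (1 + |x|)))
    (Eventually.of_forall fun p => ?_)).trans_eq ?_
  · rw [norm_mul, Real.norm_eq_abs, Real.norm_eq_abs, Real.abs_exp]
    calc Real.exp (-α * p) * |F (x - p)| ≤ Real.exp (-α * p) * (C * (1 + |x|) * (1 + |p|)) :=
          mul_le_mul_of_nonneg_left (abs_comp_sub_le hC x p) (Real.exp_pos _).le
      _ = _ := by ring
  · rw [integral_const_mul]; ring

lemma preimage_sub_left_Iic (t : ℝ) : (fun p => t - p) ⁻¹' Set.Iic t = Set.Ici 0 := by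
  ext p; simp

lemma integral_Iic_exp_neg_mul (t : ℝ) :
    ∫ u in Set.Iic t, Real.exp (-α * (t - u)) * F u = expSmooth α F t := by
  have h := (Measure.measurePreserving_sub_left volume t).setIntegral_preimage_emb
    (MeasurableEquiv.subLeft t).measurableEmbedding
    (fun u => Real.exp (-α * (t - u)) * F u) (Set.Iic t)
  rw [← h, preimage_sub_left_Iic, integral_Ici_eq_integral_Ioi, expSmooth]
  simp

lemma integrableOn_Iic_exp_neg_mul (hα : 0 < α) (hF : Continuous F) {C : ℝ}
    (hC : ∀ x, |F x| ≤ C * (1 + |x|)) (t : ℝ) :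
    IntegrableOn (fun u => Real.exp (-α * (t - u)) * F u) (Set.Iic t) := by
  have h := (Measure.measurePreserving_sub_left volume t).integrableOn_comp_preimage
    (MeasurableEquiv.subLeft t).measurableEmbedding
    (f := fun u => Real.exp (-α * (t - u)) * F u) (s := Set.Iic t)
  rw [← h, preimage_sub_left_Iic, integrableOn_Ici_iff_integrableOn_Ioi]
  refine (integrableOn_exp_neg_mul_comp_sub hα hF hC t).congr (Eventually.of_forall fun p => ?_)
  simp

lemma hasDerivAt_expSmooth (hα : 0 < α) (hF : Continuous F) {C : ℝ}
    (hC : ∀ x, |F x| ≤ C * (1 + |x|)) (x : ℝ) :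
    HasDerivAt (expSmooth α F) (F x - α * expSmooth α F x) x := by
  have hint : ∀ t, IntegrableOn (fun u => Real.exp (α * u) * F u) (Set.Iic t) := by
    intro t
    have := (integrableOn_Iic_exp_neg_mul hα hF hC t).const_mul (Real.exp (α * t))
    refine this.congr (Eventually.of_forall fun u => ?_)
    simp only
    rw [← mul_assoc, ← Real.exp_add]
    ring_nf
  have heq : ∀ t, expSmooth α F t = Real.exp (-α * t) *
      ((∫ u in Set.Iic 0, Real.exp (α * u) * F u) + ∫ u in (0 : ℝ)..t, Real.exp (α * u) * F u) := by
    intro t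
    rw [← intervalIntegral.integral_Iic_sub_Iic (hint 0) (hint t), add_sub_cancel,
      ← integral_Iic_exp_neg_mul, ← integral_const_mul]
    refine integral_congr_ae (Eventually.of_forall fun u => ?_)
    simp only
    rw [← mul_assoc, ← Real.exp_add]
    ring_nf
  have hc : Continuous fun u => Real.exp (α * u) * F u := by fun_prop
  have hd := (intervalIntegral.integral_hasDerivAt_right (hc.intervalIntegrable 0 x)
    (hc.stronglyMeasurableAtFilter _ _) hc.continuousAt).const_add
      (∫ u in Set.Iic 0, Real.exp (α * u) * F u)
  have he : HasDerivAt (fun t => Real.exp (-α * t)) (Real.exp (-α * x) * (-α * 1)) x :=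
    ((hasDerivAt_id x).const_mul (-α)).exp
  have := he.mul hd
  rw [show expSmooth α F = _ from funext heq]
  convert! this using 1
  have h1 : Real.exp (-α * x) * Real.exp (α * x) = 1 := by
    rw [← Real.exp_add, neg_mul, neg_add_cancel, Real.exp_zero]
  linear_combination -(F x) * h1

lemma continuous_expSmooth (hα : 0 < α) (hF : Continuous F) {C : ℝ}
    (hC : ∀ x, |F x| ≤ C * (1 + |x|)) : Continuous (expSmooth α F) :=
  continuous_iff_continuousAt.2 fun x => (hasDerivAt_expSmooth hα hF hC x).continuousAt

/-- The derivative of the exponential average of a homogeneous function, which is the average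
`∫ α e^{-α p} (F x - F (x - p)) dp` of increments. -/
lemma powDecay_sub_expSmooth {a : ℝ} (ha0 : 0 < a) (ha1 : a ≤ 1) (cp cm : ℝ) (hα : 0 < α) :
    PowDecay (fun x => powKernel a cp cm x - α * expSmooth α (powKernel a cp cm) x) (a - 1)
      (cp * a / α) (-cm * a / α) := by
  have hF := continuous_powKernel ha0 cp cm
  have hC := abs_powKernel_le_linear ha0.le ha1 cp cm
  have h := powDecay_of_integral_sub ha0 ha1 cp cm (μ := volume.restrict (Set.Ioi 0))
    (k := fun p => α * Real.exp (-α * p))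
    (D := fun x => powKernel a cp cm x - α * expSmooth α (powKernel a cp cm) x)
    ((ae_restrict_mem measurableSet_Ioi).mono fun p hp => le_of_lt hp)
    (Continuous.aestronglyMeasurable (by fun_prop))
    (by simpa only [mul_assoc] using (integrableOn_exp_neg_mul_mul_id hα).const_mul α)
    (hF.sub ((continuous_expSmooth hα hF hC).const_mul α))
    (fun x => by
      have h1 : ∀ p, α * Real.exp (-α * p) * (powKernel a cp cm x - powKernel a cp cm (x - p)) =
          α * powKernel a cp cm x * Real.exp (-α * p) -
            α * (Real.exp (-α * p) * powKernel a cp cm (x - p)) := fun p => by ring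
      simp_rw [h1]
      rw [integral_sub ((integrableOn_exp_neg_mul hα).const_mul _)
        ((integrableOn_exp_neg_mul_comp_sub hα hF hC x).const_mul _), integral_const_mul,
        integral_const_mul, integral_exp_neg_mul hα, expSmooth]
      field_simp)
  have h2 : ∫ p in Set.Ioi 0, α * Real.exp (-α * p) * p = 1 / α := by
    simp_rw [mul_assoc]
    rw [integral_const_mul, integral_exp_neg_mul_mul_id hα]
    field_simp
  rw [h2] at h
  simpa only [mul_one_div] using h

end ExpSmooth

/-- The coefficients `K i j` for which the covariances of a bivariate fractional Brownian motion are
`G t + G (-s) - G (t - s)`, where `G` is homogeneous of degree `H i + H j` with `G 1 = K i j` and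
`G (-1) = K j i`. -/
noncomputable def mfBmCoeff (ρ η : ℝ) (i j : Fin 2) : ℝ :=
  if i = j then 1 / 2 else if i = 0 then (ρ + η) / 2 else (ρ - η) / 2

section Covariance

variable {Ω : Type*} [MeasurableSpace Ω] {P : Measure Ω} [IsProbabilityMeasure P]
  {H α ν : Fin 2 → ℝ} {B Y : Fin 2 → ℝ → Ω → ℝ}

lemma mfBmCrossCov_eq {ρ η h : ℝ} (hh : 0 < h) (t s : ℝ) :
    mfBmCrossCov ρ η h t s = powKernel h ((ρ + η) / 2) ((ρ - η) / 2) t +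
      powKernel h ((ρ + η) / 2) ((ρ - η) / 2) (-s) -
      powKernel h ((ρ + η) / 2) ((ρ - η) / 2) (t - s) := by
  have key : ∀ x, powKernel h ((ρ + η) / 2) ((ρ - η) / 2) x = (ρ - sgn (-x) * η) * |x| ^ h / 2 := by
    intro x
    unfold powKernel sgn
    split_ifs with h1 h2 h2
    · linarith
    · rw [abs_of_pos h1]; ring
    · rw [abs_of_nonpos (not_lt.1 h1)]; ring
    · linarith
  have key' : ∀ x, (ρ - sgn (-x) * η) * |x| ^ h = (ρ + sgn x * η) * |x| ^ h := by
    intro x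
    rcases eq_or_ne x 0 with rfl | hx
    · simp [Real.zero_rpow hh.ne']
    · have : sgn (-x) = -sgn x := by
        unfold sgn
        rcases lt_or_gt_of_ne hx with h1 | h1
        · rw [if_pos (by linarith), if_neg (by linarith)]; ring
        · rw [if_neg (by linarith), if_pos h1.le]
      rw [this]; ring
  rw [key, key, key, key', mfBmCrossCov, neg_neg, neg_sub, abs_neg, abs_sub_comm t s]
  ring

/-- All covariances of a bivariate fractional Brownian motion in a common form. -/
lemma IsMfBm.covariance_eq (hB : IsMfBm B H P) (hH : ∀ i, 0 < H i)
    (h1 : 1 < H 0 + H 1) (h2 : H 0 + H 1 < 2) (i j : Fin 2) (t s : ℝ) :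
    cov[B i t, B j s; P] =
      powKernel (H i + H j) (mfBmCoeff (mfBmRho B P) (mfBmEta B H P) i j)
        (mfBmCoeff (mfBmRho B P) (mfBmEta B H P) j i) t +
      powKernel (H i + H j) (mfBmCoeff (mfBmRho B P) (mfBmEta B H P) i j)
        (mfBmCoeff (mfBmRho B P) (mfBmEta B H P) j i) (-s) -
      powKernel (H i + H j) (mfBmCoeff (mfBmRho B P) (mfBmEta B H P) i j)
        (mfBmCoeff (mfBmRho B P) (mfBmEta B H P) j i) (t - s) := by
  have hdiag : ∀ i, cov[B i t, B i s; P] = powKernel (H i + H i) (1 / 2) (1 / 2) t +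
      powKernel (H i + H i) (1 / 2) (1 / 2) (-s) -
      powKernel (H i + H i) (1 / 2) (1 / 2) (t - s) := by
    intro i
    have key : ∀ x, powKernel (H i + H i) (1 / 2) (1 / 2) x = |x| ^ (2 * H i) / 2 := by
      intro x
      unfold powKernel
      split_ifs with h
      · rw [abs_of_pos h, two_mul]; ring
      · rw [abs_of_nonpos (not_lt.1 h), two_mul]; ring
    rw [(hB.fbm i).covariance, key, key, key, abs_neg]
    ring
  have hpos : 0 < H 0 + H 1 := by linarith
  fin_cases i <;> fin_cases j
  · simpa [mfBmCoeff] using hdiag 0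
  · simpa [mfBmCoeff] using (hB.cross_covariance hH h1 h2 t s).trans (mfBmCrossCov_eq hpos t s)
  · have hneg : ∀ kp km x, powKernel (H 1 + H 0) kp km x = powKernel (H 0 + H 1) km kp (-x) := by
      intro kp km x
      rw [powKernel_eq_max (by linarith), powKernel_eq_max hpos, neg_neg, add_comm (H 1)]
      ring
    have := (hB.cross_covariance hH h1 h2 s t).trans (mfBmCrossCov_eq hpos s t)
    rw [covariance_comm] at this
    simp only [Fin.mk_one, Fin.zero_eta, mfBmCoeff]
    rw [this, hneg, hneg, hneg]
    simp only [one_ne_zero, zero_ne_one, if_false, if_true, neg_neg, neg_sub]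
    ring
  · simpa [mfBmCoeff] using hdiag 1

/-- The covariances of the bivariate fractional Ornstein–Uhlenbeck process, as an exponential
average of the derivative of the exponential average of `F = G'`, where `G` is the homogeneous
function from the covariances of the driving process. -/
theorem IsMfOU.covariance_eq (hB : IsMfBm B H P) (hY : IsMfOU Y B α ν P)
    (hH : ∀ i, 0 < H i ∧ H i < 1) (hα : ∀ i, 0 < α i) (hν : ∀ i, 0 < ν i) {i j : Fin 2}
    (hij : 1 < H i + H j) {kp km : ℝ}
    (hcov : ∀ t s, cov[B i t, B j s; P] = powKernel (H i + H j) kp km t +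
      powKernel (H i + H j) kp km (-s) - powKernel (H i + H j) kp km (t - s))
    (t s : ℝ) :
    cov[Y i t, Y j s; P] = ν i * ν j * ∫ p in Set.Ioi 0, Real.exp (-α j * p) *
      (powKernel (H i + H j - 1) ((H i + H j) * kp) (-((H i + H j) * km)) (t - s + p) -
        α i * expSmooth (α i)
          (powKernel (H i + H j - 1) ((H i + H j) * kp) (-((H i + H j) * km))) (t - s + p)) := by
  set F := powKernel (H i + H j - 1) ((H i + H j) * kp) (-((H i + H j) * km)) with hFdef
  have ha0 : 0 < H i + H j - 1 := by linarith
  have ha1 : H i + H j - 1 ≤ 1 := by linarith [(hH i).2, (hH j).2]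
  have hF : Continuous F := continuous_powKernel ha0 _ _
  obtain ⟨C, hC⟩ : ∃ C, ∀ x, |F x| ≤ C * (1 + |x|) := ⟨_, abs_powKernel_le_linear ha0.le ha1 _ _⟩
  have hC0 : 0 ≤ C := by simpa using (abs_nonneg _).trans (hC 0)
  have hBG : ∀ i, IsGaussianProcess (B i) P := fun i => (hB.fbm i).gaussian
  have hY2 : ∀ i t, MemLp (Y i t) 2 P := fun i t =>
    (hY.gaussian.hasGaussianLaw_eval (i, t)).memLp_two
  -- Covariances of `Y i` with the driving process.
  have h1 : ∀ v, cov[Y i t, B j v; P] =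
      ν i * (expSmooth (α i) F t - expSmooth (α i) F (t - v)) := by
    intro v
    have hlin : ∀ x, |F x - F (x - v)| ≤ C * (2 + |v|) * (1 + |x|) := by
      intro x
      have e1 := abs_comp_sub_le hC x v
      have e2 := hC x
      have e3 := abs_sub (F x) (F (x - v))
      nlinarith
    rw [covariance_of_hasRSIntegralIic (hBG i) (hB.fbm i).centered (hα i).le (hν i).ne'
      (hB.memLp j v) (hY.integral i t) (φ' := fun u => F u - F (u - v)) (fun u => ?_)
      (by fun_prop) (integrableOn_Iic_exp_neg_mul (hα i) (by fun_prop) hlin t),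
      integral_Iic_exp_neg_mul, expSmooth, expSmooth, expSmooth, ← integral_sub
      (integrableOn_exp_neg_mul_comp_sub (hα i) hF hC t)
      (integrableOn_exp_neg_mul_comp_sub (hα i) hF hC (t - v))]
    · congr 1
      refine integral_congr_ae (Eventually.of_forall fun p => ?_)
      simp only
      rw [sub_right_comm]; ring
    · have hd1 := hasDerivAt_powKernel hij kp km u
      have hd2 := (hasDerivAt_powKernel hij kp km (u - v)).comp_sub_const u v
      have := (hd1.add_const (powKernel (H i + H j) kp km (-v))).sub hd2
      simp_rw [hcov]
      exact this
  have hE := hasDerivAt_expSmooth (hα i) hF hC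
  set D : ℝ → ℝ := fun x => F x - α i * expSmooth (α i) F x with hD
  have hDc : Continuous D := hF.sub ((continuous_expSmooth (hα i) hF hC).const_mul _)
  have hDlin : ∃ C, ∀ x, |D x| ≤ C * (1 + |x|) := by
    refine ⟨C + α i * (C * ∫ p in Set.Ioi 0, Real.exp (-α i * p) * (1 + |p|)), fun x => ?_⟩
    have e1 := abs_sub (F x) (α i * expSmooth (α i) F x)
    rw [abs_mul, abs_of_pos (hα i)] at e1
    have e2 := mul_le_mul_of_nonneg_left (abs_expSmooth_le (hα i) hC x) (hα i).le
    have e3 := hC x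
    simp only [hD]
    linarith
  obtain ⟨C', hC'⟩ := hDlin
  have hlin : ∀ x, |ν i * D (t - x)| ≤ ν i * (C' * (1 + |t|)) * (1 + |x|) := by
    intro x
    rw [abs_mul, abs_of_pos (hν i), mul_assoc]
    exact mul_le_mul_of_nonneg_left (abs_comp_sub_le hC' t x) (hν i).le
  rw [covariance_comm, covariance_of_hasRSIntegralIic (hBG j) (hB.fbm j).centered (hα j).le
    (hν j).ne' (hY2 i t) (hY.integral j s) (φ' := fun v => ν i * D (t - v)) (fun v => ?_)
    (by fun_prop) (integrableOn_Iic_exp_neg_mul (hα j) (by fun_prop) hlin s),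
    integral_Iic_exp_neg_mul, expSmooth]
  · have : ∀ p, Real.exp (-α j * p) * (ν i * D (t - (s - p))) =
        ν i * (Real.exp (-α j * p) * D (t - s + p)) := by
      intro p
      rw [show t - (s - p) = t - s + p by ring]; ring
    simp_rw [this]
    rw [integral_const_mul]
    ring
  · have e : (fun v => cov[B j v, Y i t; P]) =
        fun v => ν i * (expSmooth (α i) F t - expSmooth (α i) F (t - v)) := by
      funext v
      rw [covariance_comm, h1]
    rw [e]
    have := (((hE (t - v)).comp_const_sub t v).const_sub (expSmooth (α i) F t)).const_mul (ν i)
    rwa [neg_neg] at this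

end Covariance

/-! ### Asymptotics of the covariance functions -/

lemma HasPowTails.const_mul {g : ℤ → ℝ} {e cp cm : ℝ} (hg : HasPowTails g e cp cm) (c : ℝ) :
    HasPowTails (fun m => c * g m) e (c * cp) (c * cm) :=
  ⟨by simpa only [mul_assoc] using hg.1.const_mul c,
    by simpa only [mul_assoc] using hg.2.const_mul c⟩

/-- The coefficients of the kernels are the second derivatives at `±1` of the homogeneous functions
from the covariances, with the two sides exchanged. -/
lemma two_mul_zKernel (H : Fin 2 → ℝ) {α ν : Fin 2 → ℝ} (ρ η : ℝ) (hα : ∀ i, α i ≠ 0)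
    (i j : Fin 2) :
    2 * zKernel H α ν ρ η i j 1 0 = ν i * ν j *
        ((H i + H j) * (H i + H j - 1) * mfBmCoeff ρ η j i / (α i * α j)) ∧
      2 * zKernel H α ν ρ η i j 0 1 = ν i * ν j *
        ((H i + H j) * (H i + H j - 1) * mfBmCoeff ρ η i j / (α i * α j)) := by
  have h0 := hα 0
  have h1 := hα 1
  have h01 : ¬ (1 : ℝ) < 0 := by norm_num
  fin_cases i <;> fin_cases j <;> constructor <;> simp [zKernel, mfBmCoeff, h01] <;> field_simp <;>
    ring

lemma hurst_add_mem {H : Fin 2 → ℝ} (hH : ∀ i, 0 < H i ∧ H i < 1) (hH32 : 3 / 2 < H 0 + H 1)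
    (i j : Fin 2) : 1 < H i + H j ∧ H i + H j < 2 :=
  ⟨by linarith [half_lt_hurst hH hH32 i, half_lt_hurst hH hH32 j],
    by linarith [(hH i).2, (hH j).2]⟩

section Tails

variable {Ω : Type*} [MeasurableSpace Ω] {P : Measure Ω} [IsProbabilityMeasure P]
  {H α ν : Fin 2 → ℝ} {B Y : Fin 2 → ℝ → Ω → ℝ}

/-- The covariance function of the time-reversed fractional Ornstein–Uhlenbeck process, with its
asymptotics. The covariance of `Y 0 t` and `Y 1 s` has the coefficient `ρ + η` for `t > s`, whereas
`zKernel` has it for `x < y`; reversing time reconciles the two. -/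
theorem IsMfOU.exists_hasPowTails (hB : IsMfBm B H P) (hY : IsMfOU Y B α ν P)
    (hH : ∀ i, 0 < H i ∧ H i < 1) (hH32 : 3 / 2 < H 0 + H 1) (hα : ∀ i, 0 < α i)
    (hν : ∀ i, 0 < ν i) : ∃ γ : Fin 2 → Fin 2 → ℤ → ℝ,
      (∀ (c : ℝ) i j (m l : ℤ), cov[Y i (c - m), Y j (c - l); P] = γ i j (m - l)) ∧
      ∀ i j, HasPowTails (γ i j) (H i + H j - 2)
        (2 * zKernel H α ν (mfBmRho B P) (mfBmEta B H P) i j 1 0)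
        (2 * zKernel H α ν (mfBmRho B P) (mfBmEta B H P) i j 0 1) := by
  set ρ := mfBmRho B P
  set η := mfBmEta B H P
  let F : Fin 2 → Fin 2 → ℝ → ℝ := fun i j => powKernel (H i + H j - 1)
    ((H i + H j) * mfBmCoeff ρ η i j) (-((H i + H j) * mfBmCoeff ρ η j i))
  let D : Fin 2 → Fin 2 → ℝ → ℝ := fun i j x => F i j x - α i * expSmooth (α i) (F i j) x
  let Γ : Fin 2 → Fin 2 → ℤ → ℝ := fun i j m =>
    ν i * ν j * ∫ p in Set.Ioi 0, Real.exp (-α j * p) * D i j (m + p)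
  refine ⟨fun i j m => Γ i j (-m), fun c i j m l => ?_, fun i j => ?_⟩
  · rw [hY.covariance_eq hB hH hα hν (hurst_add_mem hH hH32 i j).1
      (hB.covariance_eq (fun i => (hH i).1) (hurst_add_mem hH hH32 0 1).1
        (hurst_add_mem hH hH32 0 1).2 i j)]
    simp only [Γ, D, F]
    push_cast
    rw [show c - (m : ℝ) - (c - l) = -(m - l) by ring]
  · obtain ⟨hij1, hij2⟩ := hurst_add_mem hH hH32 i j
    have hD : PowDecay (D i j) _ _ _ := powDecay_sub_expSmooth (a := H i + H j - 1) (by linarith)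
      (by linarith) ((H i + H j) * mfBmCoeff ρ η i j) (-((H i + H j) * mfBmCoeff ρ η j i)) (hα i)
    have h := ((hD.hasPowTails_integral (by linarith) (by linarith)
      (μ := volume.restrict (Set.Ioi 0)) (k := fun p => Real.exp (-α j * p))
      (Continuous.aestronglyMeasurable (by fun_prop))
      (integrableOn_exp_neg_mul_one_add_abs (hα j))).const_mul (ν i * ν j)).neg
    rw [integral_exp_neg_mul (hα j)] at h
    obtain ⟨e1, e2⟩ := two_mul_zKernel H (ν := ν) ρ η (fun i => (hα i).ne') i j
    have hαi := (hα i).ne'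
    have hαj := (hα j).ne'
    convert! h using 1
    · ring
    · rw [e1]; field_simp
    · rw [e2]; field_simp

/-- The covariance function of the time-reversed increments of a bivariate fractional Brownian
motion, with its asymptotics. -/
theorem IsMfBm.exists_hasPowTails (hB : IsMfBm B H P)
    (hH : ∀ i, 0 < H i ∧ H i < 1) (hH32 : 3 / 2 < H 0 + H 1) : ∃ γ : Fin 2 → Fin 2 → ℤ → ℝ,
      (∀ i j (m l : ℤ), cov[fun ω => B i (-m + 1) ω - B i (-m) ω,
        fun ω => B j (-l + 1) ω - B j (-l) ω; P] = γ i j (m - l)) ∧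
      ∀ i j, HasPowTails (γ i j) (H i + H j - 2)
        (2 * zKernel H 1 1 (mfBmRho B P) (mfBmEta B H P) i j 1 0)
        (2 * zKernel H 1 1 (mfBmRho B P) (mfBmEta B H P) i j 0 1) := by
  set ρ := mfBmRho B P with hρ
  set η := mfBmEta B H P with hη
  let G : Fin 2 → Fin 2 → ℝ → ℝ := fun i j => powKernel (H i + H j)
    (mfBmCoeff ρ η i j) (mfBmCoeff ρ η j i)
  let F : Fin 2 → Fin 2 → ℝ → ℝ := fun i j => powKernel (H i + H j - 1)
    ((H i + H j) * mfBmCoeff ρ η i j) (-((H i + H j) * mfBmCoeff ρ η j i))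
  let D : Fin 2 → Fin 2 → ℝ → ℝ := fun i j x => F i j x - F i j (x - 1)
  let Γ : Fin 2 → Fin 2 → ℤ → ℝ := fun i j m => ∫ p in Set.Ioc 0 1, 1 * D i j (m + p)
  have hFc : ∀ i j, Continuous (F i j) := fun i j =>
    continuous_powKernel (by linarith [(hurst_add_mem hH hH32 i j).1]) _ _
  refine ⟨fun i j m => Γ i j (-m), fun i j m l => ?_, fun i j => ?_⟩
  · have hcov : ∀ t s, cov[B i t, B j s; P] = G i j t + G i j (-s) - G i j (t - s) :=
      hB.covariance_eq (fun i => (hH i).1) (hurst_add_mem hH hH32 0 1).1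
        (hurst_add_mem hH hH32 0 1).2 i j
    have hderiv : ∀ c x, HasDerivAt (fun x => G i j (x + c)) (F i j (x + c)) x := fun c x =>
      (hasDerivAt_powKernel (hurst_add_mem hH hH32 i j).1 _ _ (x + c)).comp_add_const x c
    have hint : ∀ w : ℝ, ∫ p in Set.Ioc 0 1, 1 * D i j (w + p) =
        G i j (w + 1) + G i j (w - 1) - 2 * G i j w := by
      intro w
      rw [← intervalIntegral.integral_of_le zero_le_one]
      have hc : Continuous fun x => F i j (x + w) - F i j (x + (w - 1)) :=
        ((hFc i j).comp (continuous_add_const w)).sub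
          ((hFc i j).comp (continuous_add_const (w - 1)))
      have := intervalIntegral.integral_eq_sub_of_hasDerivAt (a := 0) (b := 1)
        (f := fun x => G i j (x + w) - G i j (x + (w - 1)))
        (fun x _ => (hderiv w x).sub (hderiv (w - 1) x)) (hc.intervalIntegrable _ _)
      simp only [one_mul, D]
      simp_rw [show ∀ x : ℝ, w + x - 1 = x + (w - 1) by intro x; ring, add_comm w]
      rw [this]
      simp only [zero_add, add_sub_cancel, add_comm 1 w]
      ring
    rw [covariance_fun_sub_fun_sub (hB.memLp _ _) (hB.memLp _ _) (hB.memLp _ _) (hB.memLp _ _),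
      hcov, hcov, hcov, hcov]
    simp only [Γ]
    rw [hint]
    push_cast
    rw [show -(m : ℝ) + 1 - (-l + 1) = -(m - l) by ring,
      show -(m : ℝ) + 1 - -l = -(m - l) + 1 by ring,
      show -(m : ℝ) - (-l + 1) = -(m - l) - 1 by ring, show -(m : ℝ) - -l = -(m - l) by ring]
    ring
  · obtain ⟨hij1, hij2⟩ := hurst_add_mem hH hH32 i j
    have hD : PowDecay (D i j) _ _ _ := powDecay_of_integral_sub (a := H i + H j - 1) (by linarith)
      (by linarith) ((H i + H j) * mfBmCoeff ρ η i j) (-((H i + H j) * mfBmCoeff ρ η j i))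
      (μ := Measure.dirac 1) (k := fun _ => 1)
      (by rw [ae_dirac_eq]; exact eventually_pure.2 zero_le_one)
      aestronglyMeasurable_const (integrable_dirac (by simp))
      ((hFc i j).sub ((hFc i j).comp (by fun_prop))) (fun x => by simp [D, F])
    have h := (hD.hasPowTails_integral (by linarith) (by linarith)
      (μ := volume.restrict (Set.Ioc 0 1)) (k := fun _ => 1) aestronglyMeasurable_const
      ((Continuous.integrableOn_Icc (by fun_prop)).mono_set Set.Ioc_subset_Icc_self)).neg
    obtain ⟨e1, e2⟩ := two_mul_zKernel H (α := 1) (ν := 1) ρ η (fun i => one_ne_zero) i j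
    convert! h using 1
    · ring
    · rw [e1]; simp; ring
    · rw [e2]; simp; ring

end Tails

/-! ### The rescaled statistic -/

lemma memLp_mul_of_hasGaussianLaw {Ω : Type*} [MeasurableSpace Ω] {P : Measure Ω} {U V : Ω → ℝ}
    (hU : HasGaussianLaw U P) (hV : HasGaussianLaw V P) (q : ℕ) :
    MemLp (fun ω => U ω * V ω) q P := by
  have : ENNReal.HolderTriple ((2 * q : ℕ) : ENNReal) ((2 * q : ℕ) : ENNReal) q := ⟨by
    rw [Nat.cast_mul, ENNReal.mul_inv (by simp) (by simp), ← add_mul]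
    simp [ENNReal.inv_two_add_inv_two]⟩
  have hm : ∀ {U : Ω → ℝ}, HasGaussianLaw U P → MemLp U ((2 * q : ℕ) : ENNReal) P := fun hU =>
    hU.memLp (ENNReal.natCast_ne_top _)
  exact (hm hV).mul (hm hU)

/-- The statistic after the time reversal `k ↦ n - k`, under which the lag `s` becomes `-s`. -/
lemma rescaledStat_eq {Ω : Type*} (Y : Fin 2 → ℝ → Ω → ℝ) (h ρ a₁ a₂ a₃ : ℝ) (s n : ℕ) (ω : Ω) :
    rescaledStat Y h ρ a₁ a₂ a₃ s n ω =
      (∑ e : Fin 3 × Fin n, (n : ℝ) ^ (1 - h) * ![a₁, a₂, a₃] e.1 *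
      (Y 0 (n - ((e.2 + (![![0, 0], ![-s, 0], ![0, -s]] : Fin 3 → Fin 2 → ℤ) e.1 0 : ℤ) : ℝ)) ω *
        Y 1 (n - ((e.2 + (![![0, 0], ![-s, 0], ![0, -s]] : Fin 3 → Fin 2 → ℤ) e.1 1 : ℤ) : ℝ)) ω)) +
      -((n : ℝ) ^ (1 - h) * (n * ρ)) := by
  have hrev : ∀ f : ℝ → ℝ, ∑ k ∈ Finset.Icc 1 n, f k = ∑ k : Fin n, f (n - (k : ℕ)) := by
    intro f
    rw [Fin.sum_univ_eq_sum_range (fun k : ℕ => f (n - k))]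
    refine Finset.sum_nbij' (fun k => n - k) (fun k => n - k) ?_ ?_ ?_ ?_ ?_
    · intro k hk; simp only [Finset.mem_Icc, Finset.mem_range] at *; omega
    · intro k hk; simp only [Finset.mem_Icc, Finset.mem_range] at *; omega
    · intro k hk; simp only [Finset.mem_Icc] at *; omega
    · intro k hk; simp only [Finset.mem_range] at *; omega
    · intro k hk
      simp only [Finset.mem_Icc] at hk
      rw [Nat.cast_sub hk.2, sub_sub_cancel]
  rw [rescaledStat, hrev (fun x => a₁ * (Y 0 x ω * Y 1 x ω) + a₂ * (Y 0 (x + s) ω * Y 1 x ω) +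
    a₃ * (Y 0 x ω * Y 1 (x + s) ω) - ρ), Fintype.sum_prod_type, Fin.sum_univ_three]
  simp only [Finset.sum_sub_distrib, Finset.sum_add_distrib, mul_add, mul_sub, Finset.mul_sum,
    Finset.sum_const, Finset.card_univ, Fintype.card_fin, nsmul_eq_mul, Matrix.cons_val_zero,
    Matrix.cons_val_one, Matrix.cons_val, ← sub_eq_add_neg]
  push_cast
  have hsub : ∀ x : ℝ, (n : ℝ) - (x - s) = n - x + s := fun x => by ring
  simp only [add_zero, mul_assoc, hsub]

section Statistic

variable {Ω : Type*} [MeasurableSpace Ω] {P : Measure Ω} [IsProbabilityMeasure P]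
  {H α ν : Fin 2 → ℝ} {B Y : Fin 2 → ℝ → Ω → ℝ}

lemma memLp_rescaledStat (hY : IsMfOU Y B α ν P) (h ρ a₁ a₂ a₃ : ℝ) (s n q : ℕ) :
    MemLp (rescaledStat Y h ρ a₁ a₂ a₃ s n) q P := by
  have h1 : ∀ (t u : ℝ), MemLp (fun ω => Y 0 t ω * Y 1 u ω) q P := fun t u =>
    memLp_mul_of_hasGaussianLaw (hY.gaussian.hasGaussianLaw_eval (0, t))
      (hY.gaussian.hasGaussianLaw_eval (1, u)) q
  have h2 : ∀ k : ℕ, MemLp (fun ω => a₁ * (Y 0 k ω * Y 1 k ω) + a₂ * (Y 0 (k + s) ω * Y 1 k ω) +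
      a₃ * (Y 0 k ω * Y 1 (k + s) ω) - ρ) q P := fun k =>
    ((((h1 k k).const_mul a₁).add ((h1 (k + s) k).const_mul a₂)).add
      ((h1 k (k + s)).const_mul a₃)).sub (memLp_const ρ)
  exact (memLp_finsetSum (Finset.Icc 1 n) fun k _ => h2 k).const_mul ((n : ℝ) ^ (1 - h))

/-- Centring the statistic does not affect its cumulants of order at least two, so `ρ'` is
arbitrary. -/
theorem tendsto_cumulant_rescaledStat (hB : IsMfBm B H P) (hY : IsMfOU Y B α ν P)
    (hH : ∀ i, 0 < H i ∧ H i < 1) (hH32 : 3 / 2 < H 0 + H 1) (hα : ∀ i, 0 < α i)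
    (hν : ∀ i, 0 < ν i) (ρ' : ℝ) (s : ℕ) (a₁ a₂ a₃ : ℝ) {p : ℕ} (hp : 2 ≤ p) :
    Tendsto (fun n : ℕ => cumulant p (rescaledStat Y (H 0 + H 1) ρ' a₁ a₂ a₃ s n) P) atTop
      (𝓝 (limitCumulant H α ν (mfBmRho B P) (mfBmEta B H P) (a₁ + a₂ + a₃) p)) := by
  obtain ⟨γ, hγ, htail⟩ := hY.exists_hasPowTails hB hH hH32 hα hν
  have h := tendsto_cumulant_bilinear hH hH32 (X := fun n i m => Y i ((n : ℝ) - m))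
    (fun n => hY.gaussian.comp_right (fun q : Fin 2 × ℤ => (q.1, (n : ℝ) - q.2)))
    (fun n i m => hY.centered i _) (fun n => hγ n) htail ![a₁, a₂, a₃]
    ![![0, 0], ![-s, 0], ![0, -s]] (fun n => -((n : ℝ) ^ (1 - (H 0 + H 1)) * (n * ρ'))) hp
  rw [Fin.sum_univ_three] at h
  refine h.congr fun n => ?_
  congr 1
  funext ω
  exact (rescaledStat_eq Y _ ρ' a₁ a₂ a₃ s n ω).symm

end Statistic

/-! ### The closed form of the limiting variance -/

lemma integral_abs_sub_rpow {r : ℝ} (hr : -1 < r) {x : ℝ} (hx : x ∈ Set.Icc (0 : ℝ) 1) :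
    ∫ y in Set.Icc (0 : ℝ) 1, |x - y| ^ r = (x ^ (r + 1) + (1 - x) ^ (r + 1)) / (r + 1) := by
  have hr1 : r + 1 ≠ 0 := by linarith
  have h1 : ∫ y in (0 : ℝ)..x, |x - y| ^ r = x ^ (r + 1) / (r + 1) := by
    rw [intervalIntegral.integral_comp_sub_left (fun u => |u| ^ r) x, sub_self, sub_zero,
      intervalIntegral.integral_congr (g := fun u => u ^ r)
        (fun u hu => by rw [Set.uIcc_of_le hx.1] at hu; simp only; rw [abs_of_nonneg hu.1]),
      integral_rpow (Or.inl hr), Real.zero_rpow hr1, sub_zero]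
  have h2 : ∫ y in x..(1 : ℝ), |x - y| ^ r = (1 - x) ^ (r + 1) / (r + 1) := by
    simp_rw [abs_sub_comm x]
    rw [intervalIntegral.integral_comp_sub_right (fun u => |u| ^ r) x, sub_self,
      intervalIntegral.integral_congr (g := fun u => u ^ r)
        (fun u hu => by
          rw [Set.uIcc_of_le (by linarith [hx.2])] at hu; simp only; rw [abs_of_nonneg hu.1]),
      integral_rpow (Or.inl hr), Real.zero_rpow hr1, sub_zero]
  have hi : ∀ a b : ℝ, IntervalIntegrable (fun y => |x - y| ^ r) volume a b := by
    intro a b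
    have := (intervalIntegrable_abs_rpow hr (x - a) (x - b)).comp_sub_left x
    simpa using this
  rw [integral_Icc_eq_integral_Ioc, ← intervalIntegral.integral_of_le zero_le_one,
    ← intervalIntegral.integral_add_adjacent_intervals (hi 0 x) (hi x 1), h1, h2]
  ring

lemma integral_square_abs_sub_rpow {r : ℝ} (hr : -1 < r) (hr0 : r < 0) :
    ∫ x in Set.Icc (0 : Fin 2 → ℝ) 1, |x 0 - x 1| ^ r = 2 / ((r + 1) * (r + 2)) := by
  have hr1 : r + 1 ≠ 0 := by linarith
  have hr2 : r + 2 ≠ 0 := by linarith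
  have hpre : MeasurableEquiv.finTwoArrow ⁻¹' (Set.Icc (0 : ℝ) 1 ×ˢ Set.Icc (0 : ℝ) 1) =
      Set.Icc (0 : Fin 2 → ℝ) 1 := by
    ext x
    simp only [MeasurableEquiv.finTwoArrow, Set.mem_preimage, Set.mem_prod, Set.mem_Icc, Pi.le_def,
      Fin.forall_fin_two]
    simp
    tauto
  have hmp := volume_preserving_finTwoArrow ℝ
  have hint : IntegrableOn (fun z : ℝ × ℝ => |z.1 - z.2| ^ r)
      (Set.Icc (0 : ℝ) 1 ×ˢ Set.Icc (0 : ℝ) 1) := by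
    rw [← hmp.integrableOn_comp_preimage MeasurableEquiv.finTwoArrow.measurableEmbedding, hpre]
    refine (integrableOn_prod_abs_rpow (le_refl 2) (u := fun _ => -r / 2) (fun _ => by linarith)
      (fun _ => by linarith) (by simp; linarith)).congr ?_
    filter_upwards [ae_forall_ne_finRotate (le_refl 2)] with x hx
    have hx0 : 0 < |x 0 - x 1| := abs_pos.2 (sub_ne_zero.2 (by simpa using hx 0))
    have e0 : finRotate 2 0 = 1 := rfl
    have e1 : finRotate 2 1 = 0 := rfl
    rw [Fin.prod_univ_two, e0, e1, abs_sub_comm (x 1), ← Real.rpow_add hx0]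
    simp only [Function.comp_apply, MeasurableEquiv.finTwoArrow_apply]
    congr 1; ring
  have h := hmp.setIntegral_preimage_emb MeasurableEquiv.finTwoArrow.measurableEmbedding
    (fun z : ℝ × ℝ => |z.1 - z.2| ^ r) (Set.Icc (0 : ℝ) 1 ×ˢ Set.Icc (0 : ℝ) 1)
  rw [hpre] at h
  have h' : ∀ x : Fin 2 → ℝ, MeasurableEquiv.finTwoArrow x = (x 0, x 1) := fun x => rfl
  simp only [h'] at h
  rw [h, Measure.volume_eq_prod, setIntegral_prod _ (by rwa [Measure.volume_eq_prod] at hint),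
    setIntegral_congr_fun measurableSet_Icc (fun x hx => integral_abs_sub_rpow hr hx),
    integral_Icc_eq_integral_Ioc, ← intervalIntegral.integral_of_le zero_le_one,
    intervalIntegral.integral_div, intervalIntegral.integral_add,
    intervalIntegral.integral_comp_sub_left (fun u => u ^ (r + 1)) 1]
  · rw [sub_self, sub_zero, integral_rpow (Or.inl (by linarith)), Real.one_rpow,
      show r + 1 + 1 = r + 2 by ring, Real.zero_rpow hr2]
    field_simp
    ring
  · exact (Real.continuous_rpow_const (by linarith)).intervalIntegrable _ _
  · exact ((Real.continuous_rpow_const (by linarith)).comp (by fun_prop)).intervalIntegrable _ _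

lemma zKernel_self_comm (H α ν : Fin 2 → ℝ) (ρ η : ℝ) (x y : ℝ) :
    zKernel H α ν ρ η 0 0 x y * zKernel H α ν ρ η 1 1 y x =
      ν 0 ^ 2 * ν 1 ^ 2 * H 0 * H 1 * (2 * H 0 - 1) * (2 * H 1 - 1) / (4 * α 0 ^ 2 * α 1 ^ 2) *
        (|x - y| ^ (2 * H 0 - 2) * |x - y| ^ (2 * H 1 - 2)) := by
  simp only [zKernel, if_true]
  rw [abs_sub_comm y x]
  ring

/-- The limit of the cumulants of order two in closed form. -/
lemma limitCumulant_two {H : Fin 2 → ℝ} (hH : ∀ i, 0 < H i ∧ H i < 1)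
    (hH32 : 3 / 2 < H 0 + H 1) (α ν : Fin 2 → ℝ) (ρ η A : ℝ) :
    limitCumulant H α ν ρ η A 2 = A ^ 2 * limitVariance H α ν ρ η := by
  set r := 2 * (H 0 + H 1) - 4 with hr
  have hr0 : r < 0 := by linarith [(hH 0).2, (hH 1).2]
  have hr1 : -1 < r := by linarith
  have hJ := integral_square_abs_sub_rpow hr1 hr0
  have hne : ∀ᵐ x ∂(volume.restrict (Set.Icc (0 : Fin 2 → ℝ) 1)), x 0 ≠ x 1 :=
    (ae_forall_ne_finRotate (le_refl 2)).mono fun x hx => by simpa using hx 0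
  have hdiag : ∀ x y : ℝ, x ≠ y → |x - y| ^ (2 * H 0 - 2) * |x - y| ^ (2 * H 1 - 2) =
      |x - y| ^ r := by
    intro x y hxy
    rw [← Real.rpow_add (abs_pos.2 (sub_ne_zero.2 hxy))]
    congr 1; rw [hr]; ring
  have hoff : ∀ x y : ℝ, x ≠ y → ∀ i j : Fin 2, i ≠ j →
      zKernel H α ν ρ η i j x y * zKernel H α ν ρ η i j y x =
      (ν 0 * ν 1 * (H 0 + H 1) * (H 0 + H 1 - 1) / (4 * α 0 * α 1)) ^ 2 * (ρ ^ 2 - η ^ 2) *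
        |x - y| ^ r := by
    intro x y hxy i j hij
    have key : ∀ d : ℝ, 0 < d → d ^ (H 0 + H 1 - 2) * d ^ (H 0 + H 1 - 2) = d ^ r := by
      intro d hd
      rw [← Real.rpow_add hd]
      congr 1; rw [hr]; ring
    simp only [zKernel, if_neg hij]
    rcases lt_or_gt_of_ne hxy with h | h
    · rw [abs_of_neg (by linarith), neg_sub, ← key _ (by linarith : 0 < y - x)]
      simp only [h, not_lt.2 h.le, if_true, if_false]
      split_ifs <;> ring
    · rw [abs_of_pos (by linarith), ← key _ (by linarith : 0 < x - y)]
      simp only [h, not_lt.2 h.le, if_true, if_false]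
      split_ifs <;> ring
  have hI : ∀ i : Fin 2 → Fin 2, ∫ x in Set.Icc (0 : Fin 2 → ℝ) 1,
      cyclicProd H α ν ρ η 2 i (fun k => 1 - i (finRotate 2 k)) x =
      (if i 0 = i 1 then
        (ν 0 * ν 1 * (H 0 + H 1) * (H 0 + H 1 - 1) / (4 * α 0 * α 1)) ^ 2 * (ρ ^ 2 - η ^ 2)
      else ν 0 ^ 2 * ν 1 ^ 2 * H 0 * H 1 * (2 * H 0 - 1) * (2 * H 1 - 1) /
        (4 * α 0 ^ 2 * α 1 ^ 2)) * (2 / ((r + 1) * (r + 2))) := by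
    intro i
    rw [← hJ, ← integral_const_mul]
    refine integral_congr_ae ?_
    filter_upwards [hne] with x hx
    have e0 : finRotate 2 0 = 1 := rfl
    have e1 : finRotate 2 1 = 0 := rfl
    rw [cyclicProd, Fin.prod_univ_two, e0, e1]
    have h2 : ∀ a : Fin 2, a = 0 ∨ a = 1 := by decide
    have s0 : (1 : Fin 2) - 0 = 1 := rfl
    have s1 : (1 : Fin 2) - 1 = 0 := rfl
    rcases h2 (i 0) with h | h <;> rcases h2 (i 1) with h' | h' <;> rw [h, h']
    · rw [if_pos rfl, s0, hoff _ _ hx _ _ (by decide)]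
    · rw [if_neg (by decide), s1, s0, zKernel_self_comm, hdiag _ _ hx]
    · rw [if_neg (by decide), s1, s0, mul_comm, zKernel_self_comm, abs_sub_comm, hdiag _ _ hx]
    · rw [if_pos rfl, s1, hoff _ _ hx _ _ (by decide)]
  rw [limitCumulant_eq, limitVariance]
  simp_rw [hI]
  rw [← (finTwoArrowEquiv (Fin 2)).symm.sum_comp, Fintype.sum_prod_type]
  simp only [Fin.sum_univ_two, finTwoArrowEquiv_symm_apply, Matrix.cons_val_zero,
    Matrix.cons_val_one]
  have hr2 : r + 1 = 2 * (H 0 + H 1) - 3 := by rw [hr]; ring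
  have hr3 : r + 2 = 2 * (H 0 + H 1) - 2 := by rw [hr]; ring
  rw [hr2, hr3]
  simp only [if_true, zero_ne_one, one_ne_zero, if_false, div_eq_mul_inv, mul_inv, mul_pow, inv_pow]
  norm_num
  ring

/-! ### Positivity of the limiting variance -/

/-- The variance of a bilinear form in a centred Gaussian family. -/
lemma cumulant_two_sum_mul {Ω E : Type*} [MeasurableSpace Ω] {P : Measure Ω}
    [IsProbabilityMeasure P] [Fintype E] [DecidableEq E] {X : E × Fin 2 → Ω → ℝ}
    (hX : HasGaussianLaw (fun ω v => X v ω) P) (h0 : ∀ v, ∫ ω, X v ω ∂P = 0) (w : E → ℝ) :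
    cumulant 2 (fun ω => ∑ e, w e * (X (e, 0) ω * X (e, 1) ω) + 0) P =
      ∑ e, ∑ e', w e * w e' *
        (cov[X (e, 0), X (e', 0); P] * cov[X (e, 1), X (e', 1); P] +
          cov[X (e, 0), X (e', 1); P] * cov[X (e, 1), X (e', 0); P]) := by
  rw [cumulant_sum_mul hX h0 w 0 le_rfl, ← (finTwoArrowEquiv (Fin 2)).symm.sum_comp,
    Fintype.sum_prod_type]
  simp_rw [← (finTwoArrowEquiv E).symm.sum_comp, Fintype.sum_prod_type, Fin.prod_univ_two]
  have e0 : finRotate 2 0 = 1 := rfl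
  have e1 : finRotate 2 1 = 0 := rfl
  have s0 : (1 : Fin 2) - 0 = 1 := rfl
  have s1 : (1 : Fin 2) - 1 = 0 := rfl
  simp only [Fin.sum_univ_two, finTwoArrowEquiv_symm_apply, Matrix.cons_val_zero,
    Matrix.cons_val_one, e0, e1, s0, s1, ← Finset.sum_add_distrib, Finset.mul_sum]
  refine Finset.sum_congr rfl fun e _ => Finset.sum_congr rfl fun e' _ => ?_
  rw [covariance_comm (X (e', 1)) (X (e, 0)), covariance_comm (X (e', 0)) (X (e, 0)),
    covariance_comm (X (e', 1)) (X (e, 1)), covariance_comm (X (e', 0)) (X (e, 1))]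
  norm_num
  ring

/-- A lower bound for the alternating sum of `(x - y) ^ h` over the corners of `[a, b] × [c, d]`, by
the mean value theorem in both variables. -/
lemma le_rpow_rectangle {h a b c d R : ℝ} (h1 : 1 < h) (h2 : h ≤ 2) (hcd : c < d) (hda : d ≤ a)
    (hab : a < b) (hR : b - c ≤ R) :
    h * (h - 1) * (b - a) * (d - c) * R ^ (h - 2) ≤
      (b - c) ^ h + (a - d) ^ h - (b - d) ^ h - (a - c) ^ h := by
  have hd1 : ∀ x, HasDerivAt (fun x : ℝ => (x - c) ^ h - (x - d) ^ h)
      (h * (x - c) ^ (h - 1) - h * (x - d) ^ (h - 1)) x := fun x => by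
    have := (((hasDerivAt_id x).sub_const c).rpow_const (p := h) (Or.inr h1.le)).sub
      (((hasDerivAt_id x).sub_const d).rpow_const (p := h) (Or.inr h1.le))
    simp only [one_mul, id] at this
    exact this
  obtain ⟨ξ, hξ, hξ'⟩ := exists_hasDerivAt_eq_slope _ _ hab
    (fun x _ => (hd1 x).continuousAt.continuousWithinAt) fun x _ => hd1 x
  have hξd : 0 < ξ - d := by linarith [hξ.1]
  obtain ⟨ζ, hζ, hζ'⟩ := exists_hasDerivAt_eq_slope (fun y : ℝ => y ^ (h - 1))
    (fun y => (h - 1) * y ^ (h - 1 - 1)) (show ξ - d < ξ - c by linarith)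
    (fun x hx => (Real.continuousAt_rpow_const _ _ (Or.inr (by linarith))).continuousWithinAt)
    fun x hx => Real.hasDerivAt_rpow_const (Or.inl (by linarith [hx.1]))
  have hba : 0 < b - a := by linarith
  have hdc : 0 < d - c := by linarith
  rw [eq_div_iff (by linarith)] at hξ' hζ'
  have hζR : R ^ (h - 2) ≤ ζ ^ (h - 1 - 1) := by
    rw [show h - 1 - 1 = h - 2 by ring]
    exact Real.rpow_le_rpow_of_nonpos (by linarith [hζ.1]) (by linarith [hζ.2, hξ.2]) (by linarith)
  have e : (b - c) ^ h + (a - d) ^ h - (b - d) ^ h - (a - c) ^ h =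
      h * (h - 1) * (b - a) * (d - c) * ζ ^ (h - 1 - 1) := by
    linear_combination -hξ' - h * (b - a) * hζ'
  rw [e]
  exact mul_le_mul_of_nonneg_left hζR (by
    have : 0 < h - 1 := by linarith
    positivity)

section Positivity

variable {Ω : Type*} [MeasurableSpace Ω] {P : Measure Ω} {H : Fin 2 → ℝ}
  {B : Fin 2 → ℝ → Ω → ℝ}

lemma IsMfBm.isGaussianProcess_increments (hB : IsMfBm B H P) :
    IsGaussianProcess (fun (q : Fin 2 × ℝ × ℝ) ω => B q.1 q.2.1 ω - B q.1 q.2.2 ω) P := by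
  classical
  refine hB.gaussian.of_isGaussianProcess fun q => ⟨{(q.1, q.2.1), (q.1, q.2.2)},
    ContinuousLinearMap.proj (R := ℝ)
      (φ := fun _ : ({(q.1, q.2.1), (q.1, q.2.2)} : Finset (Fin 2 × ℝ)) => ℝ)
      ⟨(q.1, q.2.1), by simp⟩ -
    ContinuousLinearMap.proj (R := ℝ)
      (φ := fun _ : ({(q.1, q.2.1), (q.1, q.2.2)} : Finset (Fin 2 × ℝ)) => ℝ)
      ⟨(q.1, q.2.2), by simp⟩, fun ω => by simp⟩

variable [IsProbabilityMeasure P]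

lemma IsMfBm.integral_increment (hB : IsMfBm B H P) (i : Fin 2) (t s : ℝ) :
    ∫ ω, (B i t ω - B i s ω) ∂P = 0 := by
  rw [integral_sub ((hB.memLp i t).integrable one_le_two) ((hB.memLp i s).integrable one_le_two),
    (hB.fbm i).centered, (hB.fbm i).centered, sub_zero]

/-- The covariance of an increment of `B i` with an increment of `B j` over an earlier interval. -/
lemma IsMfBm.covariance_increments (hB : IsMfBm B H P) (hH : ∀ i, 0 < H i)
    (h1 : 1 < H 0 + H 1) (h2 : H 0 + H 1 < 2) (i j : Fin 2) {a b c d : ℝ} (hcd : c ≤ d)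
    (hda : d ≤ a) (hab : a ≤ b) :
    cov[fun ω => B i b ω - B i a ω, fun ω => B j d ω - B j c ω; P] =
      mfBmCoeff (mfBmRho B P) (mfBmEta B H P) i j *
        ((b - c) ^ (H i + H j) + (a - d) ^ (H i + H j) - (b - d) ^ (H i + H j) -
          (a - c) ^ (H i + H j)) := by
  have hpos : 0 < H i + H j := add_pos (hH i) (hH j)
  rw [covariance_fun_sub_fun_sub (hB.memLp _ _) (hB.memLp _ _) (hB.memLp _ _) (hB.memLp _ _),
    hB.covariance_eq hH h1 h2, hB.covariance_eq hH h1 h2, hB.covariance_eq hH h1 h2,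
    hB.covariance_eq hH h1 h2]
  have key : ∀ kp km x : ℝ, 0 ≤ x → powKernel (H i + H j) kp km x = kp * x ^ (H i + H j) := by
    intro kp km x hx
    rw [powKernel_eq_max hpos, max_eq_left hx, max_eq_right (by linarith),
      Real.zero_rpow hpos.ne', mul_zero, add_zero]
  rw [key _ _ (b - d) (by linarith), key _ _ (b - c) (by linarith), key _ _ (a - d) (by linarith),
    key _ _ (a - c) (by linarith)]
  ring

lemma IsMfBm.variance_increment (hB : IsMfBm B H P) {i : Fin 2} (hi : 0 < H i) {a b : ℝ}
    (hab : a ≤ b) :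
    cov[fun ω => B i b ω - B i a ω, fun ω => B i b ω - B i a ω; P] = (b - a) ^ (2 * H i) := by
  rw [covariance_fun_sub_fun_sub (hB.memLp _ _) (hB.memLp _ _) (hB.memLp _ _) (hB.memLp _ _),
    (hB.fbm i).covariance, (hB.fbm i).covariance, (hB.fbm i).covariance, (hB.fbm i).covariance,
    abs_sub_comm a b, abs_of_nonneg (by linarith : 0 ≤ b - a)]
  simp only [sub_self, abs_zero, Real.zero_rpow (by linarith : 2 * H i ≠ 0)]
  ring

/-- The limiting variance is positive. For the increments of the driving process, the normalized
sums `W n = n ^ (1 - h) ∑ ΔB⁰ ΔB¹` have limiting variance `limitVariance H 1 1 ρ η`; they stay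
positively correlated with the product of the increments over `[n, 2 n]` and `[-2 n, -n]`. -/
theorem IsMfBm.limitVariance_pos (hB : IsMfBm B H P) (hH : ∀ i, 0 < H i ∧ H i < 1)
    (hH32 : 3 / 2 < H 0 + H 1) {α ν : Fin 2 → ℝ} (hα : ∀ i, 0 < α i) (hν : ∀ i, 0 < ν i) :
    0 < limitVariance H α ν (mfBmRho B P) (mfBmEta B H P) := by
  set ρ := mfBmRho B P with hρ
  set η := mfBmEta B H P with hη
  set h := H 0 + H 1 with hh
  have hscale : limitVariance H α ν ρ η =
      ν 0 ^ 2 * ν 1 ^ 2 / (α 0 ^ 2 * α 1 ^ 2) * limitVariance H 1 1 ρ η := by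
    have h0 := (hα 0).ne'
    have h1 := (hα 1).ne'
    simp only [limitVariance, Pi.one_apply, one_pow, mul_one, one_mul, div_eq_mul_inv, mul_inv]
    ring
  rw [hscale]
  have hν0 := hν 0
  have hν1 := hν 1
  have hα0 := hα 0
  have hα1 := hα 1
  refine mul_pos (by positivity) ?_
  have hH0 : ∀ i, 0 < H i := fun i => (hH i).1
  obtain ⟨h1, h2⟩ := hurst_add_mem hH hH32 0 1
  obtain ⟨γ, hγ, htail⟩ := hB.exists_hasPowTails hH hH32
  -- The family consists of the unit increments (indexed by `some k`) and the two long increments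
  -- (indexed by `none`); `T` gives the end points of the intervals.
  let T : (n : ℕ) → Option (Fin n) × Fin 2 → ℝ × ℝ := fun n v => v.1.elim
    (if v.2 = 0 then (2 * n, n) else (-n, -(2 * n)))
    (fun k => (-(((k : ℕ) : ℤ) : ℝ) + 1, -(((k : ℕ) : ℤ) : ℝ)))
  let X : (n : ℕ) → Option (Fin n) × Fin 2 → Ω → ℝ := fun n v ω =>
    B v.2 (T n v).1 ω - B v.2 (T n v).2 ω
  have hXP : ∀ n, IsGaussianProcess (X n) P := fun n =>
    hB.isGaussianProcess_increments.comp_right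
      (fun v : Option (Fin n) × Fin 2 => ((v.2, T n v) : Fin 2 × ℝ × ℝ))
  have hX0 : ∀ n v, ∫ ω, X n v ω ∂P = 0 := fun n v => hB.integral_increment _ _ _
  let C : (n : ℕ) → Option (Fin n) → Option (Fin n) → ℝ := fun n e e' =>
    cov[X n (e, 0), X n (e', 0); P] * cov[X n (e, 1), X n (e', 1); P] +
      cov[X n (e, 0), X n (e', 1); P] * cov[X n (e, 1), X n (e', 0); P]
  have hCs : ∀ n e e', C n e e' = C n e' e := by
    intro n e e'
    simp only [C]
    rw [covariance_comm (X n (e', 0)), covariance_comm (X n (e', 1)),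
      covariance_comm (X n (e', 0)) (X n (e, 1)), covariance_comm (X n (e', 1)) (X n (e, 0))]
    ring
  have hQ : ∀ n (w : Option (Fin n) → ℝ), 0 ≤ ∑ e, ∑ e', w e * w e' * C n e e' := by
    intro n w
    rw [← cumulant_two_sum_mul (IsGaussianProcess.hasGaussianLaw_of_fintype (hXP n)) (hX0 n) w,
      cumulant_two]
    · exact variance_nonneg _ _
    · exact (memLp_finsetSum Finset.univ fun e _ => (memLp_mul_of_hasGaussianLaw
        ((hXP n).hasGaussianLaw_eval (e, 0)) ((hXP n).hasGaussianLaw_eval (e, 1)) 2).const_mul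
          (w e)).add (memLp_const 0)
  have hW : Tendsto (fun n : ℕ => ∑ k : Fin n, ∑ k' : Fin n,
      (n : ℝ) ^ (1 - h) * (n : ℝ) ^ (1 - h) * C n (some k) (some k')) atTop
      (𝓝 (limitVariance H 1 1 ρ η)) := by
    have hlim := tendsto_cumulant_bilinear hH hH32
      (X := fun _ i m ω => B i (-m + 1) ω - B i (-m) ω) (P := P)
      (fun _ => hB.isGaussianProcess_increments.comp_right
        (fun q : Fin 2 × ℤ => ((q.1, -(q.2 : ℝ) + 1, -(q.2 : ℝ)) : Fin 2 × ℝ × ℝ)))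
      (fun _ i m => hB.integral_increment i _ _) (fun _ => hγ) htail
      (κ := Unit) (fun _ => 1) (fun _ _ => 0) (fun _ => 0) (le_refl 2)
    rw [limitCumulant_two hH hH32] at hlim
    simp only [Finset.univ_unique, Finset.sum_singleton, one_pow, one_mul, mul_one, add_zero]
      at hlim
    refine hlim.congr fun n => ?_
    have h3 := cumulant_two_sum_mul (X := fun v : (Unit × Fin n) × Fin 2 => X n (some v.1.2, v.2))
      (IsGaussianProcess.hasGaussianLaw_of_fintype ((hXP n).comp_right
        (fun v : (Unit × Fin n) × Fin 2 => (some v.1.2, v.2)))) (fun v => hX0 n _)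
      (fun _ => (n : ℝ) ^ (1 - h))
    simp only [Fintype.sum_prod_type, Finset.univ_unique, Finset.sum_singleton, add_zero] at h3
    simp only [Fintype.sum_prod_type, Finset.univ_unique, Finset.sum_singleton]
    exact h3
  -- The constants in the lower bound for the correlations and in the variance of the product.
  set K := mfBmCoeff ρ η 0 1 with hK
  set E := 1 + (K * (4 ^ h + 2 ^ h - 3 ^ h - 3 ^ h)) ^ 2 with hE
  let c : Fin 2 → ℝ := fun i => 1 / 2 * (2 * H i * (2 * H i - 1) * 3 ^ (2 * H i - 2))
  have h12 := half_lt_hurst hH hH32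
  have hc : ∀ i, 0 < c i := fun i => by
    have := h12 i
    have := hH0 i
    have : 0 < 2 * H i - 1 := by linarith [h12 i]
    simp only [c]
    positivity
  have hE0 : 0 < E := by positivity
  have hstar : ∀ n : ℕ, 0 < n → C n none none = (n : ℝ) ^ (2 * h) * E := by
    intro n hn
    have hn' : (0 : ℝ) < n := by exact_mod_cast hn
    have hU : cov[X n (none, 0), X n (none, 0); P] = (2 * n - n : ℝ) ^ (2 * H 0) :=
      hB.variance_increment (hH0 0) (a := n) (b := 2 * n) (by linarith)
    have hV : cov[X n (none, 1), X n (none, 1); P] = (-n - -(2 * n) : ℝ) ^ (2 * H 1) :=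
      hB.variance_increment (hH0 1) (a := -(2 * n)) (b := -n) (by linarith)
    have hUV : cov[X n (none, 0), X n (none, 1); P] =
        K * ((2 * n - -(2 * n) : ℝ) ^ h + (n - -n : ℝ) ^ h - (2 * n - -n : ℝ) ^ h -
          (n - -(2 * n) : ℝ) ^ h) :=
      hB.covariance_increments hH0 h1 h2 0 1 (a := n) (b := 2 * n) (c := -(2 * n)) (d := -n)
        (by linarith) (by linarith) (by linarith)
    have e : (n : ℝ) ^ (2 * h) = ((n : ℝ) ^ h) ^ 2 := by
      rw [two_mul, Real.rpow_add hn']; ring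
    have e' : (n : ℝ) ^ (2 * H 0) * (n : ℝ) ^ (2 * H 1) = ((n : ℝ) ^ h) ^ 2 := by
      rw [← Real.rpow_add hn', ← e]; congr 1; rw [hh]; ring
    simp only [C]
    rw [covariance_comm (X n (none, 1)) (X n (none, 0)), hU, hV, hUV,
      show (2 * n - n : ℝ) = n by ring, show (-n - -(2 * n) : ℝ) = n by ring,
      show (2 * n - -(2 * n) : ℝ) = 4 * n by ring, show (n - -n : ℝ) = 2 * n by ring,
      show (2 * n - -n : ℝ) = 3 * n by ring, show (n - -(2 * n) : ℝ) = 3 * n by ring,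
      Real.mul_rpow (by norm_num) hn'.le, Real.mul_rpow (by norm_num) hn'.le,
      Real.mul_rpow (by norm_num) hn'.le, e', e, hE]
    ring
  have hk : ∀ n : ℕ, 0 < n → ∀ k : Fin n,
      c 0 * c 1 * (n : ℝ) ^ (2 * h - 2) ≤ C n (some k) none := by
    intro n hn k
    have hn' : (1 : ℝ) ≤ n := by exact_mod_cast hn
    have hn0 : (0 : ℝ) < n := by linarith
    set x : ℝ := (((k : ℕ) : ℤ) : ℝ) with hx
    have hx0 : 0 ≤ x := by rw [hx]; positivity
    have hxn : x + 1 ≤ n := by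
      rw [hx, Int.cast_natCast]; exact_mod_cast k.2
    have hcoeff : ∀ i, mfBmCoeff ρ η i i = 1 / 2 := fun i => by simp [mfBmCoeff]
    have hU : ∀ i, cov[X n (none, 0), X n (some k, i); P] = mfBmCoeff ρ η 0 i *
        ((2 * n - -x : ℝ) ^ (H 0 + H i) + (n - (-x + 1) : ℝ) ^ (H 0 + H i) -
          (2 * n - (-x + 1) : ℝ) ^ (H 0 + H i) - (n - -x : ℝ) ^ (H 0 + H i)) := fun i =>
      hB.covariance_increments hH0 h1 h2 0 i (a := n) (b := 2 * n) (c := -x) (d := -x + 1)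
        (by linarith) (by linarith) (by linarith)
    have hV : ∀ i, cov[X n (some k, i), X n (none, 1); P] = mfBmCoeff ρ η i 1 *
        ((-x + 1 - -(2 * n) : ℝ) ^ (H i + H 1) + (-x - -n : ℝ) ^ (H i + H 1) -
          (-x + 1 - -n : ℝ) ^ (H i + H 1) - (-x - -(2 * n) : ℝ) ^ (H i + H 1)) := fun i =>
      hB.covariance_increments hH0 h1 h2 i 1 (a := -x) (b := -x + 1) (c := -(2 * n)) (d := -n)
        (by linarith) (by linarith) (by linarith)
    have rU : ∀ i, _ := fun i => le_rpow_rectangle (h := H 0 + H i) (a := n) (b := 2 * n) (c := -x)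
      (d := -x + 1) (R := 3 * n) (hurst_add_mem hH hH32 0 i).1 (hurst_add_mem hH hH32 0 i).2.le
      (by linarith) (by linarith) (by linarith) (by linarith)
    have rV : ∀ i, _ := fun i => le_rpow_rectangle (h := H i + H 1) (a := -x) (b := -x + 1)
      (c := -(2 * n)) (d := -n) (R := 3 * n) (hurst_add_mem hH hH32 i 1).1
      (hurst_add_mem hH hH32 i 1).2.le (by linarith) (by linarith) (by linarith) (by linarith)
    have hpow : ∀ i, (n : ℝ) * (3 * n) ^ (2 * H i - 2) =
        3 ^ (2 * H i - 2) * (n : ℝ) ^ (2 * H i - 1) := by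
      intro i
      rw [Real.mul_rpow (by norm_num) hn0.le, show 2 * H i - 1 = 2 * H i - 2 + 1 by ring,
        Real.rpow_add_one hn0.ne']
      ring
    have hlow : ∀ i, 0 ≤ c i * (n : ℝ) ^ (2 * H i - 1) := fun i =>
      mul_nonneg (hc i).le (by positivity)
    have l0 : c 0 * (n : ℝ) ^ (2 * H 0 - 1) ≤ cov[X n (some k, 0), X n (none, 0); P] := by
      rw [covariance_comm, hU, hcoeff]
      have := rU 0
      rw [← two_mul] at this ⊢
      simp only [c]
      linear_combination 1 / 2 * this - H 0 * (2 * H 0 - 1) * hpow 0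
    have l1 : c 1 * (n : ℝ) ^ (2 * H 1 - 1) ≤ cov[X n (some k, 1), X n (none, 1); P] := by
      rw [hV, hcoeff]
      have := rV 1
      rw [← two_mul] at this ⊢
      simp only [c]
      linear_combination 1 / 2 * this - H 1 * (2 * H 1 - 1) * hpow 1
    -- In both cross-covariances the increment of `B 0` is the later one, so the same coefficient
    -- `K` occurs twice.
    have lcross : 0 ≤ cov[X n (some k, 0), X n (none, 1); P] *
        cov[X n (some k, 1), X n (none, 0); P] := by
      rw [covariance_comm (X n (some k, 1)), hU, hV]
      have hh1 : 0 < H 0 + H 1 - 1 := by linarith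
      have hh0 : 0 < H 0 + H 1 := by linarith
      have g : ∀ y z : ℝ, 0 < y → 0 < z →
          0 ≤ (H 0 + H 1) * (H 0 + H 1 - 1) * y * z * (3 * (n : ℝ)) ^ (H 0 + H 1 - 2) :=
        fun y z hy hz => by positivity
      have g1 := (g _ _ (by linarith) (by linarith)).trans (rU 1)
      have g2 := (g _ _ (by linarith) (by linarith)).trans (rV 0)
      have := mul_nonneg (mul_nonneg (sq_nonneg K) g2) g1
      linear_combination this
    have e : (n : ℝ) ^ (2 * h - 2) = (n : ℝ) ^ (2 * H 0 - 1) * (n : ℝ) ^ (2 * H 1 - 1) := by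
      rw [← Real.rpow_add hn0]; congr 1; rw [hh]; ring
    have := mul_le_mul l0 l1 (hlow 1) ((hlow 0).trans l0)
    rw [e]
    simp only [C]
    linear_combination this + lcross
  -- The variance of `W n - τ V n` is nonnegative.
  have hineq : ∀ τ : ℝ, 0 ≤ τ → 0 ≤ limitVariance H 1 1 ρ η - 2 * τ * (c 0 * c 1) + τ ^ 2 * E := by
    intro τ hτ
    refine ge_of_tendsto ((hW.sub_const _).add_const _) ?_
    filter_upwards [eventually_gt_atTop 0] with n hn
    have hn' : (0 : ℝ) < n := by exact_mod_cast hn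
    have hq := hQ n (fun e => e.elim (-τ * (n : ℝ) ^ (-h)) fun _ => (n : ℝ) ^ (1 - h))
    simp only [Fintype.sum_option, Option.elim, hCs n none (some _), Finset.sum_add_distrib,
      hstar n hn] at hq
    have e1 : (n : ℝ) ^ (-h) * (n : ℝ) ^ (-h) * (n : ℝ) ^ (2 * h) = 1 := by
      rw [← Real.rpow_add hn', ← Real.rpow_add hn', show -h + -h + 2 * h = 0 by ring,
        Real.rpow_zero]
    have e2 : (n : ℝ) ^ (-h) * (n : ℝ) ^ (1 - h) * ((n : ℝ) * (n : ℝ) ^ (2 * h - 2)) = 1 := by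
      rw [← Real.rpow_one_add' hn'.le (by linarith), ← Real.rpow_add hn', ← Real.rpow_add hn',
        show -h + (1 - h) + (1 + (2 * h - 2)) = 0 by ring, Real.rpow_zero]
    have e3 : (n : ℝ) ^ (-h) * (n : ℝ) ^ (1 - h) * ∑ k : Fin n, C n (some k) none ≥ c 0 * c 1 := by
      have : ∑ k : Fin n, C n (some k) none ≥ ∑ _k : Fin n, c 0 * c 1 * (n : ℝ) ^ (2 * h - 2) :=
        Finset.sum_le_sum fun k _ => hk n hn k
      rw [Finset.sum_const, Finset.card_univ, Fintype.card_fin, nsmul_eq_mul] at this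
      calc (n : ℝ) ^ (-h) * (n : ℝ) ^ (1 - h) * ∑ k : Fin n, C n (some k) none
          ≥ (n : ℝ) ^ (-h) * (n : ℝ) ^ (1 - h) * (n * (c 0 * c 1 * (n : ℝ) ^ (2 * h - 2))) :=
            mul_le_mul_of_nonneg_left this (by positivity)
        _ = c 0 * c 1 := by linear_combination c 0 * c 1 * e2
    have e4 : ∑ k : Fin n, -τ * (n : ℝ) ^ (-h) * (n : ℝ) ^ (1 - h) * C n (some k) none =
        -τ * ((n : ℝ) ^ (-h) * (n : ℝ) ^ (1 - h) * ∑ k : Fin n, C n (some k) none) := by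
      rw [← Finset.mul_sum]; ring
    have e5 : ∑ k : Fin n, (n : ℝ) ^ (1 - h) * (-τ * (n : ℝ) ^ (-h)) * C n (some k) none =
        -τ * ((n : ℝ) ^ (-h) * (n : ℝ) ^ (1 - h) * ∑ k : Fin n, C n (some k) none) := by
      rw [← Finset.mul_sum]; ring
    rw [e4, e5] at hq
    have e6 := mul_le_mul_of_nonneg_left e3 hτ
    linear_combination hq + 2 * e6 + τ ^ 2 * E * e1
  -- The minimum of the quadratic polynomial in `τ`.
  have := hineq (c 0 * c 1 / E) (div_nonneg (mul_pos (hc 0) (hc 1)).le hE0.le)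
  have h5 : 0 < (c 0 * c 1) ^ 2 / E := div_pos (pow_pos (mul_pos (hc 0) (hc 1)) 2) hE0
  have h6 : - 2 * (c 0 * c 1 / E) * (c 0 * c 1) + (c 0 * c 1 / E) ^ 2 * E =
      -((c 0 * c 1) ^ 2 / E) := by
    field_simp
    ring
  linarith

end Positivity

/-! ### The limit theorem -/

theorem theorem3p8 {Ω : Type*} [MeasurableSpace Ω] (P : Measure Ω) [IsProbabilityMeasure P]
    (H α ν : Fin 2 → ℝ) (hH : ∀ i, 0 < H i ∧ H i < 1) (hα : ∀ i, 0 < α i) (hν : ∀ i, 0 < ν i)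
    (hH32 : 3 / 2 < H 0 + H 1)
    (B Y : Fin 2 → ℝ → Ω → ℝ) (hB : IsMfBm B H P) (hY : IsMfOU Y B α ν P)
    (ρ η : ℝ) (hρ : ρ = mfBmRho B P) (hη : η = mfBmEta B H P)
    (s : ℕ) (a₁ a₂ a₃ : ℝ) (ha : a₁ + a₂ + a₃ ≠ 0) :
    (∀ n q : ℕ, MemLp (rescaledStat Y (H 0 + H 1) ρ a₁ a₂ a₃ s n) q P) ∧
    (∀ p : ℕ, 2 ≤ p →
      (∀ i j : Fin p → Fin 2, Admissible p i j →
        IntegrableOn (cyclicProd H α ν ρ η p i j) (Set.Icc (0 : Fin p → ℝ) 1)) ∧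
      Tendsto (fun n : ℕ => cumulant p (rescaledStat Y (H 0 + H 1) ρ a₁ a₂ a₃ s n) P) atTop
        (𝓝 (limitCumulant H α ν ρ η (a₁ + a₂ + a₃) p))) ∧
    Tendsto (fun n : ℕ =>
        Var[rescaledStat Y (H 0 + H 1) ρ a₁ a₂ a₃ s n; P] / (a₁ + a₂ + a₃) ^ 2) atTop
      (𝓝 (limitVariance H α ν ρ η)) ∧
    0 < limitVariance H α ν ρ η := by
  subst hρ hη
  have hlim : ∀ p : ℕ, 2 ≤ p → Tendsto (fun n : ℕ => cumulant p
      (rescaledStat Y (H 0 + H 1) (mfBmRho B P) a₁ a₂ a₃ s n) P) atTop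
      (𝓝 (limitCumulant H α ν (mfBmRho B P) (mfBmEta B H P) (a₁ + a₂ + a₃) p)) := fun p hp =>
    tendsto_cumulant_rescaledStat hB hY hH hH32 hα hν _ s a₁ a₂ a₃ hp
  refine ⟨fun n q => memLp_rescaledStat hY _ _ a₁ a₂ a₃ s n q, fun p hp =>
    ⟨fun i j hij => integrableOn_cyclicProd hH hH32 α ν _ _ hp hij, hlim p hp⟩, ?_,
    hB.limitVariance_pos hH hH32 hα hν⟩
  have h2 := (hlim 2 le_rfl).div_const ((a₁ + a₂ + a₃) ^ 2)
  rw [limitCumulant_two hH hH32, mul_div_cancel_left₀ _ (pow_ne_zero 2 ha)] at h2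
  refine h2.congr fun n => ?_
  rw [cumulant_two]
  exact_mod_cast memLp_rescaledStat hY (H 0 + H 1) (mfBmRho B P) a₁ a₂ a₃ s n 2
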